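/- Let $p$ be a prime and let $\mathbb H_{\mathbb Z/p,3}$ be the Heisenberg group of matrices $M(x,y,z)=\begin{pmatrix}1&x&z\\0&1&y\\0&0&1\end{pmatrix}$ over $\mathbb Z/p$. A surjection of (profinite) groups is a Frattini cover if every proper (closed) subgroup of the source has proper image. Then $\mathbb H_{\mathbb Z/p,3}\to(\mathbb Z/p)^2$, $M(x,y,z)\mapsto(x,y)$, is a Frattini cover. Suppose moreover that $p$ is odd. For an abelian group $A$ let $A\rtimes\mathbb Z/2$ be the semidirect product with $\mathbb Z/2=\{\pm1\}$ acting by $a\mapsto\pm a$, and let $G_0=(\mathbb Z/p)^2\rtimes\mathbb Z/2$. The universal $p$-Frattini cover $\psi:\tilde G\to G_0$ is the Frattini cover by a profinite group $\tilde G$ that has pro-$p$ kernel and is versal for all extensions of $G_0$ by finite $p$-groups; it exists. For a pro-$p$ group $P$ let $\Phi(P)$ be the closed subgroup generated by $p$-th powers and commutators, and put $G_k=\tilde G/\Phi^k(\ker\psi)$ for $k\ge 0$ and $M_0=\ker(G_1\to G_0)=\ker\psi/\Phi(\ker\psi)$, an $\mathbb F_p[G_0]$-module by conjugation (the $p$-Frattini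 module). Let $\mathbf 1$ be the trivial one-dimensional $\mathbb F_p[G_0]$-module and $\mathbf 1^-$ the one on which $(\mathbb Z/p)^2$ acts trivially and $-1\in\mathbb Z/2$ acts by $-1$. For a quotient $H$ of $\tilde G$ by a closed normal subgroup contained in $\ker\psi$, let $\mathrm{Ni}(H,\mathbf C_{2^4})$ be the set of 4-tuples $(g_1,\dots,g_4)$ that generate $H$, satisfy $g_1g_2g_3g_4=1$, and whose entries have order prime to $p$ and map into the conjugacy class of $-1$ in $G_0$. The same definition is used for any cover $H\to G_0$ with $p$-group kernel. 1. With $J$ the Jacobson radical of $\mathbb F_p[G_0]$, the head $M_0/JM_0$ is isomorphic to $\mathbf 1\oplus\mathbf 1^-\oplus\mathbf 1^-$. 2. There is exactly one submodule $W\le M_0$ with $M_0/W\cong\mathbf 1$, and the corresponding extension $G_1/W\to G_0$ is isomorphic, over $G_0$, to $\mathbb H_{\mathbb Z/p,3}\rtimes\mathbb Z/2\to G_0$, where $-1$ acts by $M(x,y,z)\mapsto M(-x,-y,z)$ and the map is induced by $M(x,y,z)\mapsto(x,y)$. 3. This extension obstructs the tower at level 1: $\mathrm{Ni}(G_0,\mathbf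 C_{2^4})$ is nonempty; every $(g_1,\dots,g_4)$ in it has a unique lift $(h_1,\dots,h_4)$ to $\mathbb H_{\mathbb Z/p,3}\rtimes\mathbb Z/2$ with entries of order prime to $p$, and $h_1h_2h_3h_4\ne1$. Consequently $\mathrm{Ni}(G_1,\mathbf C_{2^4})=\emptyset$. 4. Consider directed paths: a directed family of finite quotients $H_i$ of $\tilde G$ covering $G_0$, together with a projective system of elements ${}_i g\in\mathrm{Ni}(H_i,\mathbf C_{2^4})$. Paths are compared by inclusion of their families of cusp sets, the cusp set of ${}_ig$ being its orbit under conjugation by $H_i$ and the cusp group $\mathrm{Cu}_4=\langle q_2,(q_1q_2q_3)^2,q_1q_3^{-1}\rangle$, where the braid $q_i$ replaces $(g_i,g_{i+1})$ by $(g_ig_{i+1}g_i^{-1},g_i)$. Maximal paths exist, every maximal path goes through level $0$ (one of the $H_i$ is $G_0$) but through no level $k\ge1$ (no $H_i$ is $G_k$), and its limit group $\varprojlim H_i$ is infinite and isomorphic, as a topological group over $G_0$, to $(\mathbb Z_p)^2\rtimes\mathbb Z/2$. -/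

import Mathlib

universe u

/-! ### Frattini covers and the universal `p`-Frattini cover -/

/-- A Frattini cover of (abstract, e.g. finite) groups: a surjection under which every proper
subgroup has proper image. -/
def IsFrattiniCover {H G : Type*} [Group H] [Group G] (f : H →* G) : Prop :=
  Function.Surjective f ∧ ∀ K : Subgroup H, K.map f = ⊤ → K = ⊤

/-- `ψ : Γ → G` is a universal `p`-Frattini cover of the finite (discrete) group `G`, for `Γ` a
profinite group: `ψ` is continuous and surjective with pro-`p` kernel, it is a Frattini cover of
profinite groups (every proper closed subgroup has proper image), and it is versal for the
extensions of `G` by finite `p`-groups. -/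
structure IsUniversalPFrattiniCover (p : ℕ) {Γ : Type*} [Group Γ] [TopologicalSpace Γ]
    [IsTopologicalGroup Γ] {G : Type} [Group G] (ψ : Γ →* G) : Prop where
  isOpen_ker : IsOpen (ψ.ker : Set Γ)
  surjective : Function.Surjective ψ
  proP_ker : ∀ U : OpenNormalSubgroup Γ,
    IsPGroup p (ψ.ker.map (QuotientGroup.mk' (U : Subgroup Γ)))
  frattini : ∀ K : Subgroup Γ, IsClosed (K : Set Γ) → K.map ψ = ⊤ → K = ⊤
  versal : ∀ (H : Type) [Group H] [Finite H] (φ : H →* G), Function.Surjective φ →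
    IsPGroup p φ.ker → ∃ μ : Γ →* H, IsOpen (μ.ker : Set Γ) ∧ φ.comp μ = ψ

/-! ### The pro-`p` Frattini subgroup and the characteristic quotients -/

section Frattini

variable (p : ℕ) (P : Type*) [Group P] [TopologicalSpace P] [IsTopologicalGroup P]

/-- `Φ(P)`: the closure of the subgroup generated by `p`-th powers and commutators. -/
def proPFrattini : Subgroup P :=
  (Subgroup.closure
    ({x | ∃ y : P, y ^ p = x} ∪ {x | ∃ a b : P, a * b * a⁻¹ * b⁻¹ = x})).topologicalClosure

theorem commutator_mem_proPFrattini (a b : P) : a * b * a⁻¹ * b⁻¹ ∈ proPFrattini p P :=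
  Subgroup.le_topologicalClosure _ (Subgroup.subset_closure (Or.inr ⟨a, b, rfl⟩))

theorem pow_mem_proPFrattini (a : P) : a ^ p ∈ proPFrattini p P :=
  Subgroup.le_topologicalClosure _ (Subgroup.subset_closure (Or.inl ⟨a, rfl⟩))

instance proPFrattini_normal : (proPFrattini p P).Normal := by
  refine ⟨fun n hn g => ?_⟩
  have h := (proPFrattini p P).mul_mem (commutator_mem_proPFrattini p P g n) hn
  simpa using h

variable {P} in
/-- `Φ(P)` is stable under continuous endomorphisms. -/
theorem map_mem_proPFrattini (f : P →* P) (hf : Continuous f) {x : P}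
    (hx : x ∈ proPFrattini p P) : f x ∈ proPFrattini p P := by
  refine map_mem_closure (t := ((Subgroup.closure ({x | ∃ y : P, y ^ p = x} ∪
    {x | ∃ a b : P, a * b * a⁻¹ * b⁻¹ = x}) : Subgroup P) : Set P)) hf hx ?_
  intro y hy
  refine Subgroup.closure_induction (p := fun y _ => f y ∈ Subgroup.closure
    ({x | ∃ y : P, y ^ p = x} ∪ {x | ∃ a b : P, a * b * a⁻¹ * b⁻¹ = x})) ?_ ?_ ?_ ?_ hy
  · rintro z (⟨w, rfl⟩ | ⟨a, b, rfl⟩)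
    · exact Subgroup.subset_closure (Or.inl ⟨f w, by simp⟩)
    · exact Subgroup.subset_closure (Or.inr ⟨f a, f b, by simp⟩)
  · simp
  · intro a b _ _ ha hb
    simpa using Subgroup.mul_mem _ ha hb
  · intro a _ ha
    simpa using Subgroup.inv_mem _ ha

instance proPFrattiniQuotient_commGroup : CommGroup (P ⧸ proPFrattini p P) :=
  { (inferInstance : Group (P ⧸ proPFrattini p P)) with
    mul_comm := by
      intro x y
      obtain ⟨a, rfl⟩ := QuotientGroup.mk_surjective x
      obtain ⟨b, rfl⟩ := QuotientGroup.mk_surjective y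
      rw [← QuotientGroup.mk_mul, ← QuotientGroup.mk_mul, QuotientGroup.eq]
      have h := commutator_mem_proPFrattini p P b⁻¹ a⁻¹
      simpa [mul_assoc] using h }

end Frattini

section Levels

variable (p : ℕ) {Γ : Type*} [Group Γ] [TopologicalSpace Γ] [IsTopologicalGroup Γ]
  {G : Type*} [Group G] (ψ : Γ →* G)

theorem continuous_conjNormal (N : Subgroup Γ) [N.Normal] (γ : Γ) :
    Continuous (MulAut.conjNormal γ : MulAut N) := by
  refine Continuous.subtype_mk (f := fun x : N => γ * (x : Γ) * γ⁻¹) ?_ _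
  fun_prop

/-- The subgroups `Φ^k(ker ψ)` of `Γ`. The `k`-th characteristic `p`-Frattini cover `G_k` of `G` is
`Γ ⧸ levelKer p ψ k` when `ψ` is the universal `p`-Frattini cover. -/
def levelKer : ℕ → Subgroup Γ
  | 0 => ψ.ker
  | k + 1 => (proPFrattini p (levelKer k)).map (levelKer k).subtype

instance levelKer_normal (k : ℕ) : (levelKer p ψ k).Normal := by
  induction k with
  | zero => exact MonoidHom.normal_ker ψ
  | succ k ih =>
    refine ⟨fun n hn g => ?_⟩
    obtain ⟨m, hm, rfl⟩ := hn
    exact ⟨MulAut.conjNormal g m, map_mem_proPFrattini p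
      (MulAut.conjNormal g : MulAut (levelKer p ψ k)).toMonoidHom
      (continuous_conjNormal _ g) hm, by simp⟩

theorem levelKer_le_ker (k : ℕ) : levelKer p ψ k ≤ ψ.ker := by
  induction k with
  | zero => exact le_rfl
  | succ k ih => exact (Subgroup.map_subtype_le _).trans ih

/-- The covering map `G_k → G`. -/
def levelMap (k : ℕ) : Γ ⧸ levelKer p ψ k →* G :=
  QuotientGroup.lift (levelKer p ψ k) ψ (levelKer_le_ker p ψ k)

/-! ### The `p`-Frattini module `M₀ = ker(G₁ → G₀)` -/

/-- `M₀ = ker ψ / Φ(ker ψ)`, that is `ker (G₁ → G₀)`, written additively. -/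
abbrev PFrattiniModule : Type _ := Additive (ψ.ker ⧸ proPFrattini p ψ.ker)

instance pFrattiniModule_module : Module (ZMod p) (PFrattiniModule p ψ) :=
  AddCommGroup.zmodModule (by
    intro x
    obtain ⟨y, rfl⟩ := Additive.ofMul.surjective x
    obtain ⟨a, rfl⟩ := QuotientGroup.mk_surjective y
    rw [← ofMul_pow, ← QuotientGroup.mk_pow,
      (QuotientGroup.eq_one_iff _).2 (pow_mem_proPFrattini p ψ.ker a)]
    rfl)

/-- Conjugation by `γ ∈ Γ` on `M₀`. -/
def pFrattiniConj (γ : Γ) : PFrattiniModule p ψ →ₗ[ZMod p] PFrattiniModule p ψ :=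
  AddMonoidHom.toZModLinearMap p (MonoidHom.toAdditive
    (QuotientGroup.map (proPFrattini p ψ.ker) (proPFrattini p ψ.ker)
      (MulAut.conjNormal γ : MulAut ψ.ker).toMonoidHom
      (fun _ hx => map_mem_proPFrattini p
        (MulAut.conjNormal γ : MulAut ψ.ker).toMonoidHom (continuous_conjNormal ψ.ker γ) hx)))

theorem pFrattiniConj_mk (γ : Γ) (a : ψ.ker) :
    pFrattiniConj p ψ γ (Additive.ofMul (QuotientGroup.mk a)) =
      Additive.ofMul (QuotientGroup.mk (MulAut.conjNormal γ a)) := rfl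

theorem pFrattiniModule_ind {q : PFrattiniModule p ψ → Prop}
    (h : ∀ a : ψ.ker, q (Additive.ofMul (QuotientGroup.mk a))) (x : PFrattiniModule p ψ) : q x := by
  obtain ⟨y, rfl⟩ := Additive.ofMul.surjective x
  obtain ⟨a, rfl⟩ := QuotientGroup.mk_surjective y
  exact h a

theorem pFrattiniConj_mul (γ δ : Γ) :
    pFrattiniConj p ψ (γ * δ) = pFrattiniConj p ψ γ * pFrattiniConj p ψ δ := by
  refine LinearMap.ext (pFrattiniModule_ind p ψ fun a => ?_)
  simp [pFrattiniConj_mk]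

theorem pFrattiniConj_eq_one {γ : Γ} (hγ : γ ∈ ψ.ker) : pFrattiniConj p ψ γ = 1 := by
  refine LinearMap.ext (pFrattiniModule_ind p ψ fun a => ?_)
  rw [pFrattiniConj_mk]
  refine congrArg Additive.ofMul (QuotientGroup.eq.2 ?_)
  have h := commutator_mem_proPFrattini p ψ.ker (⟨γ, hγ⟩ : ψ.ker) a⁻¹
  convert h using 1
  ext
  simp [mul_assoc]

theorem pFrattiniConj_eq_of_eq {γ δ : Γ} (h : ψ γ = ψ δ) :
    pFrattiniConj p ψ γ = pFrattiniConj p ψ δ := by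
  have hk : γ * δ⁻¹ ∈ ψ.ker := by simp [MonoidHom.mem_ker, h]
  have : γ = (γ * δ⁻¹) * δ := by group
  rw [this, pFrattiniConj_mul, pFrattiniConj_eq_one p ψ hk, one_mul]

/-- The action of `G` on `M₀`: an element `g` acts through conjugation by any lift to `Γ`. -/
noncomputable def pFrattiniRep (hψ : Function.Surjective ψ) :
    Representation (ZMod p) G (PFrattiniModule p ψ) where
  toFun g := pFrattiniConj p ψ (Function.surjInv hψ g)
  map_one' := pFrattiniConj_eq_one p ψ (Function.surjInv_eq hψ 1)
  map_mul' g h := by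
    rw [← pFrattiniConj_mul]
    exact pFrattiniConj_eq_of_eq p ψ (by simp [Function.surjInv_eq])

theorem pFrattiniRep_apply (hψ : Function.Surjective ψ) (γ : Γ) :
    pFrattiniRep p ψ hψ (ψ γ) = pFrattiniConj p ψ γ :=
  pFrattiniConj_eq_of_eq p ψ (Function.surjInv_eq hψ _)

/-- For a submodule `W` of `M₀`, the preimage of `W` in `ker ψ`, as a subgroup of `Γ`. The extension
of `G` with kernel `M₀ / W` that is a quotient of `G₁` is `Γ ⧸ extensionKer W = G₁ / W`. -/
def extensionKer (hψ : Function.Surjective ψ)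
    (W : Submodule (MonoidAlgebra (ZMod p) G) (pFrattiniRep p ψ hψ).asModule) : Subgroup Γ where
  carrier := {γ | ∃ h : γ ∈ ψ.ker, (pFrattiniRep p ψ hψ).asModuleEquiv.symm
    (Additive.ofMul (QuotientGroup.mk (⟨γ, h⟩ : ψ.ker))) ∈ W}
  one_mem' := ⟨ψ.ker.one_mem, W.zero_mem⟩
  mul_mem' := by
    rintro a b ⟨ha, ha'⟩ ⟨hb, hb'⟩
    exact ⟨ψ.ker.mul_mem ha hb, W.add_mem ha' hb'⟩
  inv_mem' := by
    rintro a ⟨ha, ha'⟩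
    exact ⟨ψ.ker.inv_mem ha, W.neg_mem ha'⟩

end Levels

/-- The head (first Loewy layer) `M / J M` of a module `M`, with `J` the Jacobson radical. -/
abbrev ModuleHead (R M : Type*) [Ring R] [AddCommGroup M] [Module R M] : Type _ :=
  M ⧸ (Ring.jacobson R • (⊤ : Submodule R M))

/-! ### The groups `A ⋊ {±1}` -/

/-- The action of `{±1}` on an abelian group by multiplication. -/
def signAut (A : Type*) [AddCommGroup A] : ℤˣ →* MulAut (Multiplicative A) where
  toFun ε :=
    { toFun := fun a => Multiplicative.ofAdd ((ε : ℤ) • a.toAdd)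
      invFun := fun a => Multiplicative.ofAdd ((ε : ℤ) • a.toAdd)
      left_inv := fun a => by rcases Int.units_eq_one_or ε with rfl | rfl <;> simp
      right_inv := fun a => by rcases Int.units_eq_one_or ε with rfl | rfl <;> simp
      map_mul' := fun a b => by simp [smul_add] }
  map_one' := by ext a; simp
  map_mul' ε δ := by ext a; simp [mul_smul]

/-- `A ⋊ {±1}`, with `-1` acting on `A` by inversion. -/
abbrev SignSemidirect (A : Type*) [AddCommGroup A] : Type _ :=
  Multiplicative A ⋊[signAut A] ℤˣ

/-- The product topology (`{±1}` is discrete). -/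
instance signSemidirect_topology (A : Type*) [AddCommGroup A] [TopologicalSpace A] :
    TopologicalSpace (SignSemidirect A) :=
  TopologicalSpace.induced (fun x => (x.left.toAdd, x.right)) inferInstance

/-- The map `A ⋊ {±1} → B ⋊ {±1}` induced by `A → B`. -/
def SignSemidirect.map {A B : Type*} [AddCommGroup A] [AddCommGroup B] (f : A →+ B) :
    SignSemidirect A →* SignSemidirect B :=
  SemidirectProduct.map (AddMonoidHom.toMultiplicative f) (MonoidHom.id ℤˣ)
    (fun ε => by ext a; simp [signAut])

/-- The element `-1` of `A ⋊ {±1}`. -/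
def SignSemidirect.negOne (A : Type*) [AddCommGroup A] : SignSemidirect A :=
  SemidirectProduct.inr (-1)

/-- The representation `𝟏⁻` over `k`: `A` acts trivially and `-1` acts as multiplication
by `-1`. -/
def signRep (k A : Type*) [CommRing k] [AddCommGroup A] :
    Representation k (SignSemidirect A) k where
  toFun g := ((g.right : ℤ) : k) • LinearMap.id
  map_one' := by ext; simp
  map_mul' g h := by ext; simp [mul_comm]

/-! ### The Heisenberg group -/

/-- The Heisenberg group of matrices `M(x,y,z) = !![1, x, z; 0, 1, y; 0, 0, 1]`. -/
@[ext] structure Heisenberg (R : Type*) where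
  x : R
  y : R
  z : R

namespace Heisenberg

variable {R : Type*} [CommRing R]

/-- The matrix `M(x,y,z)`. -/
def toMatrix (h : Heisenberg R) : Matrix (Fin 3) (Fin 3) R :=
  !![1, h.x, h.z; 0, 1, h.y; 0, 0, 1]

instance : Mul (Heisenberg R) := ⟨fun a b => ⟨a.x + b.x, a.y + b.y, a.z + b.z + a.x * b.y⟩⟩
instance : One (Heisenberg R) := ⟨⟨0, 0, 0⟩⟩
instance : Inv (Heisenberg R) := ⟨fun a => ⟨-a.x, -a.y, a.x * a.y - a.z⟩⟩

@[simp] theorem mul_x (a b : Heisenberg R) : (a * b).x = a.x + b.x := rfl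
@[simp] theorem mul_y (a b : Heisenberg R) : (a * b).y = a.y + b.y := rfl
@[simp] theorem mul_z (a b : Heisenberg R) : (a * b).z = a.z + b.z + a.x * b.y := rfl
@[simp] theorem one_x : (1 : Heisenberg R).x = 0 := rfl
@[simp] theorem one_y : (1 : Heisenberg R).y = 0 := rfl
@[simp] theorem one_z : (1 : Heisenberg R).z = 0 := rfl
@[simp] theorem inv_x (a : Heisenberg R) : a⁻¹.x = -a.x := rfl
@[simp] theorem inv_y (a : Heisenberg R) : a⁻¹.y = -a.y := rfl
@[simp] theorem inv_z (a : Heisenberg R) : a⁻¹.z = a.x * a.y - a.z := rfl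

instance : Group (Heisenberg R) :=
  Group.ofLeftAxioms
    (fun a b c => by ext <;> simp <;> ring)
    (fun a => by ext <;> simp)
    (fun a => by ext <;> simp)

/-- The group law is matrix multiplication. -/
theorem toMatrix_mul (a b : Heisenberg R) : (a * b).toMatrix = a.toMatrix * b.toMatrix := by
  ext i j
  fin_cases i <;> fin_cases j <;>
    simp [toMatrix, Matrix.mul_apply, Fin.sum_univ_three]
  all_goals ring

theorem toMatrix_one : (1 : Heisenberg R).toMatrix = 1 := by
  ext i j
  fin_cases i <;> fin_cases j <;> simp [toMatrix]

theorem toMatrix_injective : Function.Injective (toMatrix : Heisenberg R → _) := by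
  intro a b h
  have h1 := congrFun (congrFun h 0) 1
  have h2 := congrFun (congrFun h 1) 2
  have h3 := congrFun (congrFun h 0) 2
  simp only [toMatrix, Matrix.of_apply, Matrix.cons_val] at h1 h2 h3
  exact Heisenberg.ext h1 h2 h3

variable (R)

/-- `M(x,y,z) ↦ (x,y)`. -/
def proj : Heisenberg R →* Multiplicative (R × R) where
  toFun h := Multiplicative.ofAdd (h.x, h.y)
  map_one' := rfl
  map_mul' _ _ := rfl

/-- `{±1}` acts by `M(x,y,z) ↦ M(±x,±y,z)`. -/
def signAut : ℤˣ →* MulAut (Heisenberg R) where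
  toFun ε :=
    { toFun := fun h => ⟨(ε : ℤ) • h.x, (ε : ℤ) • h.y, h.z⟩
      invFun := fun h => ⟨(ε : ℤ) • h.x, (ε : ℤ) • h.y, h.z⟩
      left_inv := fun a => by rcases Int.units_eq_one_or ε with rfl | rfl <;> simp
      right_inv := fun a => by rcases Int.units_eq_one_or ε with rfl | rfl <;> simp
      map_mul' := fun a b => by
        rcases Int.units_eq_one_or ε with rfl | rfl <;> ext <;> simp }
  map_one' := by ext a <;> simp
  map_mul' ε δ := by ext a <;> simp [mul_assoc]

end Heisenberg

/-- `ℍ_{R,3} ⋊ {±1}`. -/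
abbrev HeisenbergSign (R : Type*) [CommRing R] : Type _ :=
  Heisenberg R ⋊[Heisenberg.signAut R] ℤˣ

/-- The map `ℍ_{R,3} ⋊ {±1} → R² ⋊ {±1}` induced by `M(x,y,z) ↦ (x,y)`. -/
def HeisenbergSign.proj (R : Type*) [CommRing R] :
    HeisenbergSign R →* SignSemidirect (R × R) :=
  SemidirectProduct.map (Heisenberg.proj R) (MonoidHom.id ℤˣ) (fun _ => rfl)

/-! ### Nielsen classes -/

section Nielsen

variable (p : ℕ) {H G : Type*} [Group H] [Group G] {r : ℕ}

/-- The Nielsen class `Ni(H, C)` for a cover `f : H → G` of finite groups with `p`-group kernel and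
`p'` conjugacy classes `C = (C₁, …, C_r)` of `G`, where `C_i` also denotes the unique `p'` conjugacy
class of `H` above `C_i` (the elements of order prime to `p` with image in `C_i`). It consists of
the generating `r`-tuples with product one that lie in the classes `C` in some order. For
`f = MonoidHom.id G` this is `Ni(G, C)`. -/
def NielsenClass (f : H →* G) (C : Fin r → ConjClasses G) : Set (Fin r → H) :=
  {g | (∃ π : Equiv.Perm (Fin r), ∀ i, (orderOf (g (π i))).Coprime p ∧
      ConjClasses.mk (f (g (π i))) = C i) ∧
    Subgroup.closure (Set.range g) = ⊤ ∧ (List.ofFn g).prod = 1}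

/-- `h` is a lift of the tuple `g` to `H` with entries of order prime to `p`. When `f` is a central
Frattini extension with `p`-group kernel and `g` is in a Nielsen class of `p'` classes, `h` is
unique, and the small lifting invariant of `g` is the product `h₁ ⋯ h_r`. -/
def IsPrimeLift (f : H →* G) (g : Fin r → G) (h : Fin r → H) : Prop :=
  ∀ i, (orderOf (h i)).Coprime p ∧ f (h i) = g i

end Nielsen

/-- The classes `C_{2⁴}`: four repetitions of the class of `-1`. -/
def classes24 (A : Type*) [AddCommGroup A] : Fin 4 → ConjClasses (SignSemidirect A) :=
  fun _ => ConjClasses.mk (SignSemidirect.negOne A)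

/-! ### Braids, cusp sets, and limit groups -/

section Cusp

variable {H : Type*} [Group H]

/-- The braid `q₁`. -/
def braid1 (g : Fin 4 → H) : Fin 4 → H := ![g 0 * g 1 * (g 0)⁻¹, g 0, g 2, g 3]
/-- The braid `q₂`. -/
def braid2 (g : Fin 4 → H) : Fin 4 → H := ![g 0, g 1 * g 2 * (g 1)⁻¹, g 1, g 3]
/-- The braid `q₃`. -/
def braid3 (g : Fin 4 → H) : Fin 4 → H := ![g 0, g 1, g 2 * g 3 * (g 2)⁻¹, g 2]

/-- One generating step of the equivalence defining cusp sets on inner Nielsen classes: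
conjugation by an element of `H`, or one of the generators `q₂`, `(q₁q₂q₃)²`, `q₁q₃⁻¹` of
the cusp group `Cu₄` (braids act on the right). -/
inductive CuspStep : (Fin 4 → H) → (Fin 4 → H) → Prop
  | conj (g : Fin 4 → H) (a : H) : CuspStep g (fun i => a * g i * a⁻¹)
  | q2 (g : Fin 4 → H) : CuspStep g (braid2 g)
  | sh2 (g : Fin 4 → H) :
      CuspStep g (braid3 (braid2 (braid1 (braid3 (braid2 (braid1 g))))))
  | q1q3 (g g' : Fin 4 → H) (h : braid3 g' = braid1 g) : CuspStep g g'

/-- Two tuples define the same cusp set `(g)Cu₄` in the inner Nielsen classes. -/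
def CuspEquiv (g g' : Fin 4 → H) : Prop := Relation.EqvGen CuspStep g g'

end Cusp

section Limit

variable {Γ : Type*} [Group Γ] [TopologicalSpace Γ] [IsTopologicalGroup Γ] {G : Type*} [Group G]

/-- The finite covers `Γ ⧸ N → G` through which `ψ : Γ → G` factors. -/
def FiniteCover (ψ : Γ →* G) : Type _ :=
  {N : OpenNormalSubgroup Γ // (N : Subgroup Γ) ≤ ψ.ker}

namespace FiniteCover

variable {ψ : Γ →* G}

/-- The kernel of `Γ → H` for the finite cover `H → G`. -/
def ker (N : FiniteCover ψ) : Subgroup Γ := (N.1 : Subgroup Γ)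

instance ker_normal (N : FiniteCover ψ) : N.ker.Normal := N.1.isNormal'

/-- The covering group `H = Γ ⧸ N`. -/
abbrev Grp (N : FiniteCover ψ) : Type _ := Γ ⧸ N.ker

/-- The covering map `H → G`. -/
def toBase (N : FiniteCover ψ) : N.Grp →* G := QuotientGroup.lift N.ker ψ N.2

end FiniteCover

/-- A directed path of cusps for `(G, C, p)`, where `ψ : Γ → G` is the universal `p`-Frattini cover,
presented by a projective system of Nielsen class elements: a directed family of finite covers
`H → G` through which `ψ` factors, and compatible elements of the Nielsen classes `Ni(H, C)`. -/
structure NielsenPath (p : ℕ) (ψ : Γ →* G) (C : Fin 4 → ConjClasses G) where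
  index : Set (FiniteCover ψ)
  nonempty : index.Nonempty
  directed : ∀ M ∈ index, ∀ N ∈ index, ∃ L ∈ index, L.ker ≤ M.ker ∧ L.ker ≤ N.ker
  tuple : ∀ N ∈ index, Fin 4 → N.Grp
  tuple_mem : ∀ N (hN : N ∈ index), tuple N hN ∈ NielsenClass p N.toBase C
  compatible : ∀ M (hM : M ∈ index) N (hN : N ∈ index) (h : M.ker ≤ N.ker) (i : Fin 4),
    QuotientGroup.map M.ker N.ker (MonoidHom.id Γ) h (tuple M hM i) = tuple N hN i

namespace NielsenPath

variable {p : ℕ} {ψ : Γ →* G} {C : Fin 4 → ConjClasses G}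

/-- The path `Q` contains the path `P`: it contains all the cusp sets of `P`. -/
def Le (P Q : NielsenPath p ψ C) : Prop :=
  ∃ h : P.index ⊆ Q.index, ∀ N (hN : N ∈ P.index), CuspEquiv (P.tuple N hN) (Q.tuple N (h hN))

/-- A maximal path. -/
def IsMaximal (P : NielsenPath p ψ C) : Prop := ∀ Q : NielsenPath p ψ C, P.Le Q → Q.Le P

/-- The intersection of the kernels `Γ → H` along the path. -/
def limitKer (P : NielsenPath p ψ C) : Subgroup Γ := ⨅ N : P.index, N.1.ker

instance limitKer_normal (P : NielsenPath p ψ C) : P.limitKer.Normal :=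
  Subgroup.normal_iInf_normal fun N => N.1.ker_normal

/-- The group `lim H` attached to the path, with its quotient topology. As `Γ` is compact and the
family is directed, the projective limit of the groups `Γ ⧸ N` is `Γ ⧸ ⋂ N`. For a maximal path this
is the limit group. -/
abbrev limitGroup (P : NielsenPath p ψ C) : Type _ := Γ ⧸ P.limitKer

/-- The path goes through level `k` of the tower, i.e. one of its groups is `G_k`. -/
def ThroughLevel (P : NielsenPath p ψ C) (k : ℕ) : Prop :=
  ∃ N ∈ P.index, N.ker = levelKer p ψ k

end NielsenPath

end Limit

/-- Reduction modulo `p`, `(ℤ_p)² → (ℤ/p)²`. -/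
noncomputable def padicSqToZMod (p : ℕ) [Fact p.Prime] : ℤ_[p] × ℤ_[p] →+ ZMod p × ZMod p :=
  AddMonoidHom.prodMap (PadicInt.toZMod (p := p)).toAddMonoidHom
    (PadicInt.toZMod (p := p)).toAddMonoidHom

/-! ### The Heisenberg extension is a Frattini cover -/

namespace Heisenberg

variable {R : Type*} [CommRing R]

/-! Everything is read off from three involutions. Since `p` is odd, a reflection in `(ℤ/p)² ⋊ {±1}`
lifts to an involution of `Γ` through the pro-`p` kernel (`exists_involution`), and by the Frattini
property involutions `s₀, s₁, s₂` over generating reflections generate `Γ` topologically. Put `x =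
s₀s₁`, `y = s₁s₂`, `c = [x,y]`. Modulo any normal subgroup in which `c` becomes central, the
elements of the dense subgroup are `x^a y^b c^k` or `x^a y^b c^k s₁`
(`involutions_normal_form_mod`), and `c` is conjugate to `(s₀s₁s₂)⁻²` (`involutions_commutator`).

In a Nielsen class the entries are involutions, so product one says that `s₀s₁s₂` is an involution,
that is, that `x` and `y` commute. In the Heisenberg extension `[x,y]` is central with coordinate
the determinant of the translations `x, y`, a unit because the reflections generate. Hence that
extension has no Nielsen tuple, and neither has any quotient of `Γ` above it, in particular no `G_k`
with `k ≥ 1`.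

Versality and compactness give a surjection `e` of `Γ` onto `(ℤ_p)² ⋊ {±1}`
(`InvolutionTriple.exists_hom_padic`). There `x` and `y` commute, and by the normal form `ker e` is
the least closed normal subgroup containing `(s₀s₁s₂)²`, for every triple
(`InvolutionTriple.ker_le`). A path lifts to a triple with `(s₀s₁s₂)²` in its limit kernel
(`NielsenPath.exists_involutionTriple`), so its covers are quotients of `Γ / ker e`. Conversely a
triple gives a path through all finite quotients of `Γ / ker e` over `G₀`. The maximal paths are
therefore those indexed by all these quotients.

For the head, `M₀` maps to `𝟏` by the central Heisenberg coordinate and to `𝟏⁻ ⊕ 𝟏⁻` by the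
coordinates of `e` divided by `p`. The classes of `x^p`, `y^p`, `c` show that the combined map is
onto. Its kernel contains `J M₀` because the targets are simple. It is no larger because the normal
form modulo the preimage of `J M₀` leaves only `x^a y^b c^k`, and vanishing modulo `p²` and in the
Heisenberg group forces `p² ∣ a, b` and `p ∣ k` (`InvolutionTriple.mem_of_padicRed_eq_one`). Since
`-1` separates `𝟏` from `𝟏⁻`, the quotient `𝟏` occurs only once. -/

theorem commutator_eq (a b : Heisenberg R) :
    a * b * a⁻¹ * b⁻¹ = ⟨0, 0, a.x * b.y - a.y * b.x⟩ := by
  ext <;> simp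
  ring

theorem central_pow (z : R) (k : ℕ) : (⟨0, 0, z⟩ : Heisenberg R) ^ k = ⟨0, 0, k * z⟩ := by
  induction k with
  | zero => ext <;> simp
  | succ k ih => rw [pow_succ, ih]; ext <;> simp; ring

end Heisenberg

/-- The commutator of lifts of the two basis vectors is the central generator, whichever lifts are
taken. A subgroup with full image therefore contains the centre, which is the kernel. -/
theorem isFrattiniCover_heisenberg_proj (p : ℕ) [Fact p.Prime] :
    IsFrattiniCover (Heisenberg.proj (ZMod p)) := by
  refine ⟨fun v => ⟨⟨v.toAdd.1, v.toAdd.2, 0⟩, rfl⟩, fun K hK => ?_⟩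
  have hlift : ∀ v : ZMod p × ZMod p, ∃ k ∈ K, k.x = v.1 ∧ k.y = v.2 := by
    intro v
    have h : Multiplicative.ofAdd v ∈ K.map (Heisenberg.proj (ZMod p)) := hK ▸ Subgroup.mem_top _
    obtain ⟨k, hk, hkv⟩ := h
    have h' : (k.x, k.y) = v := hkv
    exact ⟨k, hk, congrArg Prod.fst h', congrArg Prod.snd h'⟩
  obtain ⟨a, ha, hax, hay⟩ := hlift (1, 0)
  obtain ⟨b, hb, hbx, hby⟩ := hlift (0, 1)
  have hc : (⟨0, 0, 1⟩ : Heisenberg (ZMod p)) ∈ K := by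
    have h := K.mul_mem (K.mul_mem (K.mul_mem ha hb) (K.inv_mem ha)) (K.inv_mem hb)
    rwa [Heisenberg.commutator_eq, hax, hay, hbx, hby, mul_one, mul_zero, sub_zero] at h
  refine (Subgroup.eq_top_iff' K).2 fun h => ?_
  obtain ⟨k, hk, hkx, hky⟩ := hlift (h.x, h.y)
  have := K.mul_mem hk (K.pow_mem hc (h.z - k.z).val)
  rw [Heisenberg.central_pow] at this
  convert this using 1
  ext
  · simp [hkx]
  · simp [hky]
  · simp

theorem HeisenbergSign.proj_right {R : Type*} [CommRing R] (h : HeisenbergSign R) :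
    (HeisenbergSign.proj R h).right = h.right := rfl

theorem HeisenbergSign.proj_left {R : Type*} [CommRing R] (h : HeisenbergSign R) :
    (HeisenbergSign.proj R h).left.toAdd = (h.left.x, h.left.y) := rfl

/-- The map preserves the sign, so a subgroup with full image meets the Heisenberg group in a
subgroup that still maps onto `(ℤ/p)²`. This reduces to the previous case. -/
theorem isFrattiniCover_heisenbergSign_proj (p : ℕ) [Fact p.Prime] :
    IsFrattiniCover (HeisenbergSign.proj (ZMod p)) := by
  refine ⟨fun g => ⟨⟨⟨g.left.toAdd.1, g.left.toAdd.2, 0⟩, g.right⟩, rfl⟩, fun K hK => ?_⟩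
  have hlift : ∀ g, ∃ k ∈ K, HeisenbergSign.proj (ZMod p) k = g := fun g =>
    (hK ▸ Subgroup.mem_top g : g ∈ K.map (HeisenbergSign.proj (ZMod p)))
  have htop : K.comap SemidirectProduct.inl = ⊤ := by
    refine (isFrattiniCover_heisenberg_proj p).2 _ ((Subgroup.eq_top_iff' _).2 fun v => ?_)
    obtain ⟨k, hk, hkv⟩ := hlift (SemidirectProduct.inl v)
    have hr : k.right = 1 := congrArg SemidirectProduct.right hkv
    refine ⟨k.left, ?_, congrArg SemidirectProduct.left hkv⟩
    have : SemidirectProduct.inl k.left = k := SemidirectProduct.ext rfl hr.symm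
    change SemidirectProduct.inl k.left ∈ K
    rwa [this]
  refine (Subgroup.eq_top_iff' K).2 fun h => ?_
  obtain ⟨k, hk, hkh⟩ := hlift (HeisenbergSign.proj (ZMod p) h)
  have hr : k.right = h.right :=
    congrArg (fun g : SignSemidirect (ZMod p × ZMod p) => g.right) hkh
  have hm : SemidirectProduct.inl (h.left * k.left⁻¹) ∈ K := by
    have : h.left * k.left⁻¹ ∈ K.comap SemidirectProduct.inl := htop ▸ Subgroup.mem_top _
    exact this
  have := K.mul_mem hm hk
  convert this using 1
  ext <;> simp [hr]

/-! ### Groups generated by three involutions -/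

section NormalForm

variable {Q : Type*} [Group Q]

/-- If `x = s₀s₁` and `y = s₁s₂` commute with their commutator, every element of the group generated
by the involutions `s₀, s₁, s₂` is `x^a y^b [x,y]^k` or `x^a y^b [x,y]^k s₁`. -/
theorem involutions_normal_form {s₀ s₁ s₂ : Q} (h₀ : s₀ * s₀ = 1) (h₁ : s₁ * s₁ = 1)
    (h₂ : s₂ * s₂ = 1) {x y c : Q} (hx : x = s₀ * s₁) (hy : y = s₁ * s₂)
    (hc : c = x * y * x⁻¹ * y⁻¹) (hcx : Commute c x) (hcy : Commute c y) {g : Q}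
    (hg : g ∈ Subgroup.closure {s₀, s₁, s₂}) :
    ∃ a b k : ℤ, g = x ^ a * y ^ b * c ^ k ∨ g = x ^ a * y ^ b * c ^ k * s₁ := by
  have i₀ : s₀⁻¹ = s₀ := inv_eq_of_mul_eq_one_left h₀
  have i₁ : s₁⁻¹ = s₁ := inv_eq_of_mul_eq_one_left h₁
  have i₂ : s₂⁻¹ = s₂ := inv_eq_of_mul_eq_one_left h₂
  have e₀ : s₀ = x * s₁ := by rw [hx, mul_assoc, h₁, mul_one]
  have e₂ : s₂ = s₁ * y := by rw [hy, ← mul_assoc, h₁, one_mul]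
  have cx : s₁ * x * s₁⁻¹ = x⁻¹ := by
    rw [hx, mul_inv_rev, i₀, i₁, mul_assoc, mul_assoc, h₁, mul_one]
  have cy : s₁ * y * s₁⁻¹ = y⁻¹ := by
    rw [hy, mul_inv_rev, i₂, i₁, ← mul_assoc, h₁, one_mul]
  -- Conjugation by `s₁` inverts `x` and `y`, so it sends `c` to `[x⁻¹, y⁻¹]`. This equals `[x, y]`
  -- because `c` commutes with both.
  have cc : s₁ * c * s₁⁻¹ = c := by
    have h : s₁ * c * s₁⁻¹ = (s₁ * x * s₁⁻¹) * (s₁ * y * s₁⁻¹) * (s₁ * x * s₁⁻¹)⁻¹ *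
        (s₁ * y * s₁⁻¹)⁻¹ := by rw [hc]; group
    rw [h, cx, cy, inv_inv, inv_inv]
    have hxy : x * y = c * (y * x) := by rw [hc]; group
    rw [mul_assoc _ x y, hxy, ← mul_assoc, ← (hcx.inv_right.mul_right hcy.inv_right).eq]
    group
  have yx : ∀ a : ℤ, y * x ^ a = x ^ a * y * c ^ (-a) := by
    intro a
    have h : y * x * y⁻¹ = c⁻¹ * x := by rw [hc]; group
    have h2 : y * x ^ a * y⁻¹ = c ^ (-a) * x ^ a := by
      rw [← conj_zpow, h, hcx.inv_left.mul_zpow, inv_zpow']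
    rw [mul_assoc, ← (hcy.zpow_left (-a)).eq, ← mul_assoc,
      ← ((hcx.zpow_left (-a)).zpow_right a).eq, ← h2]
    group
  -- The normal forms include `1`. It remains to see that they are stable under left multiplication
  -- by `x`, `y` and `s₁`, hence by `s₀ = x s₁` and `s₂ = s₁ y`.
  let Nf : Q → Prop := fun g => ∃ a b k : ℤ, g = x ^ a * y ^ b * c ^ k ∨
    g = x ^ a * y ^ b * c ^ k * s₁
  have nx : ∀ g, Nf g → Nf (x * g) := by
    rintro g ⟨a, b, k, h⟩
    refine ⟨1 + a, b, k, h.imp ?_ ?_⟩ <;> rintro rfl <;> rw [zpow_one_add] <;> simp only [mul_assoc]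
  have ny : ∀ g, Nf g → Nf (y * g) := by
    have key : ∀ a b k : ℤ, y * (x ^ a * y ^ b * c ^ k) = x ^ a * y ^ (1 + b) * c ^ (-a + k) := by
      intro a b k
      rw [mul_assoc, ← mul_assoc, yx, zpow_one_add, zpow_add]
      simp only [mul_assoc]
      rw [← mul_assoc (c ^ (-a)), ((hcy.zpow_left (-a)).zpow_right b).eq]
      simp only [mul_assoc]
    rintro g ⟨a, b, k, h⟩
    refine ⟨a, 1 + b, -a + k, h.imp ?_ ?_⟩ <;> rintro rfl
    · exact key a b k
    · rw [← mul_assoc, key]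
  have ns : ∀ g, Nf g → Nf (s₁ * g) := by
    have key : ∀ a b k : ℤ, s₁ * (x ^ a * y ^ b * c ^ k) = x ^ (-a) * y ^ (-b) * c ^ k * s₁ := by
      intro a b k
      have h : s₁ * (x ^ a * y ^ b * c ^ k) * s₁⁻¹ =
          (s₁ * x * s₁⁻¹) ^ a * (s₁ * y * s₁⁻¹) ^ b * (s₁ * c * s₁⁻¹) ^ k := by
        simp only [conj_zpow]; group
      rw [cx, cy, cc, inv_zpow', inv_zpow'] at h
      rw [← h]; group
    rintro g ⟨a, b, k, h⟩
    refine ⟨-a, -b, k, ?_⟩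
    rcases h with rfl | rfl
    · exact Or.inr (key a b k)
    · left
      rw [← mul_assoc, key, mul_assoc, h₁, mul_one]
  have step : ∀ t ∈ ({s₀, s₁, s₂} : Set Q), t⁻¹ = t ∧ ∀ g, Nf g → Nf (t * g) := by
    rintro t (rfl | rfl | rfl)
    · refine ⟨i₀, fun g hg => ?_⟩
      rw [e₀, mul_assoc]
      exact nx _ (ns _ hg)
    · exact ⟨i₁, ns⟩
    · refine ⟨i₂, fun g hg => ?_⟩
      rw [e₂, mul_assoc]
      exact ns _ (ny _ hg)
  change Nf g
  refine Subgroup.closure_induction_left (p := fun g _ => Nf g) ⟨0, 0, 0, by simp⟩ ?_ ?_ hg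
  · intro t ht g _ hg
    exact (step t ht).2 g hg
  · intro t ht g _ hg
    rw [(step t ht).1]
    exact (step t ht).2 g hg

/-- The normal form modulo a normal subgroup. -/
theorem involutions_normal_form_mod (T : Subgroup Q) [T.Normal] {s₀ s₁ s₂ : Q} (h₀ : s₀ * s₀ = 1)
    (h₁ : s₁ * s₁ = 1) (h₂ : s₂ * s₂ = 1) {x y c : Q} (hx : x = s₀ * s₁) (hy : y = s₁ * s₂)
    (hc : c = x * y * x⁻¹ * y⁻¹) (hcx : x * c * x⁻¹ * c⁻¹ ∈ T) (hcy : y * c * y⁻¹ * c⁻¹ ∈ T) {g : Q}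
    (hg : g ∈ Subgroup.closure {s₀, s₁, s₂}) :
    ∃ a b k : ℤ, ∃ t ∈ T, g = x ^ a * y ^ b * c ^ k * t ∨ g = x ^ a * y ^ b * c ^ k * s₁ * t := by
  let π := QuotientGroup.mk' T
  have hcomm : ∀ u : Q, u * c * u⁻¹ * c⁻¹ ∈ T → Commute (π c) (π u) := by
    intro u hu
    have h : π (u * c * u⁻¹ * c⁻¹) = 1 := (QuotientGroup.eq_one_iff _).2 hu
    simp only [map_mul, map_inv] at h
    have := mul_inv_eq_one.1 h
    exact (mul_inv_eq_iff_eq_mul.1 this).symm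
  have hg' : π g ∈ Subgroup.closure {π s₀, π s₁, π s₂} := by
    have := Subgroup.mem_map_of_mem π hg
    rw [MonoidHom.map_closure] at this
    simpa [Set.image_insert_eq] using this
  obtain ⟨a, b, k, h⟩ := involutions_normal_form (s₀ := π s₀) (s₁ := π s₁) (s₂ := π s₂)
    (by rw [← map_mul, h₀, map_one]) (by rw [← map_mul, h₁, map_one])
    (by rw [← map_mul, h₂, map_one]) (x := π x) (y := π y) (c := π c) (by rw [hx, map_mul])
    (by rw [hy, map_mul]) (by rw [hc]; simp) (hcomm x hcx) (hcomm y hcy) hg'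
  refine ⟨a, b, k, ?_⟩
  rcases h with h | h
  · refine ⟨(x ^ a * y ^ b * c ^ k)⁻¹ * g, ?_, Or.inl (by group)⟩
    have h' : π (x ^ a * y ^ b * c ^ k) = π g := by rw [h]; simp only [map_mul, map_zpow]
    exact QuotientGroup.eq.1 h'
  · refine ⟨(x ^ a * y ^ b * c ^ k * s₁)⁻¹ * g, ?_, Or.inr (by group)⟩
    have h' : π (x ^ a * y ^ b * c ^ k * s₁) = π g := by rw [h]; simp only [map_mul, map_zpow]
    exact QuotientGroup.eq.1 h'

/-- This is the bridge between the product-one condition and commutativity: the product of the three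
involutions squares to one exactly when the two translations commute. -/
theorem involutions_commutator {s₀ s₁ s₂ : Q} (h₀ : s₀ * s₀ = 1) (h₁ : s₁ * s₁ = 1)
    (h₂ : s₂ * s₂ = 1) {x y : Q} (hx : x = s₀ * s₁) (hy : y = s₁ * s₂) :
    x * y * x⁻¹ * y⁻¹ = y * (s₀ * s₁ * s₂ * (s₀ * s₁ * s₂))⁻¹ * y⁻¹ := by
  have i₀ : s₀⁻¹ = s₀ := inv_eq_of_mul_eq_one_left h₀
  have i₁ : s₁⁻¹ = s₁ := inv_eq_of_mul_eq_one_left h₁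
  have i₂ : s₂⁻¹ = s₂ := inv_eq_of_mul_eq_one_left h₂
  have h : s₀ * s₁ * s₂ * (s₀ * s₁ * s₂) = x * y⁻¹ * x⁻¹ * y := by
    rw [hx, hy, mul_inv_rev, mul_inv_rev, i₀, i₁, i₂]
    simp only [mul_assoc]
    rw [← mul_assoc s₁ s₁ (s₀ * _), h₁, one_mul]
  rw [h]
  group

end NormalForm

/-! ### Elements of `A ⋊ {±1}` -/

namespace SignSemidirect

variable {A : Type*} [AddCommGroup A]

theorem mul_left_toAdd (g h : SignSemidirect A) :
    (g * h).left.toAdd = g.left.toAdd + (g.right : ℤ) • h.left.toAdd := rfl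

theorem ext_iff' {g h : SignSemidirect A} :
    g = h ↔ g.left.toAdd = h.left.toAdd ∧ g.right = h.right := by
  constructor
  · rintro rfl; exact ⟨rfl, rfl⟩
  · rintro ⟨h1, h2⟩; exact SemidirectProduct.ext h1 h2

/-- The homomorphism `A ⋊ {±1} → {±1}`. -/
abbrev sign : SignSemidirect A →* ℤˣ := SemidirectProduct.rightHom

theorem map_left_toAdd {B : Type*} [AddCommGroup B] (f : A →+ B) (g : SignSemidirect A) :
    (SignSemidirect.map f g).left.toAdd = f g.left.toAdd := rfl

theorem mul_self_eq_one {g : SignSemidirect A} (hg : g.right = -1) : g * g = 1 := by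
  rw [ext_iff', mul_left_toAdd, SemidirectProduct.mul_right, hg]
  simp

theorem mul_comm_of_right_eq_one {g h : SignSemidirect A} (hg : g.right = 1) (hh : h.right = 1) :
    g * h = h * g := by
  rw [ext_iff', mul_left_toAdd, mul_left_toAdd, SemidirectProduct.mul_right,
    SemidirectProduct.mul_right, hg, hh]
  simp [add_comm]

theorem left_mul_of_right_eq_one {g : SignSemidirect A} (hg : g.right = 1) (h : SignSemidirect A) :
    (g * h).left.toAdd = g.left.toAdd + h.left.toAdd := by
  rw [mul_left_toAdd, hg]; simp

theorem left_zpow {g : SignSemidirect A} (hg : g.right = 1) (k : ℤ) :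
    (g ^ k).left.toAdd = k • g.left.toAdd ∧ (g ^ k).right = 1 := by
  have h : g = SemidirectProduct.inl g.left := SemidirectProduct.ext rfl hg
  rw [h, ← map_zpow]
  exact ⟨rfl, rfl⟩

theorem left_zpow_mul_zpow {g h : SignSemidirect A} (hg : g.right = 1) (hh : h.right = 1)
    (a b : ℤ) :
    (g ^ a * h ^ b).left.toAdd = a • g.left.toAdd + b • h.left.toAdd ∧
      (g ^ a * h ^ b).right = 1 := by
  rw [left_mul_of_right_eq_one (left_zpow hg a).2, (left_zpow hg a).1, (left_zpow hh b).1,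
    SemidirectProduct.mul_right, (left_zpow hg a).2, (left_zpow hh b).2]
  exact ⟨rfl, one_mul 1⟩

instance [Finite A] : Finite (SignSemidirect A) :=
  Finite.of_equiv _ (SemidirectProduct.equivProd (φ := signAut A)).symm

/-- Three reflections generating `A ⋊ {±1}`: the translations `s₀s₁`, `s₁s₂` generate `A`. -/
theorem exists_zsmul_of_closure_eq_top {s₀ s₁ s₂ : SignSemidirect A} (h₀ : s₀.right = -1)
    (h₁ : s₁.right = -1) (h₂ : s₂.right = -1) (h : Subgroup.closure {s₀, s₁, s₂} = ⊤) (v : A) :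
    ∃ a b : ℤ, v = a • (s₀ * s₁).left.toAdd + b • (s₁ * s₂).left.toAdd := by
  have hx : (s₀ * s₁).right = 1 := by rw [SemidirectProduct.mul_right, h₀, h₁]; rfl
  have hy : (s₁ * s₂).right = 1 := by rw [SemidirectProduct.mul_right, h₁, h₂]; rfl
  have hxy := mul_comm_of_right_eq_one hx hy
  -- Translations commute here, so `c = 1`. The form ending in `s₁` has sign `-1` and cannot be a
  -- translation.
  obtain ⟨a, b, k, hk⟩ := involutions_normal_form (mul_self_eq_one h₀) (mul_self_eq_one h₁)
    (mul_self_eq_one h₂) (x := s₀ * s₁) (y := s₁ * s₂) (c := 1) rfl rfl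
    (by rw [hxy]; group) (Commute.one_left _) (Commute.one_left _)
    (h ▸ Subgroup.mem_top (SemidirectProduct.inl (Multiplicative.ofAdd v)))
  obtain ⟨e1, e2⟩ := left_zpow_mul_zpow hx hy a b
  rw [one_zpow, mul_one] at hk
  rcases hk with hk | hk
  · exact ⟨a, b, by rw [← e1, ← hk]; rfl⟩
  · have := congrArg (fun g : SignSemidirect A => g.right) hk
    simp [e2, h₁] at this

end SignSemidirect

/-! ### The determinant -/

section Det

variable {R : Type*} [CommRing R]

/-- The determinant of two vectors in `R²`. -/
def det₂ (v w : R × R) : R := v.1 * w.2 - v.2 * w.1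

theorem zsmul_add_zsmul_eq (v w : R × R) (a b : ℤ) :
    a • v + b • w = (a * v.1 + b * w.1, a * v.2 + b * w.2) := by
  ext
  · rw [Prod.fst_add, Prod.smul_fst, Prod.smul_fst, zsmul_eq_mul, zsmul_eq_mul]
  · rw [Prod.snd_add, Prod.smul_snd, Prod.smul_snd, zsmul_eq_mul, zsmul_eq_mul]

/-- Expressing the two basis vectors through `v, w` gives an inverse matrix, whose determinant
inverts `det₂ v w`. -/
theorem isUnit_det₂_of_span {v w : R × R}
    (h : ∀ u : R × R, ∃ a b : ℤ, u = a • v + b • w) : IsUnit (det₂ v w) := by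
  obtain ⟨a, b, h1⟩ := h (1, 0)
  obtain ⟨a', b', h2⟩ := h (0, 1)
  simp only [zsmul_add_zsmul_eq, Prod.ext_iff] at h1 h2
  refine IsUnit.of_mul_eq_one ((a * b' - a' * b : ℤ) : R) ?_
  have e : (1 : R) = (a * v.1 + b * w.1) * (a' * v.2 + b' * w.2) -
      (a * v.2 + b * w.2) * (a' * v.1 + b' * w.1) := by
    rw [← h1.1, ← h1.2, ← h2.1, ← h2.2]; ring
  rw [e, det₂]
  push_cast
  ring

theorem eq_zero_of_det₂_isUnit {v w : R × R} (h : IsUnit (det₂ v w)) {a b : ℤ}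
    (hab : a • v + b • w = 0) : (a : R) = 0 ∧ (b : R) = 0 := by
  simp only [zsmul_add_zsmul_eq, Prod.ext_iff, Prod.fst_zero, Prod.snd_zero] at hab
  constructor
  · refine (h.mul_left_eq_zero).1 ?_
    rw [det₂]
    linear_combination w.2 * hab.1 - w.1 * hab.2
  · refine (h.mul_left_eq_zero).1 ?_
    rw [det₂]
    linear_combination v.1 * hab.2 - v.2 * hab.1

/-- Cramer's rule. The coefficients can be taken in `ℤ` because every residue modulo `n` is the
image of an integer. -/
theorem exists_zsmul_of_det₂_isUnit {n : ℕ} {v w : ZMod n × ZMod n} (h : IsUnit (det₂ v w))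
    (u : ZMod n × ZMod n) : ∃ a b : ℤ, u = a • v + b • w := by
  obtain ⟨d, hd⟩ := h.exists_right_inv
  obtain ⟨a, ha⟩ := ZMod.intCast_surjective (d * det₂ u w)
  obtain ⟨b, hb⟩ := ZMod.intCast_surjective (d * det₂ v u)
  refine ⟨a, b, ?_⟩
  rw [zsmul_add_zsmul_eq, Prod.ext_iff, ha, hb]
  simp only [det₂] at hd ⊢
  constructor
  · linear_combination (-u.1) * hd
  · linear_combination (-u.2) * hd

theorem ZMod.isUnit_of_castHom_ne_zero {p : ℕ} [Fact p.Prime] {m : ℕ} (h : p ∣ p ^ (m + 1))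
    {r : ZMod (p ^ (m + 1))} (hr : ZMod.castHom h (ZMod p) r ≠ 0) : IsUnit r := by
  obtain ⟨n, rfl⟩ := ZMod.natCast_zmod_surjective r
  rw [map_natCast, Ne, ZMod.natCast_eq_zero_iff] at hr
  rw [ZMod.isUnit_iff_coprime]
  exact (((Fact.out : p.Prime).coprime_iff_not_dvd.2 hr).symm).pow_right _

end Det

/-- A subgroup of `(ℤ/n)² ⋊ {±1}` is everything if it contains a reflection and two translations
with invertible determinant. -/
theorem SignSemidirect.eq_top_of_det₂ {n : ℕ} {K : Subgroup (SignSemidirect (ZMod n × ZMod n))}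
    {s x y : SignSemidirect (ZMod n × ZMod n)} (hs : s ∈ K) (hx : x ∈ K) (hy : y ∈ K)
    (hsr : s.right = -1) (hxr : x.right = 1) (hyr : y.right = 1)
    (h : IsUnit (det₂ x.left.toAdd y.left.toAdd)) : K = ⊤ := by
  have key : ∀ g : SignSemidirect (ZMod n × ZMod n), g.right = 1 → g ∈ K := by
    intro g hg
    obtain ⟨a, b, hab⟩ := exists_zsmul_of_det₂_isUnit h g.left.toAdd
    obtain ⟨e1, e2⟩ := left_zpow_mul_zpow hxr hyr a b
    have : g = x ^ a * y ^ b := by rw [ext_iff', e1, e2]; exact ⟨hab, hg⟩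
    rw [this]
    exact K.mul_mem (K.zpow_mem hx a) (K.zpow_mem hy b)
  refine (Subgroup.eq_top_iff' K).2 fun g => ?_
  rcases Int.units_eq_one_or g.right with hg | hg
  · exact key g hg
  · have := K.mul_mem (key (g * s) (by rw [SemidirectProduct.mul_right, hg, hsr]; rfl)) hs
    rwa [mul_assoc, mul_self_eq_one hsr, mul_one] at this

/-! ### Existence of the universal `p`-Frattini cover -/

/-- Extensions of `G` by finite `p`-groups, with covering group a permutation group. -/
structure PExtension (p : ℕ) (G : Type) [Group G] : Type where
  degree : ℕ
  carrier : Subgroup (Equiv.Perm (Fin degree))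
  hom : carrier →* G
  surjective : Function.Surjective hom
  isPGroup_ker : IsPGroup p hom.ker

namespace PExtension

variable {p : ℕ} {G : Type} [Group G]

/-- The covering group, with the discrete topology. -/
def Grp (i : PExtension p G) : Type := i.carrier

instance (i : PExtension p G) : Group i.Grp := inferInstanceAs (Group i.carrier)
instance (i : PExtension p G) : Finite i.Grp := inferInstanceAs (Finite i.carrier)
instance (i : PExtension p G) : TopologicalSpace i.Grp := ⊥
instance (i : PExtension p G) : DiscreteTopology i.Grp := ⟨rfl⟩

/-- The covering map. -/
def proj (i : PExtension p G) : i.Grp →* G := i.hom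

/-- Cayley's theorem. Replacing abstract finite groups by permutation groups keeps the index of the
product of all extensions in the lowest universe. -/
theorem exists_equiv {H : Type} [Group H] [Finite H] (φ : H →* G) (hφ : Function.Surjective φ)
    (hp : IsPGroup p φ.ker) : ∃ (i : PExtension p G) (e : i.Grp ≃* H), φ.comp e = i.proj := by
  obtain ⟨n, ⟨f⟩⟩ := Finite.exists_equiv_fin H
  let c : H →* Equiv.Perm (Fin n) :=
    (f.permCongrHom : Equiv.Perm H →* Equiv.Perm (Fin n)).comp (MulAction.toPermHom H H)
  have hc : Function.Injective c :=
    f.permCongrHom.injective.comp MulAction.toPerm_injective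
  let e : H ≃* c.range := MonoidHom.ofInjective hc
  refine ⟨⟨n, c.range, φ.comp e.symm, hφ.comp e.symm.surjective, ?_⟩, e.symm, rfl⟩
  rintro ⟨x, hx⟩
  obtain ⟨k, hk⟩ := hp ⟨e.symm x, hx⟩
  refine ⟨k, Subtype.ext (e.symm.injective ?_)⟩
  simpa using congrArg Subtype.val hk

/-- The conditions on a closed subgroup of the product of all extensions by `p`-groups: it lies in
the fibre product over `G` and maps onto `G`. -/
structure IsCover (i₀ : PExtension p G) (K : Subgroup (∀ i : PExtension p G, i.Grp)) : Prop where
  isClosed : IsClosed (K : Set (∀ i : PExtension p G, i.Grp))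
  proj_eq : ∀ x ∈ K, ∀ i : PExtension p G, i.proj (x i) = i₀.proj (x i₀)
  surjective : ∀ g, ∃ x ∈ K, i₀.proj (x i₀) = g

/-- Zorn's lemma downwards from the full fibre product. Minimality will become the Frattini
property. -/
theorem exists_minimal_isCover (i₀ : PExtension p G) :
    ∃ K, IsCover i₀ K ∧ ∀ L, IsCover i₀ L → L ≤ K → L = K := by
  let F : Subgroup (∀ i : PExtension p G, i.Grp) :=
    { carrier := {x | ∀ i : PExtension p G, i.proj (x i) = i₀.proj (x i₀)}
      one_mem' := fun i => by simp
      mul_mem' := fun {a b} ha hb i => by simp [ha i, hb i]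
      inv_mem' := fun {a} ha i => by simp [ha i] }
  have hF : IsCover i₀ F := by
    refine ⟨?_, fun x hx => hx, fun g => ?_⟩
    · change IsClosed {x : ∀ i : PExtension p G, i.Grp |
        ∀ i : PExtension p G, i.proj (x i) = i₀.proj (x i₀)}
      rw [Set.ofPred_forall]
      refine isClosed_iInter fun i => ?_
      let : TopologicalSpace G := ⊥
      have : DiscreteTopology G := ⟨rfl⟩
      exact isClosed_eq (continuous_of_discreteTopology.comp (continuous_apply i))
        (continuous_of_discreteTopology.comp (continuous_apply i₀))
    · choose x hx using fun i : PExtension p G => i.surjective g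
      exact ⟨x, fun i => (hx i).trans (hx i₀).symm, hx i₀⟩
  obtain ⟨K, hK⟩ := zorn_le₀ (α := (Subgroup (∀ i : PExtension p G, i.Grp))ᵒᵈ)
    {K | IsCover i₀ (OrderDual.ofDual K)} (by
    intro c hc hchain
    by_cases hne : c.Nonempty
    · let S : Set (Subgroup (∀ i : PExtension p G, i.Grp)) := OrderDual.toDual ⁻¹' c
      have hSne : S.Nonempty := hne
      have hS : ∀ K ∈ S, IsCover i₀ K := fun K hK => hc hK
      refine ⟨OrderDual.toDual (sInf S), ⟨?_, ?_, ?_⟩, fun K hK =>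
        (sInf_le (show OrderDual.ofDual K ∈ S from hK) : sInf S ≤ OrderDual.ofDual K)⟩
      · change IsClosed ((sInf S : Subgroup (∀ i : PExtension p G, i.Grp)) :
          Set (∀ i : PExtension p G, i.Grp))
        rw [Subgroup.coe_sInf]
        exact isClosed_biInter fun K hK => (hS K hK).isClosed
      · intro x hx
        obtain ⟨K, hK⟩ := hSne
        exact (hS K hK).proj_eq x (Subgroup.mem_sInf.1 hx K hK)
      · intro g
        have : Nonempty S := hSne.to_subtype
        have hcl : IsClosed {x : ∀ i : PExtension p G, i.Grp | i₀.proj (x i₀) = g} :=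
          (isClosed_discrete {a : i₀.Grp | i₀.proj a = g}).preimage (continuous_apply i₀)
        have hclK : ∀ K : S, IsClosed ((K : Set (∀ i : PExtension p G, i.Grp)) ∩
            {x | i₀.proj (x i₀) = g}) := fun K => (hS K K.2).isClosed.inter hcl
        -- The intersection of a chain still maps onto `G`: over each `g` the fibres are nonempty,
        -- closed in a compact product, and nested.
        obtain ⟨x, hx⟩ := IsCompact.nonempty_iInter_of_directed_nonempty_isCompact_isClosed
          (fun K : S => (K : Set (∀ i : PExtension p G, i.Grp)) ∩ {x | i₀.proj (x i₀) = g}) (by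
            intro K L
            rcases hchain.total K.2 L.2 with h | h
            · exact ⟨L, Set.inter_subset_inter_left _ h, subset_rfl⟩
            · exact ⟨K, subset_rfl, Set.inter_subset_inter_left _ h⟩)
          (fun K => (hS K K.2).surjective g) (fun K => (hclK K).isCompact) hclK
        rw [Set.mem_iInter] at hx
        exact ⟨x, Subgroup.mem_sInf.2 fun K hK => (hx ⟨K, hK⟩).1, (hx (Classical.arbitrary S)).2⟩
    · rw [Set.not_nonempty_iff_eq_empty] at hne
      exact ⟨OrderDual.toDual F, hF, by simp [hne]⟩)
  exact ⟨OrderDual.ofDual K, hK.1, fun L hL hLK =>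
    le_antisymm hLK (hK.2 (y := OrderDual.toDual L) hL hLK)⟩

end PExtension

/-- A minimal closed subgroup of the fibre product of all extensions by finite `p`-groups works: its
coordinate projections give versality, and a closed subgroup with full image contradicts minimality
unless it is everything. -/
theorem exists_isUniversalPFrattiniCover (p : ℕ) (G : Type) [Group G] [Finite G] :
    ∃ (Γ : ProfiniteGrp.{0}) (ψ : Γ →* G), IsUniversalPFrattiniCover p ψ := by
  -- The coordinate `i₀` only serves to read off the map to `G`. The trivial extension shows that
  -- some coordinate exists.
  obtain ⟨i₀, -, -⟩ := PExtension.exists_equiv (p := p) (MonoidHom.id G) Function.surjective_id (by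
    rintro ⟨x, hx⟩
    have hx' : x = 1 := hx
    exact ⟨0, Subtype.ext (by change x ^ p ^ 0 = 1; rw [hx', one_pow])⟩)
  obtain ⟨K, hK, hmin⟩ := PExtension.exists_minimal_isCover i₀
  have : CompactSpace K := isCompact_iff_compactSpace.1 hK.isClosed.isCompact
  have hcont : ∀ i : PExtension p G, Continuous fun x : K => (x : ∀ i : PExtension p G, i.Grp) i :=
    fun i => (continuous_apply i).comp continuous_subtype_val
  let ψ : K →* G := (i₀.proj.comp (Pi.evalMonoidHom _ i₀)).comp K.subtype
  refine ⟨ProfiniteGrp.of K, ψ, ?_, ?_, ?_, ?_, ?_⟩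
  · exact (isOpen_discrete {a : i₀.Grp | i₀.proj a = 1}).preimage (hcont i₀)
  · intro g
    obtain ⟨x, hx, hg⟩ := hK.surjective g
    exact ⟨⟨x, hx⟩, hg⟩
  · rintro U ⟨_, x, hx, rfl⟩
    -- Each coordinate of `x` lies in a `p`-group kernel, so `x ^ p ^ n` is eventually `1` in that
    -- coordinate, and convergence in the product is coordinatewise.
    have hlim : Filter.Tendsto (fun n : ℕ => x ^ p ^ n) Filter.atTop (nhds (1 : K)) := by
      rw [tendsto_subtype_rng, tendsto_pi_nhds]
      intro i
      have hxi : (x : ∀ i : PExtension p G, i.Grp) i ∈ i.proj.ker :=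
        (hK.proj_eq x x.2 i).trans hx
      obtain ⟨k, hk⟩ := i.isPGroup_ker ⟨(x : ∀ i : PExtension p G, i.Grp) i, hxi⟩
      have hk' : (x : ∀ i : PExtension p G, i.Grp) i ^ p ^ k = 1 := congrArg Subtype.val hk
      refine tendsto_const_nhds.congr' ?_
      filter_upwards [Filter.eventually_ge_atTop k] with n hn
      obtain ⟨m, rfl⟩ := Nat.exists_eq_add_of_le hn
      change 1 = (x : ∀ i : PExtension p G, i.Grp) i ^ p ^ (k + m)
      rw [pow_add, pow_mul, hk', one_pow]
    obtain ⟨n, hn⟩ := (hlim.eventually (U.toOpenSubgroup.mem_nhds_one)).exists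
    exact ⟨n, Subtype.ext ((QuotientGroup.eq_one_iff (x ^ p ^ n)).2 hn)⟩
  · intro L hL hLtop
    have hle : L.map K.subtype ≤ K := Subgroup.map_subtype_le L
    have := hmin (L.map K.subtype) ⟨?_, fun x hx => hK.proj_eq x (hle hx), fun g => ?_⟩ hle
    · refine (Subgroup.eq_top_iff' L).2 fun x => ?_
      obtain ⟨y, hy, hyx⟩ : (x : ∀ i : PExtension p G, i.Grp) ∈ L.map K.subtype := by
        rw [this]; exact x.2
      rwa [← Subtype.ext hyx]
    · rw [Subgroup.coe_map]
      exact hK.isClosed.isClosedEmbedding_subtypeVal.isClosedMap _ hL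
    · obtain ⟨x, hx, hg⟩ := (hLtop ▸ Subgroup.mem_top g : g ∈ L.map ψ)
      exact ⟨x, ⟨x, hx, rfl⟩, hg⟩
  · intro H _ _ φ hφ hp
    obtain ⟨i, e, he⟩ := PExtension.exists_equiv φ hφ hp
    refine ⟨((e : i.Grp →* H).comp (Pi.evalMonoidHom _ i)).comp K.subtype, ?_, ?_⟩
    · exact (isOpen_discrete {a : i.Grp | e a = 1}).preimage (hcont i)
    · ext x
      have := DFunLike.congr_fun he ((x : ∀ i : PExtension p G, i.Grp) i)
      exact this.trans (hK.proj_eq x x.2 i)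

/-! ### Homomorphisms from profinite groups -/

section Profinite

variable {Γ : Type*} [Group Γ] [TopologicalSpace Γ] [IsTopologicalGroup Γ]

theorem IsLocallyConstant.of_isOpen_ker {H : Type*} [Group H] {f : Γ →* H}
    (hf : IsOpen (f.ker : Set Γ)) : IsLocallyConstant f := by
  rw [IsLocallyConstant.iff_exists_open]
  intro x
  refine ⟨(fun y => x⁻¹ * y) ⁻¹' (f.ker : Set Γ), hf.preimage (by fun_prop), by simp, ?_⟩
  intro y hy
  have h : f (x⁻¹ * y) = 1 := hy
  rw [map_mul, map_inv, inv_mul_eq_one] at h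
  exact h.symm

theorem IsLocallyConstant.isClosed_preimage {X Y : Type*} [TopologicalSpace X] {f : X → Y}
    (hf : IsLocallyConstant f) (s : Set Y) : IsClosed (f ⁻¹' s) := by
  rw [← isOpen_compl_iff, ← Set.preimage_compl]
  exact hf _

theorem IsLocallyConstant.isOpen_ker {Γ H : Type*} [Group Γ] [TopologicalSpace Γ] [Group H]
    {f : Γ →* H} (hf : IsLocallyConstant f) : IsOpen (f.ker : Set Γ) :=
  hf.isOpen_fiber 1

/-- The kernel of a locally constant homomorphism, as an open normal subgroup. -/
def openKer {H : Type*} [Group H] (f : Γ →* H) (hf : IsLocallyConstant f) : OpenNormalSubgroup Γ :=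
  { toSubgroup := f.ker
    isOpen' := hf.isOpen_ker
    isNormal' := MonoidHom.normal_ker f }

theorem exists_mul_mem_of_dense {S : Subgroup Γ} (hS : S.topologicalClosure = ⊤) (γ : Γ)
    (U : OpenNormalSubgroup Γ) : ∃ u ∈ U, γ * u ∈ S := by
  have hγ : γ ∈ closure (S : Set Γ) := (hS ▸ Subgroup.mem_top γ : γ ∈ S.topologicalClosure)
  obtain ⟨s, hs, hsS⟩ := mem_closure_iff.1 hγ ((fun y => γ⁻¹ * y) ⁻¹' (U : Set Γ))
    (U.toOpenSubgroup.isOpen.preimage (by fun_prop))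
    (by simp)
  exact ⟨γ⁻¹ * s, hs, by simpa using hsS⟩

variable [CompactSpace Γ] [TotallyDisconnectedSpace Γ]

/-- The cosets `γU` form a neighbourhood basis of `γ`, so approximating `γ` by elements of a closed
set modulo every `U` is enough. -/
theorem mem_of_forall_openNormalSubgroup {N : Set Γ} (hN : IsClosed N) {γ : Γ}
    (h : ∀ U : OpenNormalSubgroup Γ, ∃ u ∈ U, γ * u ∈ N) : γ ∈ N := by
  by_contra hγ
  obtain ⟨U, hU⟩ := ProfiniteGrp.exist_openNormalSubgroup_sub_open_nhds_of_one
    (U := (fun u => γ * u) ⁻¹' Nᶜ) (hN.isOpen_compl.preimage (by fun_prop)) (by simpa using hγ)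
  obtain ⟨u, hu, huN⟩ := h U
  exact hU hu huN

/-- Square roots of elements of a pro-`p` subgroup, `p` odd: if `γ² ∈ N` then `γN` contains an
involution. -/
theorem exists_involution [T2Space Γ] {p : ℕ} (hp : Odd p) {N : Subgroup Γ}
    (hN : IsClosed (N : Set Γ))
    (hpN : ∀ n ∈ N, ∀ U : OpenNormalSubgroup Γ, ∃ k : ℕ, n ^ p ^ k ∈ U)
    {γ : Γ} (hγ : γ * γ ∈ N) : ∃ s, γ⁻¹ * s ∈ N ∧ s * s = 1 := by
  let t : OpenNormalSubgroup Γ → Set Γ := fun U => {s | γ⁻¹ * s ∈ N ∧ s * s ∈ U}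
  have hcl : ∀ U, IsClosed (t U) := fun U =>
    (hN.preimage (by fun_prop : Continuous fun s => γ⁻¹ * s)).inter
      (U.toOpenSubgroup.isClosed.preimage (by fun_prop : Continuous fun s => s * s))
  have hne : ∀ U, (t U).Nonempty := by
    intro U
    obtain ⟨k, hk⟩ := hpN _ hγ U
    obtain ⟨j, hj⟩ := hp.pow (n := k)
    -- As `p ^ k` is odd, `γ ^ p ^ k` differs from `γ` by a power of `γ²`, and its square `(γ²) ^ p
    -- ^ k` lies in `U`. Compactness then removes the dependence on `U`.
    refine ⟨γ ^ p ^ k, ?_, ?_⟩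
    · have : γ⁻¹ * γ ^ p ^ k = (γ * γ) ^ j := by
        rw [hj, pow_succ', inv_mul_cancel_left, pow_mul, pow_two]
      rw [this]
      exact N.pow_mem hγ j
    · rwa [← (Commute.refl γ).mul_pow]
  have : Nonempty (OpenNormalSubgroup Γ) :=
    ⟨openKer (1 : Γ →* Γ) (IsLocallyConstant.const 1)⟩
  obtain ⟨s, hs⟩ := IsCompact.nonempty_iInter_of_directed_nonempty_isCompact_isClosed t
    (fun U V => ⟨U ⊓ V, fun s hs => ⟨hs.1, (hs.2 : _ ∈ (U : Set Γ) ∩ V).1⟩,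
      fun s hs => ⟨hs.1, (hs.2 : _ ∈ (U : Set Γ) ∩ V).2⟩⟩)
    hne (fun U => (hcl U).isCompact) hcl
  rw [Set.mem_iInter] at hs
  refine ⟨s, (hs (Classical.arbitrary _)).1, ?_⟩
  refine mem_of_forall_openNormalSubgroup (isClosed_singleton (x := (1 : Γ))) fun U =>
    ⟨(s * s)⁻¹, inv_mem (hs U).2, by simp⟩

end Profinite

theorem IsUniversalPFrattiniCover.exists_pow_mem {p : ℕ} {Γ : Type*} [Group Γ] [TopologicalSpace Γ]
    [IsTopologicalGroup Γ] {G : Type} [Group G] {ψ : Γ →* G} (hψ : IsUniversalPFrattiniCover p ψ)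
    {γ : Γ} (hγ : γ ∈ ψ.ker) (U : OpenNormalSubgroup Γ) : ∃ k : ℕ, γ ^ p ^ k ∈ U := by
  obtain ⟨k, hk⟩ := hψ.proP_ker U ⟨QuotientGroup.mk' (U : Subgroup Γ) γ, γ, hγ, rfl⟩
  refine ⟨k, (QuotientGroup.eq_one_iff (γ ^ p ^ k)).1 ?_⟩
  simpa [Subtype.ext_iff] using hk

/-! ### Triples of involutions -/

section Triple

variable {p : ℕ} {Γ : Type*} [Group Γ]

/-- Three involutions of `Γ` whose images are reflections generating `(ℤ/p)² ⋊ {±1}`. -/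
structure InvolutionTriple (ψ : Γ →* SignSemidirect (ZMod p × ZMod p)) (s₀ s₁ s₂ : Γ) : Prop where
  sq₀ : s₀ * s₀ = 1
  sq₁ : s₁ * s₁ = 1
  sq₂ : s₂ * s₂ = 1
  right₀ : (ψ s₀).right = -1
  right₁ : (ψ s₁).right = -1
  right₂ : (ψ s₂).right = -1
  generate : Subgroup.closure {ψ s₀, ψ s₁, ψ s₂} = ⊤

variable {ψ : Γ →* SignSemidirect (ZMod p × ZMod p)} {s₀ s₁ s₂ : Γ}

theorem InvolutionTriple.isUnit_det₂ (h : InvolutionTriple ψ s₀ s₁ s₂) :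
    IsUnit (det₂ (ψ (s₀ * s₁)).left.toAdd (ψ (s₁ * s₂)).left.toAdd) := by
  rw [map_mul, map_mul]
  exact isUnit_det₂_of_span
    (SignSemidirect.exists_zsmul_of_closure_eq_top h.right₀ h.right₁ h.right₂ h.generate)

variable [TopologicalSpace Γ] [IsTopologicalGroup Γ]

/-- The generated closed subgroup has full image, so the Frattini property applies. -/
theorem InvolutionTriple.topologicalClosure (h : InvolutionTriple ψ s₀ s₁ s₂)
    (hψ : IsUniversalPFrattiniCover p ψ) :
    (Subgroup.closure {s₀, s₁, s₂}).topologicalClosure = ⊤ := by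
  refine hψ.frattini _ (Subgroup.isClosed_topologicalClosure _) (top_le_iff.1 ?_)
  rw [← h.generate]
  refine le_trans (le_of_eq ?_) (Subgroup.map_mono (Subgroup.le_topologicalClosure _))
  rw [MonoidHom.map_closure]
  simp [Set.image_insert_eq]

/-- Locally constant homomorphisms agreeing on a triple of involutions are equal. -/
theorem InvolutionTriple.hom_ext (h : InvolutionTriple ψ s₀ s₁ s₂)
    (hψ : IsUniversalPFrattiniCover p ψ) {H : Type*} [Group H] {f g : Γ →* H}
    (hf : IsLocallyConstant f) (hg : IsLocallyConstant g) (e₀ : f s₀ = g s₀) (e₁ : f s₁ = g s₁)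
    (e₂ : f s₂ = g s₂) : f = g := by
  have hcl : IsClosed (f.eqLocus g : Set Γ) :=
    (hf.prodMk hg).isClosed_preimage {x | x.1 = x.2}
  have hle : Subgroup.closure {s₀, s₁, s₂} ≤ f.eqLocus g := by
    rw [Subgroup.closure_le]
    rintro x (rfl | rfl | rfl) <;> assumption
  have := Subgroup.topologicalClosure_minimal _ hle hcl
  rw [h.topologicalClosure hψ] at this
  ext γ
  exact this (Subgroup.mem_top γ)

theorem closure_reflections_eq_top (p : ℕ) :
    Subgroup.closure {(⟨Multiplicative.ofAdd (0, 0), -1⟩ : SignSemidirect (ZMod p × ZMod p)),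
      ⟨Multiplicative.ofAdd (1, 0), -1⟩, ⟨Multiplicative.ofAdd (1, 1), -1⟩} = ⊤ := by
  have h₀ := Subgroup.subset_closure (G := SignSemidirect (ZMod p × ZMod p))
    (k := {⟨Multiplicative.ofAdd (0, 0), -1⟩, ⟨Multiplicative.ofAdd (1, 0), -1⟩,
      ⟨Multiplicative.ofAdd (1, 1), -1⟩}) (Or.inl rfl)
  have h₁ := Subgroup.subset_closure (G := SignSemidirect (ZMod p × ZMod p))
    (k := {⟨Multiplicative.ofAdd (0, 0), -1⟩, ⟨Multiplicative.ofAdd (1, 0), -1⟩,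
      ⟨Multiplicative.ofAdd (1, 1), -1⟩}) (Or.inr (Or.inl rfl))
  have h₂ := Subgroup.subset_closure (G := SignSemidirect (ZMod p × ZMod p))
    (k := {⟨Multiplicative.ofAdd (0, 0), -1⟩, ⟨Multiplicative.ofAdd (1, 0), -1⟩,
      ⟨Multiplicative.ofAdd (1, 1), -1⟩}) (Or.inr (Or.inr rfl))
  refine SignSemidirect.eq_top_of_det₂ h₀ (Subgroup.mul_mem _ h₀ h₁) (Subgroup.mul_mem _ h₁ h₂) rfl
    (by simp) (by simp) ?_
  simp only [SignSemidirect.mul_left_toAdd, det₂]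
  simp

/-- Every triple of reflections generating `(ℤ/p)² ⋊ {±1}` lifts. -/
theorem exists_involutionTriple [CompactSpace Γ] [TotallyDisconnectedSpace Γ] [T2Space Γ]
    (hp : Odd p) (hψ : IsUniversalPFrattiniCover p ψ) : ∃ s₀ s₁ s₂, InvolutionTriple ψ s₀ s₁ s₂ := by
  have key : ∀ g : SignSemidirect (ZMod p × ZMod p), g.right = -1 → ∃ s, s * s = 1 ∧ ψ s = g := by
    intro g hg
    obtain ⟨γ, rfl⟩ := hψ.surjective g
    obtain ⟨s, hs, hs2⟩ := exists_involution (N := ψ.ker) hp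
      ((IsLocallyConstant.of_isOpen_ker hψ.isOpen_ker).isClosed_preimage {1})
      (fun n hn U => hψ.exists_pow_mem hn U) (γ := γ)
      (by rw [MonoidHom.mem_ker, map_mul, SignSemidirect.mul_self_eq_one hg])
    refine ⟨s, hs2, ?_⟩
    rw [MonoidHom.mem_ker, map_mul, map_inv, inv_mul_eq_one] at hs
    exact hs.symm
  obtain ⟨s₀, h₀, e₀⟩ := key ⟨Multiplicative.ofAdd (0, 0), -1⟩ rfl
  obtain ⟨s₁, h₁, e₁⟩ := key ⟨Multiplicative.ofAdd (1, 0), -1⟩ rfl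
  obtain ⟨s₂, h₂, e₂⟩ := key ⟨Multiplicative.ofAdd (1, 1), -1⟩ rfl
  refine ⟨s₀, s₁, s₂, h₀, h₁, h₂, by rw [e₀], by rw [e₁], by rw [e₂], ?_⟩
  rw [e₀, e₁, e₂]
  exact closure_reflections_eq_top p

end Triple

/-! ### The quotient `(ℤ_p)² ⋊ {±1}` -/

section PadicTopology

variable (p : ℕ) [Fact p.Prime]

theorem isLocallyConstant_toZModPow (n : ℕ) :
    IsLocallyConstant (PadicInt.toZModPow n : ℤ_[p] → ZMod (p ^ n)) := by
  rw [IsLocallyConstant.iff_eventually_eq]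
  intro x
  have hpos : (0 : ℝ) < (p : ℝ) ^ (-(n : ℤ)) :=
    zpow_pos (by exact_mod_cast (Fact.out : p.Prime).pos) _
  filter_upwards [Metric.ball_mem_nhds x hpos] with y hy
  rw [← sub_eq_zero, ← map_sub, ← RingHom.mem_ker, PadicInt.ker_toZModPow,
    ← PadicInt.norm_le_pow_iff_mem_span_pow, ← dist_eq_norm]
  exact (Metric.mem_ball.1 hy).le

/-- Reduction modulo `p^n` of `(ℤ_p)² ⋊ {±1}`. -/
noncomputable def padicRed (n : ℕ) :
    SignSemidirect (ℤ_[p] × ℤ_[p]) →* SignSemidirect (ZMod (p ^ n) × ZMod (p ^ n)) :=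
  SignSemidirect.map (AddMonoidHom.prodMap (PadicInt.toZModPow (p := p) n).toAddMonoidHom
    (PadicInt.toZModPow (p := p) n).toAddMonoidHom)

/-- Reduction modulo `m`, for `m ∣ n`. -/
noncomputable def zmodRed {m n : ℕ} (h : m ∣ n) :
    SignSemidirect (ZMod n × ZMod n) →* SignSemidirect (ZMod m × ZMod m) :=
  SignSemidirect.map (AddMonoidHom.prodMap (ZMod.castHom h (ZMod m)).toAddMonoidHom
    (ZMod.castHom h (ZMod m)).toAddMonoidHom)

variable {p}

theorem padicRed_left (n : ℕ) (g : SignSemidirect (ℤ_[p] × ℤ_[p])) :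
    (padicRed p n g).left.toAdd =
      (PadicInt.toZModPow n g.left.toAdd.1, PadicInt.toZModPow n g.left.toAdd.2) := rfl

theorem zmodRed_left {m n : ℕ} (h : m ∣ n) (g : SignSemidirect (ZMod n × ZMod n)) :
    (zmodRed h g).left.toAdd =
      (ZMod.castHom h (ZMod m) g.left.toAdd.1, ZMod.castHom h (ZMod m) g.left.toAdd.2) := rfl

theorem zmodRed_surjective {m n : ℕ} (h : m ∣ n) : Function.Surjective (zmodRed h) := by
  rintro ⟨⟨a, b⟩, ε⟩
  obtain ⟨a', ha⟩ := ZMod.castHom_surjective h a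
  obtain ⟨b', hb⟩ := ZMod.castHom_surjective h b
  refine ⟨⟨Multiplicative.ofAdd (a', b'), ε⟩, ?_⟩
  rw [SignSemidirect.ext_iff', zmodRed_left]
  exact ⟨Prod.ext ha hb, rfl⟩

theorem padicRed_surjective (n : ℕ) : Function.Surjective (padicRed p n) := by
  have hs : Function.Surjective (PadicInt.toZModPow (p := p) n) :=
    ZMod.ringHom_surjective _
  rintro ⟨⟨a, b⟩, ε⟩
  obtain ⟨a', ha⟩ := hs a
  obtain ⟨b', hb⟩ := hs b
  refine ⟨⟨Multiplicative.ofAdd (a', b'), ε⟩, ?_⟩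
  rw [SignSemidirect.ext_iff', padicRed_left]
  exact ⟨Prod.ext ha hb, rfl⟩

theorem zmodRed_padicRed {m n : ℕ} (h : m ≤ n) (g : SignSemidirect (ℤ_[p] × ℤ_[p])) :
    zmodRed (pow_dvd_pow p h) (padicRed p n g) = padicRed p m g := by
  have key := fun x : ℤ_[p] => RingHom.congr_fun (PadicInt.zmod_cast_comp_toZModPow (p := p) m n h) x
  rw [SignSemidirect.ext_iff', zmodRed_left, padicRed_left, padicRed_left]
  exact ⟨Prod.ext (key _) (key _), rfl⟩

/-- Both reductions `ℤ_p → ℤ/p` have the unique maximal ideal as kernel, and a ring homomorphism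
onto `ℤ/p` is determined by its kernel. -/
theorem zmodRed_padicRed_eq_map (n : ℕ) (g : SignSemidirect (ℤ_[p] × ℤ_[p])) :
    zmodRed (dvd_pow_self p n.succ_ne_zero) (padicRed p (n + 1) g) =
      SignSemidirect.map (padicSqToZMod p) g := by
  have key : (ZMod.castHom (dvd_pow_self p n.succ_ne_zero) (ZMod p)).comp
      (PadicInt.toZModPow (p := p) (n + 1)) = PadicInt.toZMod := by
    apply ZMod.ringHom_eq_of_ker_eq
    have h1 : (RingHom.ker ((ZMod.castHom (dvd_pow_self p n.succ_ne_zero) (ZMod p)).comp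
        (PadicInt.toZModPow (p := p) (n + 1)))).IsMaximal :=
      RingHom.ker_isMaximal_of_surjective _ (ZMod.ringHom_surjective _)
    rw [PadicInt.ker_toZMod]
    exact IsLocalRing.eq_maximalIdeal h1
  rw [SignSemidirect.ext_iff', zmodRed_left, padicRed_left]
  exact ⟨Prod.ext (RingHom.congr_fun key _) (RingHom.congr_fun key _), rfl⟩

theorem eq_of_forall_padicRed_eq {g h : SignSemidirect (ℤ_[p] × ℤ_[p])}
    (H : ∀ n, padicRed p (n + 1) g = padicRed p (n + 1) h) : g = h := by
  have H' : ∀ n, padicRed p n g = padicRed p n h := fun n => by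
    rw [← zmodRed_padicRed n.le_succ, ← zmodRed_padicRed n.le_succ, H]
  have key : ∀ n, _ := fun n => (SignSemidirect.ext_iff'.1 (H' n)).1
  simp only [padicRed_left, Prod.ext_iff] at key
  rw [SignSemidirect.ext_iff']
  exact ⟨Prod.ext (PadicInt.ext_of_toZModPow.1 fun n => (key n).1)
    (PadicInt.ext_of_toZModPow.1 fun n => (key n).2), (SignSemidirect.ext_iff'.1 (H 0)).2⟩

theorem continuous_signSemidirect_coord {A : Type*} [AddCommGroup A] [TopologicalSpace A] :
    Continuous fun x : SignSemidirect A => (x.left.toAdd, x.right) := continuous_induced_dom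

theorem isLocallyConstant_right {A : Type*} [AddCommGroup A] [TopologicalSpace A] :
    IsLocallyConstant fun x : SignSemidirect A => x.right :=
  (IsLocallyConstant.of_discrete (id : ℤˣ → ℤˣ)).comp_continuous
    (continuous_snd.comp continuous_signSemidirect_coord)

theorem isLocallyConstant_padicRed (n : ℕ) : IsLocallyConstant (padicRed p n) := by
  have h := continuous_fst.comp (continuous_signSemidirect_coord (A := ℤ_[p] × ℤ_[p]))
  have h1 := (isLocallyConstant_toZModPow p n).comp_continuous (continuous_fst.comp h)
  have h2 := (isLocallyConstant_toZModPow p n).comp_continuous (continuous_snd.comp h)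
  exact ((h1.prodMk h2).prodMk isLocallyConstant_right).comp
    fun x => (⟨Multiplicative.ofAdd x.1, x.2⟩ : SignSemidirect (ZMod (p ^ n) × ZMod (p ^ n)))

/-- The coordinates of `A ⋊ {±1}`. -/
def signSemidirectHomeomorph (A : Type*) [AddCommGroup A] [TopologicalSpace A] :
    SignSemidirect A ≃ₜ A × ℤˣ where
  toFun x := (x.left.toAdd, x.right)
  invFun x := ⟨Multiplicative.ofAdd x.1, x.2⟩
  left_inv _ := rfl
  right_inv _ := rfl
  continuous_toFun := continuous_induced_dom
  continuous_invFun := continuous_induced_rng.2 continuous_id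

instance (A : Type*) [AddCommGroup A] [TopologicalSpace A] [T2Space A] :
    T2Space (SignSemidirect A) :=
  (signSemidirectHomeomorph A).symm.t2Space

instance (A : Type*) [AddCommGroup A] [TopologicalSpace A] [CompactSpace A] :
    CompactSpace (SignSemidirect A) :=
  (signSemidirectHomeomorph A).symm.compactSpace

theorem isPGroup_ker_zmodRed (n : ℕ) :
    IsPGroup p (zmodRed (dvd_pow_self p n.succ_ne_zero)).ker := by
  rintro ⟨x, hx⟩
  refine ⟨n + 1, Subtype.ext ?_⟩
  change x ^ p ^ (n + 1) = 1
  have hr : x.right = 1 := congrArg (fun g : SignSemidirect (ZMod p × ZMod p) => g.right) hx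
  obtain ⟨e1, e2⟩ := SignSemidirect.left_zpow hr ((p ^ (n + 1) : ℕ) : ℤ)
  rw [zpow_natCast] at e1 e2
  rw [SignSemidirect.ext_iff', e1, e2]
  refine ⟨?_, rfl⟩
  rw [natCast_zsmul]
  have h0 : ((p ^ (n + 1) : ℕ) : ZMod (p ^ n.succ)) = 0 := ZMod.natCast_self _
  ext
  · rw [Prod.smul_fst, nsmul_eq_mul, h0, zero_mul]; rfl
  · rw [Prod.smul_snd, nsmul_eq_mul, h0, zero_mul]; rfl

end PadicTopology

section PadicQuotient

variable {p : ℕ} [Fact p.Prime] {Γ : Type*} [Group Γ]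
  {ψ : Γ →* SignSemidirect (ZMod p × ZMod p)} {s₀ s₁ s₂ : Γ}

/-- A residue modulo `p ^ (n + 1)` is a unit as soon as it is nonzero modulo `p`, where the
determinant is that of the original triple. -/
theorem InvolutionTriple.isUnit_det₂_of_lift (h : InvolutionTriple ψ s₀ s₁ s₂) {n : ℕ}
    {μ : Γ →* SignSemidirect (ZMod (p ^ (n + 1)) × ZMod (p ^ (n + 1)))}
    (hμ : (zmodRed (dvd_pow_self p n.succ_ne_zero)).comp μ = ψ) :
    IsUnit (det₂ (μ (s₀ * s₁)).left.toAdd (μ (s₁ * s₂)).left.toAdd) := by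
  refine ZMod.isUnit_of_castHom_ne_zero (dvd_pow_self p n.succ_ne_zero) ?_
  have := h.isUnit_det₂.ne_zero
  rw [← hμ, MonoidHom.comp_apply, MonoidHom.comp_apply, zmodRed_left, zmodRed_left] at this
  simpa [det₂] using this

theorem right_of_lift {n : ℕ} {μ : Γ →* SignSemidirect (ZMod (p ^ (n + 1)) × ZMod (p ^ (n + 1)))}
    (hμ : (zmodRed (dvd_pow_self p n.succ_ne_zero)).comp μ = ψ) (γ : Γ) :
    (μ γ).right = (ψ γ).right := by
  rw [← hμ]; rfl

theorem InvolutionTriple.surjective_of_lift (h : InvolutionTriple ψ s₀ s₁ s₂) {n : ℕ}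
    {μ : Γ →* SignSemidirect (ZMod (p ^ (n + 1)) × ZMod (p ^ (n + 1)))}
    (hμ : (zmodRed (dvd_pow_self p n.succ_ne_zero)).comp μ = ψ) : Function.Surjective μ := by
  rw [← MonoidHom.range_eq_top]
  refine SignSemidirect.eq_top_of_det₂ ⟨s₀, rfl⟩ ⟨s₀ * s₁, rfl⟩ ⟨s₁ * s₂, rfl⟩ ?_ ?_ ?_
    (h.isUnit_det₂_of_lift hμ)
  · rw [right_of_lift hμ, h.right₀]
  · rw [right_of_lift hμ, map_mul, SemidirectProduct.mul_right, h.right₀, h.right₁]; rfl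
  · rw [right_of_lift hμ, map_mul, SemidirectProduct.mul_right, h.right₁, h.right₂]; rfl

variable [TopologicalSpace Γ] [IsTopologicalGroup Γ]

theorem exists_hom_zmod (hψ : IsUniversalPFrattiniCover p ψ) (n : ℕ) :
    ∃ μ : Γ →* SignSemidirect (ZMod (p ^ (n + 1)) × ZMod (p ^ (n + 1))),
      IsLocallyConstant μ ∧ (zmodRed (dvd_pow_self p n.succ_ne_zero)).comp μ = ψ := by
  obtain ⟨μ, h1, h2⟩ := hψ.versal _ (zmodRed (dvd_pow_self p n.succ_ne_zero))
    (zmodRed_surjective _) (isPGroup_ker_zmodRed n)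
  exact ⟨μ, IsLocallyConstant.of_isOpen_ker h1, h2⟩

/-- A coherent choice of homomorphisms onto `(ℤ/p^n)² ⋊ {±1}`. -/
theorem InvolutionTriple.exists_coherent (h : InvolutionTriple ψ s₀ s₁ s₂)
    (hψ : IsUniversalPFrattiniCover p ψ) :
    ∃ μ : ∀ n : ℕ, Γ →* SignSemidirect (ZMod (p ^ (n + 1)) × ZMod (p ^ (n + 1))),
      (∀ n, IsLocallyConstant (μ n)) ∧
      (∀ n, (zmodRed (dvd_pow_self p n.succ_ne_zero)).comp (μ n) = ψ) ∧
      ∀ n, (zmodRed (pow_dvd_pow p (n + 1).le_succ)).comp (μ (n + 1)) = μ n := by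
  let D := SignSemidirect (ℤ_[p] × ℤ_[p])
  -- Versality gives a lift at each level, with no compatibility between levels. A lift is
  -- determined by the images of the three involutions, so lifts are encoded by triples in the
  -- compact space `D × D × D`. The sets `t n` are nonempty, closed and decreasing, and a common
  -- point gives a coherent system.
  let t : ℕ → Set (D × D × D) := fun n => {d | ∃ μ : Γ →* SignSemidirect
    (ZMod (p ^ (n + 1)) × ZMod (p ^ (n + 1))), IsLocallyConstant μ ∧
      (zmodRed (dvd_pow_self p n.succ_ne_zero)).comp μ = ψ ∧ μ s₀ = padicRed p (n + 1) d.1 ∧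
      μ s₁ = padicRed p (n + 1) d.2.1 ∧ μ s₂ = padicRed p (n + 1) d.2.2}
  have hcl : ∀ n, IsClosed (t n) := by
    intro n
    have hr := isLocallyConstant_padicRed (p := p) (n + 1)
    have hlc := (hr.comp_continuous (f := fun d : D × D × D => d.1) (by fun_prop)).prodMk
      ((hr.comp_continuous (f := fun d : D × D × D => d.2.1) (by fun_prop)).prodMk
      (hr.comp_continuous (f := fun d : D × D × D => d.2.2) (by fun_prop)))
    exact hlc.isClosed_preimage {x | ∃ μ : Γ →* SignSemidirect
      (ZMod (p ^ (n + 1)) × ZMod (p ^ (n + 1))), IsLocallyConstant μ ∧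
      (zmodRed (dvd_pow_self p n.succ_ne_zero)).comp μ = ψ ∧ μ s₀ = x.1 ∧
      μ s₁ = x.2.1 ∧ μ s₂ = x.2.2}
  have hred : ∀ (n : ℕ) (x : SignSemidirect (ZMod (p ^ (n + 1 + 1)) × ZMod (p ^ (n + 1 + 1)))),
      zmodRed (dvd_pow_self p n.succ_ne_zero) (zmodRed (pow_dvd_pow p (n + 1).le_succ) x) =
        zmodRed (dvd_pow_self p (n + 1).succ_ne_zero) x := by
    intro n x
    obtain ⟨d, rfl⟩ := padicRed_surjective (n + 1 + 1) x
    rw [zmodRed_padicRed (n + 1).le_succ, zmodRed_padicRed_eq_map, zmodRed_padicRed_eq_map]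
  obtain ⟨d, hd⟩ := IsCompact.nonempty_iInter_of_sequence_nonempty_isCompact_isClosed t (by
      rintro n d ⟨μ, h1, h2, e₀, e₁, e₂⟩
      refine ⟨(zmodRed (pow_dvd_pow p (n + 1).le_succ)).comp μ, h1.comp (zmodRed _), ?_, ?_, ?_, ?_⟩
      · ext1 γ
        rw [← h2]
        exact hred n (μ γ)
      · rw [MonoidHom.comp_apply, e₀, zmodRed_padicRed (n + 1).le_succ]
      · rw [MonoidHom.comp_apply, e₁, zmodRed_padicRed (n + 1).le_succ]
      · rw [MonoidHom.comp_apply, e₂, zmodRed_padicRed (n + 1).le_succ]) (by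
      intro n
      obtain ⟨μ, h1, h2⟩ := exists_hom_zmod hψ n
      obtain ⟨d₀, e₀⟩ := padicRed_surjective (n + 1) (μ s₀)
      obtain ⟨d₁, e₁⟩ := padicRed_surjective (n + 1) (μ s₁)
      obtain ⟨d₂, e₂⟩ := padicRed_surjective (n + 1) (μ s₂)
      exact ⟨(d₀, d₁, d₂), μ, h1, h2, e₀.symm, e₁.symm, e₂.symm⟩) (hcl 0).isCompact hcl
  rw [Set.mem_iInter] at hd
  choose μ h1 h2 e₀ e₁ e₂ using hd
  refine ⟨μ, h1, h2, fun n => h.hom_ext hψ ((h1 (n + 1)).comp (zmodRed _)) (h1 n) ?_ ?_ ?_⟩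
  · rw [MonoidHom.comp_apply, e₀, zmodRed_padicRed (n + 1).le_succ, e₀]
  · rw [MonoidHom.comp_apply, e₁, zmodRed_padicRed (n + 1).le_succ, e₁]
  · rw [MonoidHom.comp_apply, e₂, zmodRed_padicRed (n + 1).le_succ, e₂]

/-- This is the inverse limit of the coherent system. The values exist by compactness of `(ℤ_p)² ⋊
{±1}`, and surjectivity comes from that of each level by compactness of `Γ`. -/
theorem InvolutionTriple.exists_hom_padic [CompactSpace Γ] (h : InvolutionTriple ψ s₀ s₁ s₂)
    (hψ : IsUniversalPFrattiniCover p ψ) :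
    ∃ e : Γ →* SignSemidirect (ℤ_[p] × ℤ_[p]), Continuous e ∧ Function.Surjective e ∧
      ∀ γ, SignSemidirect.map (padicSqToZMod p) (e γ) = ψ γ := by
  obtain ⟨μ, hlc, hover, hcoh⟩ := h.exists_coherent hψ
  have hcoh' : ∀ n γ, zmodRed (pow_dvd_pow p (n + 1).le_succ) (μ (n + 1) γ) = μ n γ :=
    fun n γ => DFunLike.congr_fun (hcoh n) γ
  have hex : ∀ γ, ∃ d, ∀ n, padicRed p (n + 1) d = μ n γ := by
    intro γ
    have hcl : ∀ n, IsClosed {d | padicRed p (n + 1) d = μ n γ} := fun n =>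
      (isLocallyConstant_padicRed (n + 1)).isClosed_fiber _
    obtain ⟨d, hd⟩ := IsCompact.nonempty_iInter_of_sequence_nonempty_isCompact_isClosed
      (fun n => {d | padicRed p (n + 1) d = μ n γ}) (fun n d hd => by
        change padicRed p (n + 1) d = μ n γ
        rw [← hcoh', ← (hd : padicRed p (n + 1 + 1) d = _), zmodRed_padicRed (n + 1).le_succ])
      (fun n => padicRed_surjective (n + 1) (μ n γ)) (hcl 0).isCompact hcl
    exact ⟨d, Set.mem_iInter.1 hd⟩
  choose e he using hex
  let E : Γ →* SignSemidirect (ℤ_[p] × ℤ_[p]) :=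
    { toFun := e
      map_one' := eq_of_forall_padicRed_eq fun n => by rw [he, map_one, map_one]
      map_mul' := fun a b => eq_of_forall_padicRed_eq fun n => by
        rw [he, map_mul, map_mul, he, he] }
  refine ⟨E, ?_, ?_, ?_⟩
  · rw [continuous_iff_isClosed]
    intro C hC
    -- Closed graph argument: the graph is cut out by locally constant conditions, and projection
    -- along a compact factor is a closed map.
    have hset : E ⁻¹' C = Prod.fst '' ((⋂ n, {x : Γ × SignSemidirect (ℤ_[p] × ℤ_[p]) |
        padicRed p (n + 1) x.2 = μ n x.1}) ∩ Prod.snd ⁻¹' C) := by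
      ext γ
      constructor
      · intro hγ
        exact ⟨(γ, e γ), ⟨Set.mem_iInter.2 (he γ), hγ⟩, rfl⟩
      · rintro ⟨⟨γ', d⟩, ⟨h1, h2⟩, rfl⟩
        rw [Set.mem_iInter] at h1
        have : e γ' = d := eq_of_forall_padicRed_eq fun n => (he γ' n).trans (h1 n).symm
        change e γ' ∈ C
        rw [this]
        exact h2
    rw [hset]
    refine isClosedMap_fst_of_compactSpace _ ((isClosed_iInter fun n => ?_).inter
      (hC.preimage continuous_snd))
    exact (((isLocallyConstant_padicRed (n + 1)).comp_continuous continuous_snd).prodMk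
      ((hlc n).comp_continuous continuous_fst)).isClosed_preimage {x | x.1 = x.2}
  · intro d
    have hcl : ∀ n, IsClosed {γ | μ n γ = padicRed p (n + 1) d} := fun n => (hlc n).isClosed_fiber _
    obtain ⟨γ, hγ⟩ := IsCompact.nonempty_iInter_of_sequence_nonempty_isCompact_isClosed
      (fun n => {γ | μ n γ = padicRed p (n + 1) d}) (fun n γ hγ => by
        change μ n γ = padicRed p (n + 1) d
        rw [← hcoh', (hγ : μ (n + 1) γ = _), zmodRed_padicRed (n + 1).le_succ])
      (fun n => h.surjective_of_lift (hover n) _) (hcl 0).isCompact hcl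
    rw [Set.mem_iInter] at hγ
    exact ⟨γ, eq_of_forall_padicRed_eq fun n => (he γ n).trans (hγ n)⟩
  · intro γ
    rw [← zmodRed_padicRed_eq_map 0, ← hover 0]
    exact congrArg _ (he γ 0)

end PadicQuotient

/-! ### Nielsen classes of reflections -/

section Nielsen

/-- The order of `h²` divides both the order of `h`, prime to `p`, and a power of `p`. -/
theorem mul_self_eq_one_of_coprime {H : Type*} [Group H] {p : ℕ} {h : H}
    (hc : (orderOf h).Coprime p) {k : ℕ} (hk : (h * h) ^ p ^ k = 1) : h * h = 1 := by
  rw [← orderOf_eq_one_iff]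
  refine Nat.eq_one_of_dvd_coprimes (hc.pow_right k) ?_ (orderOf_dvd_of_pow_eq_one hk)
  rw [← pow_two]
  exact orderOf_pow_dvd 2

theorem coprime_orderOf_of_mul_self {H : Type*} [Group H] {p : ℕ} (hp : Odd p) {h : H}
    (hh : h * h = 1) : (orderOf h).Coprime p :=
  Nat.Coprime.coprime_dvd_left (orderOf_dvd_of_pow_eq_one ((pow_two h).trans hh))
    (Nat.coprime_two_left.2 hp)

theorem closure_range_fin_four {H : Type*} [Group H] {g : Fin 4 → H}
    (h : g 0 * g 1 * g 2 * g 3 = 1) :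
    Subgroup.closure (Set.range g) = Subgroup.closure {g 0, g 1, g 2} := by
  refine le_antisymm ?_ (Subgroup.closure_mono ?_)
  · rw [Subgroup.closure_le]
    have h₀ : g 0 ∈ Subgroup.closure {g 0, g 1, g 2} := Subgroup.subset_closure (by simp)
    have h₁ : g 1 ∈ Subgroup.closure {g 0, g 1, g 2} := Subgroup.subset_closure (by simp)
    have h₂ : g 2 ∈ Subgroup.closure {g 0, g 1, g 2} := Subgroup.subset_closure (by simp)
    rintro _ ⟨i, rfl⟩
    fin_cases i
    · exact h₀
    · exact h₁
    · exact h₂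
    · have : g 3 = (g 0 * g 1 * g 2)⁻¹ := (inv_eq_of_mul_eq_one_right h).symm
      change g 3 ∈ Subgroup.closure {g 0, g 1, g 2}
      rw [this]
      exact Subgroup.inv_mem _ (Subgroup.mul_mem _ (Subgroup.mul_mem _ h₀ h₁) h₂)
  · rintro x (rfl | rfl | rfl) <;> exact ⟨_, rfl⟩

theorem ofFn_prod_fin_four {H : Type*} [Group H] (g : Fin 4 → H) :
    (List.ofFn g).prod = g 0 * g 1 * g 2 * g 3 := by
  simp [List.ofFn_succ, mul_assoc]

variable {p : ℕ}

theorem conjClasses_mk_eq_negOne_iff (hp : Odd p) (g : SignSemidirect (ZMod p × ZMod p)) :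
    ConjClasses.mk g = ConjClasses.mk (SignSemidirect.negOne (ZMod p × ZMod p)) ↔
      g.right = -1 := by
  rw [ConjClasses.mk_eq_mk_iff_isConj, isConj_iff]
  constructor
  · rintro ⟨c, hc⟩
    have : c.right * g.right * c.right⁻¹ = -1 :=
      congrArg (fun g : SignSemidirect (ZMod p × ZMod p) => g.right) hc
    rwa [mul_comm c.right, mul_inv_cancel_right] at this
  · intro hg
    obtain ⟨m, hm⟩ := hp
    -- Conjugating a reflection by the translation by `w` shifts it by `2w`. With `p = 2m + 1`, the
    -- number `m + 1` is one half modulo `p`.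
    refine ⟨SemidirectProduct.inl (Multiplicative.ofAdd (-((m + 1 : ℕ) • g.left.toAdd))), ?_⟩
    have h0 : (2 * m + 1) • g.left.toAdd = 0 := by
      rw [← hm]
      ext <;> simp
    rw [SignSemidirect.ext_iff', ← map_inv, SignSemidirect.mul_left_toAdd,
      SignSemidirect.mul_left_toAdd]
    constructor
    · simp only [SemidirectProduct.left_inl, SemidirectProduct.right_inl,
        SemidirectProduct.mul_right, hg, toAdd_ofAdd, toAdd_inv]
      change _ = (0 : ZMod p × ZMod p)
      rw [← neg_eq_zero, ← h0]
      simp only [Units.val_one, one_mul, Units.val_neg, one_smul, neg_smul, neg_neg]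
      module
    · simp [hg, SignSemidirect.negOne]

/-- The four classes coincide, so their order is irrelevant and the class condition is one on signs.
Product one makes the fourth entry redundant for generation. -/
theorem mem_nielsenClass_iff (hp : Odd p) {H : Type*} [Group H]
    {f : H →* SignSemidirect (ZMod p × ZMod p)} {g : Fin 4 → H} :
    g ∈ NielsenClass p f (classes24 (ZMod p × ZMod p)) ↔
      (∀ i, (orderOf (g i)).Coprime p ∧ (f (g i)).right = -1) ∧
        Subgroup.closure {g 0, g 1, g 2} = ⊤ ∧ g 0 * g 1 * g 2 * g 3 = 1 := by
  simp only [NielsenClass, classes24, Set.mem_ofPred_eq, conjClasses_mk_eq_negOne_iff hp,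
    ofFn_prod_fin_four]
  constructor
  · rintro ⟨⟨π, hπ⟩, hgen, hprod⟩
    refine ⟨fun i => ?_, by rwa [← closure_range_fin_four hprod], hprod⟩
    simpa using hπ (π.symm i)
  · rintro ⟨h, hgen, hprod⟩
    exact ⟨⟨1, h⟩, by rwa [closure_range_fin_four hprod], hprod⟩

theorem nielsenClass_nonempty (hp : Odd p) :
    (NielsenClass p (MonoidHom.id (SignSemidirect (ZMod p × ZMod p)))
      (classes24 (ZMod p × ZMod p))).Nonempty := by
  -- Reflections with translation parts `a, b, c, d` multiply to the translation by `a - b + c - d`,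
  -- which vanishes for the consecutive vertices of a parallelogram.
  refine ⟨![⟨Multiplicative.ofAdd (0, 0), -1⟩, ⟨Multiplicative.ofAdd (1, 0), -1⟩,
    ⟨Multiplicative.ofAdd (1, 1), -1⟩, ⟨Multiplicative.ofAdd (0, 1), -1⟩],
    (mem_nielsenClass_iff hp).2 ⟨fun i => ?_, closure_reflections_eq_top p, ?_⟩⟩
  · have key : ∀ g : SignSemidirect (ZMod p × ZMod p), g.right = -1 →
        (orderOf g).Coprime p ∧ (MonoidHom.id _ g).right = -1 := fun g hg =>
      ⟨coprime_orderOf_of_mul_self hp (SignSemidirect.mul_self_eq_one hg), hg⟩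
    fin_cases i <;> exact key _ rfl
  · rw [SignSemidirect.ext_iff']
    simp only [SignSemidirect.mul_left_toAdd, SemidirectProduct.mul_right]
    constructor
    · ext <;> simp
    · simp

/-! ### The obstruction from the Heisenberg extension -/

namespace HeisenbergSign

variable {R : Type*} [CommRing R]

theorem commutator_eq {x y : HeisenbergSign R} (hx : x.right = 1) (hy : y.right = 1) :
    x * y * x⁻¹ * y⁻¹ = SemidirectProduct.inl ⟨0, 0, det₂ (HeisenbergSign.proj R x).left.toAdd
      (HeisenbergSign.proj R y).left.toAdd⟩ := by
  have ex : x = SemidirectProduct.inl x.left := SemidirectProduct.ext rfl hx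
  have ey : y = SemidirectProduct.inl y.left := SemidirectProduct.ext rfl hy
  conv_lhs => rw [ex, ey]
  rw [← map_inv, ← map_inv, ← map_mul, ← map_mul, ← map_mul, Heisenberg.commutator_eq]
  rfl

theorem mul_self_eq {h : HeisenbergSign R} (hr : h.right = -1) :
    h * h = SemidirectProduct.inl ⟨0, 0, 2 * h.left.z - h.left.x * h.left.y⟩ := by
  have e : Heisenberg.signAut R (-1) h.left = ⟨-h.left.x, -h.left.y, h.left.z⟩ := by
    ext <;> simp [Heisenberg.signAut]
  refine SemidirectProduct.ext ?_ ?_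
  · rw [SemidirectProduct.mul_left, hr, e]
    ext
    · simp
    · simp
    · simp; ring
  · rw [SemidirectProduct.mul_right, hr]; rfl

theorem central_pow (z : R) (k : ℕ) :
    (SemidirectProduct.inl ⟨0, 0, z⟩ : HeisenbergSign R) ^ k =
      SemidirectProduct.inl ⟨0, 0, k * z⟩ := by
  rw [← map_pow, Heisenberg.central_pow]

theorem inl_central_eq_one_iff {z : R} :
    (SemidirectProduct.inl ⟨0, 0, z⟩ : HeisenbergSign R) = 1 ↔ z = 0 := by
  rw [← map_one SemidirectProduct.inl, SemidirectProduct.inl_inj]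
  simp [Heisenberg.ext_iff]

theorem mem_ker_proj_iff {h : HeisenbergSign R} : h ∈ (HeisenbergSign.proj R).ker ↔
    h = SemidirectProduct.inl ⟨0, 0, h.left.z⟩ := by
  rw [MonoidHom.mem_ker, SignSemidirect.ext_iff', proj_left, proj_right]
  constructor
  · rintro ⟨h1, h2⟩
    refine SemidirectProduct.ext (Heisenberg.ext ?_ ?_ rfl) h2
    · exact congrArg Prod.fst h1
    · exact congrArg Prod.snd h1
  · intro hh
    rw [hh]
    exact ⟨rfl, rfl⟩

theorem proj_surjective : Function.Surjective (HeisenbergSign.proj R) := fun g =>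
  ⟨⟨⟨g.left.toAdd.1, g.left.toAdd.2, 0⟩, g.right⟩, rfl⟩

theorem mem_ker_proj_pow {p : ℕ} {h : HeisenbergSign (ZMod p)}
    (hh : h ∈ (HeisenbergSign.proj (ZMod p)).ker) : h ^ p = 1 := by
  rw [mem_ker_proj_iff.1 hh, central_pow, CharP.cast_eq_zero, zero_mul]
  exact inl_central_eq_one_iff.2 rfl

theorem isPGroup_ker_proj (p : ℕ) : IsPGroup p (HeisenbergSign.proj (ZMod p)).ker := by
  rintro ⟨h, hh⟩
  refine ⟨1, Subtype.ext ?_⟩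
  change h ^ p ^ 1 = 1
  rw [pow_one, mem_ker_proj_pow hh]

instance (p : ℕ) [NeZero p] : Finite (HeisenbergSign (ZMod p)) := by
  have : Function.Injective fun h : HeisenbergSign (ZMod p) =>
      (h.left.x, h.left.y, h.left.z, h.right) := by
    intro a b hab
    simp only [Prod.mk.injEq] at hab
    exact SemidirectProduct.ext (Heisenberg.ext hab.1 hab.2.1 hab.2.2.1) hab.2.2.2
  exact Finite.of_injective _ this

theorem mul_self_eq_one_of_coprime {h : HeisenbergSign (ZMod p)} (hr : h.right = -1)
    (hc : (orderOf h).Coprime p) : h * h = 1 := by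
  refine _root_.mul_self_eq_one_of_coprime hc (k := 1) ?_
  rw [pow_one]
  refine mem_ker_proj_pow ?_
  rw [MonoidHom.mem_ker, map_mul]
  exact SignSemidirect.mul_self_eq_one hr

theorem mul_self_eq_one_iff {h : HeisenbergSign R} (hr : h.right = -1) :
    h * h = 1 ↔ 2 * h.left.z = h.left.x * h.left.y := by
  rw [mul_self_eq hr, inl_central_eq_one_iff, sub_eq_zero]

/-- Four involutions with product one, lifting a generating tuple of reflections, do not exist. -/
theorem prod_ne_one {h : Fin 4 → HeisenbergSign (ZMod p)} [Fact p.Prime]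
    (hr : ∀ i, (h i).right = -1) (hsq : ∀ i, h i * h i = 1)
    (hgen : Subgroup.closure {HeisenbergSign.proj _ (h 0), HeisenbergSign.proj _ (h 1),
      HeisenbergSign.proj _ (h 2)} = ⊤) : h 0 * h 1 * h 2 * h 3 ≠ 1 := by
  intro hprod
  -- The product of the first three is the involution `h 3`, so the commutator of the two
  -- translations is trivial. Its central coordinate is a unit determinant, a contradiction.
  have h3 : h 0 * h 1 * h 2 = h 3 := by
    rw [eq_inv_of_mul_eq_one_left hprod, inv_eq_of_mul_eq_one_left (hsq 3)]
  have hcomm := involutions_commutator (hsq 0) (hsq 1) (hsq 2) rfl rfl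
  rw [h3, hsq 3, inv_one, mul_one, mul_inv_cancel, commutator_eq
    (by rw [SemidirectProduct.mul_right, hr, hr]; rfl)
    (by rw [SemidirectProduct.mul_right, hr, hr]; rfl), inl_central_eq_one_iff] at hcomm
  refine (isUnit_det₂_of_span (SignSemidirect.exists_zsmul_of_closure_eq_top
    (hr 0) (hr 1) (hr 2) hgen)).ne_zero ?_
  rw [← map_mul, ← map_mul]
  exact hcomm

end HeisenbergSign

theorem isPrimeLift_heisenberg_iff (hp : Odd p) {g : Fin 4 → SignSemidirect (ZMod p × ZMod p)}
    (hg : ∀ i, (g i).right = -1) {h : Fin 4 → HeisenbergSign (ZMod p)} :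
    IsPrimeLift p (HeisenbergSign.proj (ZMod p)) g h ↔
      ∀ i, h i * h i = 1 ∧ HeisenbergSign.proj (ZMod p) (h i) = g i := by
  refine forall_congr' fun i => and_congr_left fun hi => ?_
  have hr : (h i).right = -1 := by rw [← hg i, ← hi]; rfl
  exact ⟨HeisenbergSign.mul_self_eq_one_of_coprime hr, coprime_orderOf_of_mul_self hp⟩

theorem ZMod.two_ne_zero_of_odd [Fact p.Prime] (hp : Odd p) : (2 : ZMod p) ≠ 0 := by
  have : ((2 : ℕ) : ZMod p) ≠ 0 := by
    rw [Ne, ZMod.natCast_eq_zero_iff]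
    intro h
    obtain rfl := (Nat.prime_dvd_prime_iff_eq Fact.out Nat.prime_two).1 h
    exact absurd hp (by decide)
  exact_mod_cast this

/-- Only the coordinate `z` of a lift is free, and the lift is an involution exactly when `2z = xy`,
which has one solution for odd `p`. -/
theorem existsUnique_isPrimeLift_heisenberg [Fact p.Prime] (hp : Odd p)
    {g : Fin 4 → SignSemidirect (ZMod p × ZMod p)} (hg : ∀ i, (g i).right = -1) :
    ∃! h, IsPrimeLift p (HeisenbergSign.proj (ZMod p)) g h := by
  have h2 := ZMod.two_ne_zero_of_odd hp
  simp only [isPrimeLift_heisenberg_iff hp hg]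
  refine ⟨fun i => ⟨⟨(g i).left.toAdd.1, (g i).left.toAdd.2,
    (g i).left.toAdd.1 * (g i).left.toAdd.2 / 2⟩, -1⟩, fun i => ⟨?_, ?_⟩, fun h hh => ?_⟩
  · rw [HeisenbergSign.mul_self_eq_one_iff rfl]
    field_simp
  · rw [SignSemidirect.ext_iff']
    exact ⟨rfl, (hg i).symm⟩
  · ext1 i
    obtain ⟨hsq, hpr⟩ := hh i
    obtain ⟨e1, e2⟩ := SignSemidirect.ext_iff'.1 hpr
    rw [HeisenbergSign.proj_left] at e1
    have hr : (h i).right = -1 := e2.trans (hg i)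
    rw [HeisenbergSign.mul_self_eq_one_iff hr] at hsq
    refine SemidirectProduct.ext (Heisenberg.ext ?_ ?_ ?_) hr
    · exact congrArg Prod.fst e1
    · exact congrArg Prod.snd e1
    · rw [← e1]
      exact (eq_div_iff h2).2 (by rw [mul_comm, hsq])

theorem isPrimeLift_heisenberg_prod_ne_one [Fact p.Prime] (hp : Odd p)
    {g : Fin 4 → SignSemidirect (ZMod p × ZMod p)}
    (hg : g ∈ NielsenClass p (MonoidHom.id _) (classes24 (ZMod p × ZMod p)))
    {h : Fin 4 → HeisenbergSign (ZMod p)}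
    (hh : IsPrimeLift p (HeisenbergSign.proj (ZMod p)) g h) : (List.ofFn h).prod ≠ 1 := by
  obtain ⟨h1, hgen, -⟩ := (mem_nielsenClass_iff hp).1 hg
  have hr : ∀ i, (g i).right = -1 := fun i => (h1 i).2
  have h2 := (isPrimeLift_heisenberg_iff hp hr).1 hh
  rw [ofFn_prod_fin_four]
  refine HeisenbergSign.prod_ne_one (fun i => ?_) (fun i => (h2 i).1) ?_
  · rw [← hr i, ← (h2 i).2]; rfl
  · rw [(h2 0).2, (h2 1).2, (h2 2).2, hgen]

end Nielsen

section Obstruction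

variable {p : ℕ} [Fact p.Prime] {Γ : Type*} [Group Γ]
  {ψ : Γ →* SignSemidirect (ZMod p × ZMod p)}

/-- A quotient of `Γ` that dominates the Heisenberg extension has empty Nielsen class. -/
theorem nielsenClass_eq_empty (hp : Odd p) {χ : Γ →* HeisenbergSign (ZMod p)}
    (hχ : (HeisenbergSign.proj (ZMod p)).comp χ = ψ) (hψ : Function.Surjective ψ) {N : Subgroup Γ}
    [N.Normal] (hN : N ≤ ψ.ker) (hNχ : N ≤ χ.ker) :
    NielsenClass p (QuotientGroup.lift N ψ hN) (classes24 (ZMod p × ZMod p)) = ∅ := by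
  rw [Set.eq_empty_iff_forall_notMem]
  intro t ht
  obtain ⟨h1, hgen, hprod⟩ := (mem_nielsenClass_iff hp).1 ht
  have hlift : ∀ x, HeisenbergSign.proj (ZMod p) (QuotientGroup.lift N χ hNχ x) =
      QuotientGroup.lift N ψ hN x := by
    intro x
    obtain ⟨γ, rfl⟩ := QuotientGroup.mk_surjective x
    exact DFunLike.congr_fun hχ γ
  have hr : ∀ i, (QuotientGroup.lift N χ hNχ (t i)).right = -1 := fun i => by
    rw [← (h1 i).2, ← hlift]; rfl
  refine HeisenbergSign.prod_ne_one (h := fun i => QuotientGroup.lift N χ hNχ (t i)) hr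
    (fun i => HeisenbergSign.mul_self_eq_one_of_coprime (hr i)
      ((h1 i).1.coprime_dvd_left (orderOf_map_dvd _ _))) ?_ ?_
  · simp only [hlift]
    have := congrArg (Subgroup.map (QuotientGroup.lift N ψ hN)) hgen
    rw [MonoidHom.map_closure, ← MonoidHom.range_eq_map, MonoidHom.range_eq_top.2
      (QuotientGroup.lift_surjective_of_surjective N ψ hψ hN)] at this
    simpa [Set.image_insert_eq] using this
  · simp only [← map_mul, hprod, map_one]

variable [TopologicalSpace Γ] [IsTopologicalGroup Γ]

/-- Versality gives the map, and the Frattini property of the Heisenberg extension makes it onto. -/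
theorem exists_hom_heisenberg (hψ : IsUniversalPFrattiniCover p ψ) :
    ∃ χ : Γ →* HeisenbergSign (ZMod p), IsLocallyConstant χ ∧ Function.Surjective χ ∧
      (HeisenbergSign.proj (ZMod p)).comp χ = ψ := by
  obtain ⟨χ, h1, h2⟩ := hψ.versal _ (HeisenbergSign.proj (ZMod p)) HeisenbergSign.proj_surjective
    (HeisenbergSign.isPGroup_ker_proj p)
  refine ⟨χ, IsLocallyConstant.of_isOpen_ker h1, ?_, h2⟩
  rw [← MonoidHom.range_eq_top]
  refine (isFrattiniCover_heisenbergSign_proj p).2 _ ?_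
  rw [MonoidHom.map_range, h2, MonoidHom.range_eq_top]
  exact hψ.surjective

end Obstruction

/-! ### The kernel of `Γ → (ℤ_p)² ⋊ {±1}` and maximal paths -/

section Kernel

variable {p : ℕ} [Fact p.Prime] {Γ : Type*} [Group Γ]
  {ψ : Γ →* SignSemidirect (ZMod p × ZMod p)} {s₀ s₁ s₂ : Γ}

theorem InvolutionTriple.right_mul₀₁ (h : InvolutionTriple ψ s₀ s₁ s₂) :
    (ψ (s₀ * s₁)).right = 1 := by
  rw [map_mul, SemidirectProduct.mul_right, h.right₀, h.right₁]; rfl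

theorem InvolutionTriple.right_mul₁₂ (h : InvolutionTriple ψ s₀ s₁ s₂) :
    (ψ (s₁ * s₂)).right = 1 := by
  rw [map_mul, SemidirectProduct.mul_right, h.right₁, h.right₂]; rfl

theorem pow_mem_ker_of_right_eq_one {γ : Γ} (h : (ψ γ).right = 1) : γ ^ p ∈ ψ.ker := by
  obtain ⟨e1, e2⟩ := SignSemidirect.left_zpow h (p : ℤ)
  rw [zpow_natCast] at e1 e2
  rw [MonoidHom.mem_ker, map_pow, SignSemidirect.ext_iff', e1, e2]
  refine ⟨?_, rfl⟩
  rw [natCast_zsmul]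
  ext <;> simp

section Over

variable {e : Γ →* SignSemidirect (ℤ_[p] × ℤ_[p])}

theorem ker_padic_le_ker
    (heψ : ∀ γ, SignSemidirect.map (padicSqToZMod p) (e γ) = ψ γ) : e.ker ≤ ψ.ker := fun γ hγ => by
  rw [MonoidHom.mem_ker, ← heψ, (hγ : e γ = 1), map_one]

theorem right_padic
    (heψ : ∀ γ, SignSemidirect.map (padicSqToZMod p) (e γ) = ψ γ) (γ : Γ) :
    (e γ).right = (ψ γ).right := by rw [← heψ]; rfl

theorem InvolutionTriple.mul_self_mem_ker
    (heψ : ∀ γ, SignSemidirect.map (padicSqToZMod p) (e γ) = ψ γ)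
    (h : InvolutionTriple ψ s₀ s₁ s₂) :
    s₀ * s₁ * s₂ * (s₀ * s₁ * s₂) ∈ e.ker := by
  rw [MonoidHom.mem_ker, map_mul]
  refine SignSemidirect.mul_self_eq_one ?_
  rw [right_padic heψ, map_mul, map_mul, SemidirectProduct.mul_right, SemidirectProduct.mul_right,
    h.right₀, h.right₁, h.right₂]
  rfl

end Over

variable [TopologicalSpace Γ]

theorem NielsenPath.limitKer_le_ker
    {C : Fin 4 → ConjClasses (SignSemidirect (ZMod p × ZMod p))} (P : NielsenPath p ψ C) :
    P.limitKer ≤ ψ.ker := by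
  obtain ⟨N, hN⟩ := P.nonempty
  exact (iInf_le _ (⟨N, hN⟩ : P.index)).trans N.2

variable [IsTopologicalGroup Γ]

theorem IsUniversalPFrattiniCover.exists_pow_mem_of_right_eq_one
    (hψ : IsUniversalPFrattiniCover p ψ) {γ : Γ} (h : (ψ γ).right = 1) (U : OpenNormalSubgroup Γ) :
    ∃ k : ℕ, ∀ n, k ≤ n → γ ^ p ^ n ∈ U := by
  obtain ⟨k, hk⟩ := hψ.exists_pow_mem (pow_mem_ker_of_right_eq_one h) U
  refine ⟨k + 1, fun n hn => ?_⟩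
  obtain ⟨m, rfl⟩ := Nat.exists_eq_add_of_le hn
  rw [pow_add, pow_succ', pow_mul, pow_mul]
  exact pow_mem hk _

/-- A closed normal subgroup of `Γ` that contains the square of `s₀s₁s₂` for a triple of involutions
contains the kernel of `Γ → (ℤ_p)² ⋊ {±1}`. -/
theorem InvolutionTriple.ker_le [CompactSpace Γ] [TotallyDisconnectedSpace Γ]
    (h : InvolutionTriple ψ s₀ s₁ s₂) (hψ : IsUniversalPFrattiniCover p ψ)
    {e : Γ →* SignSemidirect (ℤ_[p] × ℤ_[p])} (he : Continuous e)
    (heψ : ∀ γ, SignSemidirect.map (padicSqToZMod p) (e γ) = ψ γ)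
    {L : Subgroup Γ} [L.Normal] (hL : IsClosed (L : Set Γ))
    (hs : s₀ * s₁ * s₂ * (s₀ * s₁ * s₂) ∈ L) : e.ker ≤ L := by
  intro γ hγ
  refine mem_of_forall_openNormalSubgroup hL fun U => ?_
  obtain ⟨k₁, hk₁⟩ := hψ.exists_pow_mem_of_right_eq_one h.right_mul₀₁ U
  obtain ⟨k₂, hk₂⟩ := hψ.exists_pow_mem_of_right_eq_one h.right_mul₁₂ U
  -- The level is chosen so that `x` and `y` raised to `p ^ (n + 1)` lie in `U`. Comparing modulo `p
  -- ^ (n + 1)` will then control the exponents `a` and `b`.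
  let n := max k₁ k₂
  have hxU : (s₀ * s₁) ^ p ^ (n + 1) ∈ U := hk₁ _ ((le_max_left _ _).trans n.le_succ)
  have hyU : (s₁ * s₂) ^ p ^ (n + 1) ∈ U := hk₂ _ ((le_max_right _ _).trans n.le_succ)
  let μ := (padicRed p (n + 1)).comp e
  have hμψ : (zmodRed (dvd_pow_self p n.succ_ne_zero)).comp μ = ψ := by
    ext1 γ
    rw [← heψ, ← zmodRed_padicRed_eq_map n]
    rfl
  have hμ : IsLocallyConstant μ := (isLocallyConstant_padicRed (n + 1)).comp_continuous he
  obtain ⟨u, hu, huS⟩ := exists_mul_mem_of_dense (h.topologicalClosure hψ) γ (U ⊓ openKer μ hμ)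
  have huU : u ∈ (U : Subgroup Γ) := (hu : u ∈ (U : Set Γ) ∩ _).1
  have huμ : μ u = 1 := (hu : u ∈ (U : Set Γ) ∩ _).2
  have hc : s₀ * s₁ * (s₁ * s₂) * (s₀ * s₁)⁻¹ * (s₁ * s₂)⁻¹ ∈ L ⊓ e.ker := by
    rw [involutions_commutator h.sq₀ h.sq₁ h.sq₂ rfl rfl]
    exact (inferInstance : (L ⊓ e.ker).Normal).conj_mem _
      (inv_mem ⟨hs, h.mul_self_mem_ker heψ⟩) _
  obtain ⟨a, b, k, t, ht, hnf⟩ := involutions_normal_form_mod (L ⊓ e.ker) h.sq₀ h.sq₁ h.sq₂ rfl rfl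
    rfl (mul_mem ((inferInstance : (L ⊓ e.ker).Normal).conj_mem _ hc _) (inv_mem hc))
    (mul_mem ((inferInstance : (L ⊓ e.ker).Normal).conj_mem _ hc _) (inv_mem hc)) huS
  set x := s₀ * s₁ with hx
  set y := s₁ * s₂ with hy
  set c := x * y * x⁻¹ * y⁻¹
  have hμT : ∀ t ∈ L ⊓ e.ker, μ t = 1 := fun t ht => by
    rw [MonoidHom.comp_apply, (ht.2 : e t = 1), map_one]
  have hγμ : μ (γ * u) = 1 := by
    rw [map_mul, huμ, mul_one, MonoidHom.comp_apply, (hγ : e γ = 1), map_one]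
  have hxr : (μ x).right = 1 := by rw [right_of_lift hμψ, h.right_mul₀₁]
  have hyr : (μ y).right = 1 := by rw [right_of_lift hμψ, h.right_mul₁₂]
  obtain ⟨e1, e2⟩ := SignSemidirect.left_zpow_mul_zpow hxr hyr a b
  have hw : μ (x ^ a * y ^ b * c ^ k) = μ x ^ a * μ y ^ b := by
    rw [map_mul, hμT _ (zpow_mem hc k), mul_one, map_mul, map_zpow, map_zpow]
  rcases hnf with hnf | hnf
  · rw [hnf, map_mul, hμT t ht, mul_one, hw] at hγμ
    rw [hγμ] at e1
    -- Since `γu` dies modulo `p ^ (n + 1)` and the translations are independent there, `p ^ (n +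
    -- 1)` divides `a` and `b`, which puts `x^a y^b` in `U`.
    obtain ⟨ha, hb⟩ := eq_zero_of_det₂_isUnit (h.isUnit_det₂_of_lift hμψ) e1.symm
    rw [ZMod.intCast_zmod_eq_zero_iff_dvd] at ha hb
    have hwU : x ^ a * y ^ b ∈ (U : Subgroup Γ) := by
      obtain ⟨i, rfl⟩ := ha
      obtain ⟨j, rfl⟩ := hb
      rw [zpow_mul, zpow_mul, zpow_natCast, zpow_natCast]
      exact mul_mem (zpow_mem hxU i) (zpow_mem hyU j)
    have htL : c ^ k * t ∈ L := L.mul_mem (L.zpow_mem hc.1 k) ht.1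
    -- Write `γu = wv` with `w = x^a y^b ∈ U` and `v = c^k t ∈ L`. Multiplying by `v⁻¹ w⁻¹ v`, an
    -- element of the normal subgroup `U`, leaves `v`.
    refine ⟨u * ((c ^ k * t)⁻¹ * (x ^ a * y ^ b)⁻¹ * (c ^ k * t)⁻¹⁻¹), mul_mem huU
      (U.isNormal'.conj_mem _ (inv_mem hwU) _), ?_⟩
    have : γ * (u * ((c ^ k * t)⁻¹ * (x ^ a * y ^ b)⁻¹ * (c ^ k * t)⁻¹⁻¹)) = c ^ k * t := by
      rw [← mul_assoc γ, hnf]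
      group
    rw [this]
    exact htL
  · rw [hnf, map_mul, hμT t ht, mul_one, map_mul, hw] at hγμ
    have := congrArg (fun g : SignSemidirect _ => g.right) hγμ
    simp only [SemidirectProduct.mul_right] at this
    rw [← SemidirectProduct.mul_right, e2, right_of_lift hμψ, h.right₁] at this
    exact absurd (this.trans SemidirectProduct.one_right) (by decide)

end Kernel

/-! ### Paths as triples of involutions -/

section Paths

variable {p : ℕ} [Fact p.Prime] {Γ : Type*} [Group Γ] [TopologicalSpace Γ] [IsTopologicalGroup Γ]
  {ψ : Γ →* SignSemidirect (ZMod p × ZMod p)} {s₀ s₁ s₂ : Γ}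

theorem Subgroup.mk_closure_eq_top_of_dense {S : Set Γ}
    (hS : (Subgroup.closure S).topologicalClosure = ⊤) (N : OpenNormalSubgroup Γ) :
    Subgroup.closure ((QuotientGroup.mk : Γ → Γ ⧸ (N : Subgroup Γ)) '' S) = ⊤ := by
  have : (Subgroup.closure S).map (QuotientGroup.mk' (N : Subgroup Γ)) = ⊤ := by
    refine (Subgroup.eq_top_iff' _).2 fun x => ?_
    obtain ⟨γ, rfl⟩ := QuotientGroup.mk_surjective x
    obtain ⟨u, hu, hγu⟩ := exists_mul_mem_of_dense hS γ N
    refine ⟨γ * u, hγu, ?_⟩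
    rw [QuotientGroup.mk'_apply, QuotientGroup.mk_mul, (QuotientGroup.eq_one_iff u).2 hu, mul_one]
  rwa [MonoidHom.map_closure] at this

theorem InvolutionTriple.mem_nielsenClass (hp : Odd p) (h : InvolutionTriple ψ s₀ s₁ s₂)
    (hψ : IsUniversalPFrattiniCover p ψ) (N : FiniteCover ψ)
    (hN : s₀ * s₁ * s₂ * (s₀ * s₁ * s₂) ∈ N.ker) :
    (fun i => (QuotientGroup.mk (![s₀, s₁, s₂, s₀ * s₁ * s₂] i) : N.Grp)) ∈
      NielsenClass p N.toBase (classes24 (ZMod p × ZMod p)) := by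
  have key : ∀ s : Γ, s * s ∈ N.ker → (ψ s).right = -1 →
      (orderOf (QuotientGroup.mk s : N.Grp)).Coprime p ∧
        (N.toBase (QuotientGroup.mk s : N.Grp)).right = -1 := fun s hs hr =>
    ⟨coprime_orderOf_of_mul_self hp ((QuotientGroup.eq_one_iff (s * s)).2 hs), hr⟩
  refine (mem_nielsenClass_iff hp).2 ⟨fun i => ?_, ?_, ?_⟩
  · fin_cases i
    · exact key s₀ (by rw [h.sq₀]; exact one_mem _) h.right₀
    · exact key s₁ (by rw [h.sq₁]; exact one_mem _) h.right₁
    · exact key s₂ (by rw [h.sq₂]; exact one_mem _) h.right₂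
    · refine key (s₀ * s₁ * s₂) hN ?_
      rw [map_mul, map_mul, SemidirectProduct.mul_right, SemidirectProduct.mul_right,
        h.right₀, h.right₁, h.right₂]
      rfl
  · have : Subgroup.closure ((QuotientGroup.mk : Γ → N.Grp) '' {s₀, s₁, s₂}) = ⊤ :=
      Subgroup.mk_closure_eq_top_of_dense (h.topologicalClosure hψ) N.1
    rwa [Set.image_insert_eq, Set.image_pair] at this
  · exact (QuotientGroup.eq_one_iff (s₀ * s₁ * s₂ * (s₀ * s₁ * s₂))).2 hN

/-- The path of all finite quotients of `Γ/T`, with the tuple `(s₀, s₁, s₂, s₀s₁s₂)`. -/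
def InvolutionTriple.path (hp : Odd p) (h : InvolutionTriple ψ s₀ s₁ s₂)
    (hψ : IsUniversalPFrattiniCover p ψ) {T : Subgroup Γ} (hT : T ≤ ψ.ker)
    (hs : s₀ * s₁ * s₂ * (s₀ * s₁ * s₂) ∈ T) :
    NielsenPath p ψ (classes24 (ZMod p × ZMod p)) where
  index := {N | T ≤ N.ker}
  nonempty := ⟨⟨openKer ψ (IsLocallyConstant.of_isOpen_ker hψ.isOpen_ker), le_rfl⟩, hT⟩
  directed M hM N hN := ⟨⟨M.1 ⊓ N.1, fun _ hx => M.2 hx.1⟩, fun _ hx => ⟨hM hx, hN hx⟩,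
    fun _ hx => hx.1, fun _ hx => hx.2⟩
  tuple _ _ := fun i => QuotientGroup.mk (![s₀, s₁, s₂, s₀ * s₁ * s₂] i)
  tuple_mem N hN := h.mem_nielsenClass hp hψ N (hN hs)
  compatible _ _ _ _ _ _ := rfl

theorem NielsenPath.isClosed_limitKer
    {C : Fin 4 → ConjClasses (SignSemidirect (ZMod p × ZMod p))} (P : NielsenPath p ψ C) :
    IsClosed (P.limitKer : Set Γ) := by
  rw [NielsenPath.limitKer, Subgroup.coe_iInf]
  exact isClosed_iInter fun N => N.1.1.toOpenSubgroup.isClosed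

/-- The `i`-th entries are cosets of open subgroups forming a directed family of nonempty closed
sets, so they have a common point. -/
theorem NielsenPath.exists_lift [CompactSpace Γ]
    {C : Fin 4 → ConjClasses (SignSemidirect (ZMod p × ZMod p))}
    (P : NielsenPath p ψ C) (i : Fin 4) :
    ∃ γ : Γ, ∀ N (hN : N ∈ P.index), (QuotientGroup.mk γ : N.Grp) = P.tuple N hN i := by
  have hcl : ∀ N : P.index, IsClosed {γ : Γ | (QuotientGroup.mk γ : N.1.Grp) = P.tuple N.1 N.2 i} :=
    fun N => (IsLocallyConstant.of_isOpen_ker (f := QuotientGroup.mk' N.1.ker) (by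
      rw [QuotientGroup.ker_mk']; exact N.1.1.toOpenSubgroup.isOpen)).isClosed_fiber _
  have : Nonempty P.index := P.nonempty.to_subtype
  obtain ⟨γ, hγ⟩ := IsCompact.nonempty_iInter_of_directed_nonempty_isCompact_isClosed
    (fun N : P.index => {γ : Γ | (QuotientGroup.mk γ : N.1.Grp) = P.tuple N.1 N.2 i}) (by
      intro M N
      obtain ⟨L, hL, hLM, hLN⟩ := P.directed M.1 M.2 N.1 N.2
      refine ⟨⟨L, hL⟩, fun γ hγ => ?_, fun γ hγ => ?_⟩
      · have := P.compatible L hL M.1 M.2 hLM i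
        rw [← (hγ : _ = P.tuple L hL i)] at this
        exact this
      · have := P.compatible L hL N.1 N.2 hLN i
        rw [← (hγ : _ = P.tuple L hL i)] at this
        exact this)
    (fun N => QuotientGroup.mk_surjective _) (fun N => (hcl N).isCompact) hcl
  rw [Set.mem_iInter] at hγ
  exact ⟨γ, fun N hN => hγ ⟨N, hN⟩⟩

variable [CompactSpace Γ] [TotallyDisconnectedSpace Γ] [T2Space Γ]

/-- The tuples of a path come from a triple of involutions of `Γ`. -/
theorem NielsenPath.exists_involutionTriple (hp : Odd p) (hψ : IsUniversalPFrattiniCover p ψ)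
    (P : NielsenPath p ψ (classes24 (ZMod p × ZMod p))) :
    ∃ s₀ s₁ s₂ : Γ, InvolutionTriple ψ s₀ s₁ s₂ ∧
      s₀ * s₁ * s₂ * (s₀ * s₁ * s₂) ∈ P.limitKer ∧
      ∀ N (hN : N ∈ P.index), P.tuple N hN = fun i =>
        QuotientGroup.mk (![s₀, s₁, s₂, s₀ * s₁ * s₂] i) := by
  have hmem := fun N hN => (mem_nielsenClass_iff hp).1 (P.tuple_mem N hN)
  have hsq : ∀ N (hN : N ∈ P.index) i, P.tuple N hN i * P.tuple N hN i = 1 := by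
    intro N hN i
    obtain ⟨γ, hγ⟩ := QuotientGroup.mk_surjective (P.tuple N hN i)
    have hr : (ψ γ).right = -1 := by
      have := ((hmem N hN).1 i).2
      rwa [← hγ] at this
    obtain ⟨k, hk⟩ := hψ.exists_pow_mem (γ := γ * γ)
      (by rw [MonoidHom.mem_ker, map_mul, SignSemidirect.mul_self_eq_one hr]) N.1
    refine mul_self_eq_one_of_coprime ((hmem N hN).1 i).1 (k := k) ?_
    rw [← hγ]
    exact (QuotientGroup.eq_one_iff ((γ * γ) ^ p ^ k)).2 hk
  have hlift : ∀ i, ∃ s : Γ, s * s = 1 ∧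
      ∀ N (hN : N ∈ P.index), (QuotientGroup.mk s : N.Grp) = P.tuple N hN i := by
    intro i
    obtain ⟨γ, hγ⟩ := P.exists_lift i
    have hγL : γ * γ ∈ P.limitKer := by
      refine (Subgroup.mem_iInf).2 fun N => ?_
      rw [← QuotientGroup.eq_one_iff, QuotientGroup.mk_mul, hγ N.1 N.2, hsq]
    -- The common lift `γ` is an involution only modulo `P.limitKer`. As this subgroup is closed and
    -- pro-`p`, `γ` can be corrected inside its coset.
    obtain ⟨s, hs, hs2⟩ := exists_involution hp P.isClosed_limitKer
      (fun n hn U => hψ.exists_pow_mem (P.limitKer_le_ker hn) U) hγL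
    refine ⟨s, hs2, fun N hN => ?_⟩
    rw [← hγ N hN]
    exact (QuotientGroup.eq.2 ((Subgroup.mem_iInf).1 hs ⟨N, hN⟩)).symm
  obtain ⟨s₀, h₀, e₀⟩ := hlift 0
  obtain ⟨s₁, h₁, e₁⟩ := hlift 1
  obtain ⟨s₂, h₂, e₂⟩ := hlift 2
  have e₃ : ∀ N (hN : N ∈ P.index),
      (QuotientGroup.mk (s₀ * s₁ * s₂) : N.Grp) = P.tuple N hN 3 := by
    intro N hN
    rw [QuotientGroup.mk_mul, QuotientGroup.mk_mul, e₀ N hN, e₁ N hN, e₂ N hN,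
      eq_inv_of_mul_eq_one_left (hmem N hN).2.2, inv_eq_of_mul_eq_one_left (hsq N hN 3)]
  refine ⟨s₀, s₁, s₂, ?_, ?_, ?_⟩
  · obtain ⟨N, hN⟩ := P.nonempty
    obtain ⟨hr, hgen, -⟩ := hmem N hN
    refine ⟨h₀, h₁, h₂, ?_, ?_, ?_, ?_⟩
    · have := (hr 0).2; rwa [← e₀ N hN] at this
    · have := (hr 1).2; rwa [← e₁ N hN] at this
    · have := (hr 2).2; rwa [← e₂ N hN] at this
    · have hsurj : Function.Surjective N.toBase :=
        QuotientGroup.lift_surjective_of_surjective _ ψ hψ.surjective _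
      have := congrArg (Subgroup.map N.toBase) hgen
      rwa [MonoidHom.map_closure, ← MonoidHom.range_eq_map, MonoidHom.range_eq_top.2 hsurj,
        ← e₀ N hN, ← e₁ N hN, ← e₂ N hN, Set.image_insert_eq, Set.image_pair] at this
  · refine (Subgroup.mem_iInf).2 fun N => ?_
    rw [← QuotientGroup.eq_one_iff, QuotientGroup.mk_mul, e₃ N.1 N.2, hsq]
  · intro N hN
    ext1 i
    fin_cases i
    · exact (e₀ N hN).symm
    · exact (e₁ N hN).symm
    · exact (e₂ N hN).symm
    · exact (e₃ N hN).symm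

theorem NielsenPath.ker_le_limitKer
    {e : Γ →* SignSemidirect (ℤ_[p] × ℤ_[p])} (he : Continuous e)
    (heψ : ∀ γ, SignSemidirect.map (padicSqToZMod p) (e γ) = ψ γ)
    (hp : Odd p) (hψ : IsUniversalPFrattiniCover p ψ)
    (P : NielsenPath p ψ (classes24 (ZMod p × ZMod p))) : e.ker ≤ P.limitKer := by
  obtain ⟨s₀, s₁, s₂, h, hs, -⟩ := P.exists_involutionTriple hp hψ
  exact h.ker_le hψ he heψ P.isClosed_limitKer hs

/-- Every path uses only covers whose kernel contains `e.ker`, and this path already uses all of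
them. -/
theorem InvolutionTriple.path_isMaximal
    {e : Γ →* SignSemidirect (ℤ_[p] × ℤ_[p])} (he : Continuous e)
    (heψ : ∀ γ, SignSemidirect.map (padicSqToZMod p) (e γ) = ψ γ)
    (hp : Odd p) (h : InvolutionTriple ψ s₀ s₁ s₂)
    (hψ : IsUniversalPFrattiniCover p ψ) :
    (h.path hp hψ (ker_padic_le_ker heψ) (h.mul_self_mem_ker heψ)).IsMaximal := by
  rintro Q ⟨hle, heq⟩
  have hQ : ∀ N ∈ Q.index, e.ker ≤ N.ker := fun N hN =>
    (Q.ker_le_limitKer he heψ hp hψ).trans (iInf_le (fun N : Q.index => N.1.ker) ⟨N, hN⟩)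
  exact ⟨hQ, fun N hN => (heq N (hQ N hN)).symm⟩

/-- A maximal path runs through all finite quotients of `(ℤ_p)² ⋊ {±1}`. -/
theorem NielsenPath.IsMaximal.mem_index_iff
    {e : Γ →* SignSemidirect (ℤ_[p] × ℤ_[p])} (he : Continuous e)
    (heψ : ∀ γ, SignSemidirect.map (padicSqToZMod p) (e γ) = ψ γ)
    (hp : Odd p) (hψ : IsUniversalPFrattiniCover p ψ)
    {P : NielsenPath p ψ (classes24 (ZMod p × ZMod p))} (hP : P.IsMaximal) (N : FiniteCover ψ) :
    N ∈ P.index ↔ e.ker ≤ N.ker := by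
  refine ⟨fun hN => (P.ker_le_limitKer he heψ hp hψ).trans
    (iInf_le (fun N : P.index => N.1.ker) ⟨N, hN⟩), fun hN => ?_⟩
  -- The triple underlying `P` has `(s₀s₁s₂)²` in `e.ker` as well, so it extends `P` to all covers
  -- above `e.ker` with the same tuples. Maximality of `P` returns those covers.
  obtain ⟨s₀, s₁, s₂, h, -, ht⟩ := P.exists_involutionTriple hp hψ
  refine (hP (h.path hp hψ (ker_padic_le_ker heψ) (h.mul_self_mem_ker heψ))
    ⟨fun M hM => (P.ker_le_limitKer he heψ hp hψ).trans
      (iInf_le (fun N : P.index => N.1.ker) ⟨M, hM⟩), fun M hM => ?_⟩).1 hN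
  rw [ht M hM]
  exact Relation.EqvGen.refl _

/-- The reductions modulo `p ^ (n + 1)` are among the covers of a maximal path, and their kernels
intersect in `e.ker`. -/
theorem NielsenPath.IsMaximal.limitKer_eq
    {e : Γ →* SignSemidirect (ℤ_[p] × ℤ_[p])} (he : Continuous e)
    (heψ : ∀ γ, SignSemidirect.map (padicSqToZMod p) (e γ) = ψ γ)
    (hp : Odd p) (hψ : IsUniversalPFrattiniCover p ψ)
    {P : NielsenPath p ψ (classes24 (ZMod p × ZMod p))} (hP : P.IsMaximal) :
    P.limitKer = e.ker := by
  refine le_antisymm (fun γ hγ => ?_) (P.ker_le_limitKer he heψ hp hψ)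
  refine eq_of_forall_padicRed_eq fun n => ?_
  rw [map_one]
  let μ := (padicRed p (n + 1)).comp e
  have hμ : IsLocallyConstant μ := (isLocallyConstant_padicRed (n + 1)).comp_continuous he
  have hle : μ.ker ≤ ψ.ker := fun γ hγ => by
    have h1 : padicRed p (n + 1) (e γ) = 1 := hγ
    rw [MonoidHom.mem_ker, ← heψ, ← zmodRed_padicRed_eq_map n, h1, map_one]
  have hmem : (⟨openKer μ hμ, hle⟩ : FiniteCover ψ) ∈ P.index := by
    refine (hP.mem_index_iff he heψ hp hψ _).2 fun γ hγ => ?_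
    change padicRed p (n + 1) (e γ) = 1
    rw [(hγ : e γ = 1), map_one]
  exact (Subgroup.mem_iInf).1 hγ ⟨_, hmem⟩

theorem NielsenPath.IsMaximal.exists_continuousMulEquiv
    {e : Γ →* SignSemidirect (ℤ_[p] × ℤ_[p])} (he : Continuous e)
    (heψ : ∀ γ, SignSemidirect.map (padicSqToZMod p) (e γ) = ψ γ)
    (hp : Odd p)
    (hψ : IsUniversalPFrattiniCover p ψ) (hes : Function.Surjective e)
    {P : NielsenPath p ψ (classes24 (ZMod p × ZMod p))} (hP : P.IsMaximal) :
    ∃ f : P.limitGroup ≃ₜ* SignSemidirect (ℤ_[p] × ℤ_[p]),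
      ∀ γ : Γ, SignSemidirect.map (padicSqToZMod p) (f (QuotientGroup.mk γ)) = ψ γ := by
  have hker := hP.limitKer_eq he heψ hp hψ
  let f : P.limitGroup →* SignSemidirect (ℤ_[p] × ℤ_[p]) := QuotientGroup.lift P.limitKer e hker.le
  have hf : Continuous f := continuous_quot_lift _ he
  have hbij : Function.Bijective f := by
    refine ⟨?_, QuotientGroup.lift_surjective_of_surjective _ e hes _⟩
    rw [injective_iff_map_eq_one]
    intro x hx
    obtain ⟨γ, rfl⟩ := QuotientGroup.mk_surjective x
    exact (QuotientGroup.eq_one_iff γ).2 (hker.ge hx)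
  let E := MulEquiv.ofBijective f hbij
  let H := Continuous.homeoOfEquivCompactToT2 (f := E.toEquiv) hf
  exact ⟨{ E with
    continuous_toFun := H.continuous_toFun
    continuous_invFun := H.continuous_invFun }, heψ⟩

/-- For `k ≥ 1` the group `G_k` dominates `G₁`, hence the Heisenberg extension, and its Nielsen
class is empty. -/
theorem NielsenPath.throughLevel_iff (hp : Odd p) (hψ : IsUniversalPFrattiniCover p ψ)
    {χ : Γ →* HeisenbergSign (ZMod p)} (hχ : (HeisenbergSign.proj (ZMod p)).comp χ = ψ)
    (hχ1 : levelKer p ψ 1 ≤ χ.ker) {e : Γ →* SignSemidirect (ℤ_[p] × ℤ_[p])} (he : Continuous e)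
    (heψ : ∀ γ, SignSemidirect.map (padicSqToZMod p) (e γ) = ψ γ)
    {P : NielsenPath p ψ (classes24 (ZMod p × ZMod p))} (hP : P.IsMaximal) (k : ℕ) :
    P.ThroughLevel k ↔ k = 0 := by
  constructor
  · rintro ⟨N, hN, hNk⟩
    by_contra hk
    obtain ⟨k, rfl⟩ := Nat.exists_eq_succ_of_ne_zero hk
    have hle : levelKer p ψ (k + 1) ≤ levelKer p ψ 1 := by
      clear hN hNk
      induction k with
      | zero => exact le_rfl
      | succ k ih => exact (Subgroup.map_subtype_le _).trans (ih k.succ_ne_zero)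
    have := nielsenClass_eq_empty hp hχ hψ.surjective N.2 (hNk.le.trans (hle.trans hχ1))
    exact Set.eq_empty_iff_forall_notMem.1 this _ (P.tuple_mem N hN)
  · rintro rfl
    refine ⟨⟨openKer ψ (IsLocallyConstant.of_isOpen_ker hψ.isOpen_ker), le_rfl⟩, ?_, rfl⟩
    exact (hP.mem_index_iff he heψ hp hψ _).2 (ker_padic_le_ker heψ)

end Paths

/-! ### The Jacobson radical of a group algebra in characteristic `p` -/

section GroupAlgebra

variable {p : ℕ} [Fact p.Prime] {G : Type*} [Group G]

instance MonoidAlgebra.finite_of_finite [Finite G] : Finite (MonoidAlgebra (ZMod p) G) :=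
  Module.finite_of_finite (ZMod p)

theorem Representation.isSimpleModule_of_self (σ : Representation (ZMod p) G (ZMod p)) :
    IsSimpleModule (MonoidAlgebra (ZMod p) G) σ.asModule := by
  rw [isSimpleModule_iff_toSpanSingleton_surjective]
  refine ⟨inferInstanceAs (Nontrivial (ZMod p)), fun m hm n => ?_⟩
  have hm' : σ.asModuleEquiv m ≠ 0 := fun h => hm (σ.asModuleEquiv.injective (h.trans (map_zero _).symm))
  refine ⟨MonoidAlgebra.single 1 (σ.asModuleEquiv n / σ.asModuleEquiv m), ?_⟩
  rw [LinearMap.toSpanSingleton_apply]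
  apply σ.asModuleEquiv.injective
  rw [Representation.asModuleEquiv_map_smul, Representation.asAlgebraHom_single, map_one]
  change (σ.asModuleEquiv n / σ.asModuleEquiv m) * σ.asModuleEquiv m = _
  rw [div_mul_cancel₀ _ hm']

theorem jacobson_smul_top_le_ker {R M N : Type*} [Ring R] [AddCommGroup M] [Module R M]
    [AddCommGroup N] [Module R N] [IsSimpleModule R N] (f : M →ₗ[R] N) :
    Ring.jacobson R • (⊤ : Submodule R M) ≤ LinearMap.ker f := by
  refine (Ring.jacobson_smul_top_le R M).trans fun m hm => ?_
  have := Module.le_comap_jacobson f hm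
  rwa [IsSimpleModule.jacobson_eq_bot] at this

/-- The augmentation ideal of a normal `p`-subgroup lies in the radical. -/
theorem of_sub_one_mem_jacobson [Finite G] {V : Subgroup G} [V.Normal] (hV : IsPGroup p V) {v : G}
    (hv : v ∈ V) :
    MonoidAlgebra.of (ZMod p) G v - 1 ∈ Ring.jacobson (MonoidAlgebra (ZMod p) G) := by
  rw [Ring.jacobson_eq_sInf_isMaximal, Submodule.mem_sInf]
  intro I hI
  let S := MonoidAlgebra (ZMod p) G ⧸ I
  have hS : IsSimpleModule (MonoidAlgebra (ZMod p) G) S :=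
    isSimpleModule_iff_isCoatom.2 (Ideal.isMaximal_def.1 hI)
  have : Nontrivial S := hS.nontrivial
  have : Finite S := Finite.of_surjective _ (Submodule.Quotient.mk_surjective I)
  let : MulAction V S := MulAction.compHom S ((MonoidAlgebra.of (ZMod p) G).comp V.subtype)
  have hact : ∀ (v : V) (s : S), v • s = MonoidAlgebra.of (ZMod p) G v • s := fun _ _ => rfl
  have hp0 : (p : MonoidAlgebra (ZMod p) G) = 0 := by
    rw [← map_natCast (algebraMap (ZMod p) (MonoidAlgebra (ZMod p) G)), CharP.cast_eq_zero,
      map_zero]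
  have hcard : p ∣ Nat.card S := by
    obtain ⟨s, hs⟩ := exists_ne (0 : S)
    have hps : p • s = 0 := by
      rw [← Nat.cast_smul_eq_nsmul (MonoidAlgebra (ZMod p) G), hp0, zero_smul]
    rw [← addOrderOf_eq_prime hps hs]
    exact addOrderOf_dvd_natCard s
  -- Counting orbits of the `p`-group `V` on a simple quotient `S` of order divisible by `p` gives a
  -- nonzero fixed vector. Normality of `V` makes the fixed vectors a submodule, which is then all
  -- of `S`.
  obtain ⟨b, hb, hb0⟩ := hV.exists_fixed_point_of_prime_dvd_card_of_fixed_point S hcard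
    (a := (0 : S)) (fun v => by rw [hact, smul_zero])
  let N : Submodule (MonoidAlgebra (ZMod p) G) S :=
    { carrier := {s | ∀ v : V, MonoidAlgebra.of (ZMod p) G v • s = s}
      zero_mem' := fun v => smul_zero _
      add_mem' := fun {s t} hs ht v => by rw [smul_add, hs v, ht v]
      smul_mem' := fun r s hs v => by
        induction r using MonoidAlgebra.induction_linear with
        | zero => rw [zero_smul, smul_zero]
        | add x y hx hy => rw [add_smul, smul_add, hx, hy]
        | single g a =>
          have hconj : g⁻¹ * v * g ∈ V := by
            simpa using (inferInstance : V.Normal).conj_mem v v.2 g⁻¹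
          have h := hs ⟨g⁻¹ * v * g, hconj⟩
          conv_rhs => rw [← h]
          rw [smul_smul, smul_smul, MonoidAlgebra.of_apply, MonoidAlgebra.of_apply,
            MonoidAlgebra.single_mul_single, MonoidAlgebra.single_mul_single, one_mul, mul_one]
          simp [mul_assoc] }
  have hN : N = ⊤ := by
    refine (eq_bot_or_eq_top N).resolve_left fun h => hb0 ?_
    have : b ∈ N := hb
    rw [h, Submodule.mem_bot] at this
    exact this.symm
  have h1 : (Submodule.Quotient.mk 1 : S) ∈ N := hN ▸ Submodule.mem_top
  have h2 : (Submodule.Quotient.mk (MonoidAlgebra.of (ZMod p) G v) : S) =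
      Submodule.Quotient.mk 1 := by
    have := h1 ⟨v, hv⟩
    rwa [← Submodule.Quotient.mk_smul, smul_eq_mul, mul_one] at this
  exact (Submodule.Quotient.eq I).1 h2

end GroupAlgebra

/-! ### Homomorphisms from the `p`-Frattini module -/

section FrattiniModule

variable {p : ℕ}

theorem proPFrattini_le_ker {P : Type*} [Group P] [TopologicalSpace P] [IsTopologicalGroup P]
    {f : P →* Multiplicative (ZMod p)} (hf : IsClosed (f.ker : Set P)) :
    proPFrattini p P ≤ f.ker := by
  refine Subgroup.topologicalClosure_minimal _ ((Subgroup.closure_le _).2 ?_) hf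
  rintro x (⟨y, rfl⟩ | ⟨a, b, rfl⟩)
  · change f (y ^ p) = 1
    rw [map_pow]
    apply Multiplicative.toAdd.injective
    rw [toAdd_pow, toAdd_one, nsmul_eq_mul, CharP.cast_eq_zero, zero_mul]
  · change f (a * b * a⁻¹ * b⁻¹) = 1
    simp only [map_mul, map_inv]
    rw [mul_comm (f a), mul_inv_cancel_right, mul_inv_cancel]

variable {Γ : Type*} [Group Γ] [TopologicalSpace Γ] [IsTopologicalGroup Γ]
  {G : Type*} [Group G] {ψ : Γ →* G} (hψ : Function.Surjective ψ)

/-- The class in `M₀` of an element of `ker ψ`. -/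
noncomputable def frattiniClass (r : ψ.ker) : (pFrattiniRep p ψ hψ).asModule :=
  (pFrattiniRep p ψ hψ).asModuleEquiv.symm (Additive.ofMul (QuotientGroup.mk r))

theorem frattiniClass_mul (r s : ψ.ker) :
    frattiniClass (p := p) hψ (r * s) = frattiniClass hψ r + frattiniClass hψ s := rfl

theorem frattiniClass_inv (r : ψ.ker) :
    frattiniClass (p := p) hψ r⁻¹ = -frattiniClass hψ r := rfl

theorem frattiniClass_surjective : Function.Surjective (frattiniClass (p := p) hψ) := by
  intro m
  obtain ⟨x, hx⟩ := QuotientGroup.mk_surjective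
    (Additive.toMul ((pFrattiniRep p ψ hψ).asModuleEquiv m))
  refine ⟨x, ?_⟩
  rw [frattiniClass, LinearEquiv.symm_apply_eq, hx]
  rfl

theorem frattiniClass_pow (r : ψ.ker) : frattiniClass (p := p) hψ (r ^ p) = 0 := by
  have h : (QuotientGroup.mk (r ^ p) : ψ.ker ⧸ proPFrattini p ψ.ker) = 1 :=
    (QuotientGroup.eq_one_iff _).2 (pow_mem_proPFrattini p ψ.ker r)
  rw [frattiniClass, h, ofMul_one, map_zero]

theorem frattiniClass_conj (γ : Γ) (r : ψ.ker) :
    frattiniClass (p := p) hψ (MulAut.conjNormal γ r) =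
      MonoidAlgebra.of (ZMod p) G (ψ γ) • frattiniClass hψ r := by
  rw [frattiniClass, frattiniClass, ← Representation.asModuleEquiv_symm_map_rho,
    pFrattiniRep_apply, pFrattiniConj_mk]

theorem mem_extensionKer_iff {W : Submodule (MonoidAlgebra (ZMod p) G)
    (pFrattiniRep p ψ hψ).asModule} {γ : Γ} :
    γ ∈ extensionKer p ψ hψ W ↔ ∃ h : γ ∈ ψ.ker, frattiniClass hψ ⟨γ, h⟩ ∈ W := Iff.rfl

theorem extensionKer_normal (W : Submodule (MonoidAlgebra (ZMod p) G)
    (pFrattiniRep p ψ hψ).asModule) : (extensionKer p ψ hψ W).Normal := by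
  refine ⟨fun r hr γ => ?_⟩
  obtain ⟨h, hW⟩ := hr
  refine ⟨(inferInstance : ψ.ker.Normal).conj_mem r h γ, ?_⟩
  have := frattiniClass_conj (p := p) hψ γ ⟨r, h⟩
  change frattiniClass hψ (MulAut.conjNormal γ ⟨r, h⟩) ∈ W
  rw [this]
  exact W.smul_mem _ hW

theorem pow_mem_extensionKer (W : Submodule (MonoidAlgebra (ZMod p) G)
    (pFrattiniRep p ψ hψ).asModule) {r : Γ} (hr : r ∈ ψ.ker) : r ^ p ∈ extensionKer p ψ hψ W := by
  refine ⟨ψ.ker.pow_mem hr p, ?_⟩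
  have h : frattiniClass (p := p) hψ (⟨r, hr⟩ ^ p) ∈ W := by
    rw [frattiniClass_pow]
    exact W.zero_mem
  exact h

/-- In additive notation the commutator is `(ψ u - 1)` applied to the class of `r`, and `ψ u - 1`
lies in the radical. -/
theorem commutator_mem_extensionKer_jacobson [Fact p.Prime] [Finite G] {V : Subgroup G} [V.Normal]
    (hV : IsPGroup p V) {u r : Γ} (hu : ψ u ∈ V) (hr : r ∈ ψ.ker) :
    u * r * u⁻¹ * r⁻¹ ∈
      extensionKer p ψ hψ (Ring.jacobson (MonoidAlgebra (ZMod p) G) • ⊤) := by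
  refine ⟨ψ.ker.mul_mem ((inferInstance : ψ.ker.Normal).conj_mem r hr u) (ψ.ker.inv_mem hr), ?_⟩
  have h : (MonoidAlgebra.of (ZMod p) G (ψ u) - 1) • frattiniClass (p := p) hψ ⟨r, hr⟩ ∈
      Ring.jacobson (MonoidAlgebra (ZMod p) G) •
        (⊤ : Submodule (MonoidAlgebra (ZMod p) G) (pFrattiniRep p ψ hψ).asModule) :=
    Submodule.smul_mem_smul (of_sub_one_mem_jacobson hV hu) trivial
  rw [sub_smul, one_smul, ← frattiniClass_conj, sub_eq_add_neg, ← frattiniClass_inv,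
    ← frattiniClass_mul] at h
  exact h

/-- Closedness of the kernel is what lets `f` factor through the quotient by the closed subgroup
`Φ(ker ψ)`. -/
theorem exists_linearMap_of_equivariant (σ : Representation (ZMod p) G (ZMod p))
    {f : ψ.ker →* Multiplicative (ZMod p)} (hf : IsClosed (f.ker : Set ψ.ker))
    (hσ : ∀ γ r, (f (MulAut.conjNormal γ r)).toAdd = σ (ψ γ) (f r).toAdd) :
    ∃ F : (pFrattiniRep p ψ hψ).asModule →ₗ[MonoidAlgebra (ZMod p) G] σ.asModule,
      ∀ r, F (frattiniClass hψ r) = σ.asModuleEquiv.symm (f r).toAdd := by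
  let F₀ : PFrattiniModule p ψ →+ ZMod p :=
    MonoidHom.toAdditiveLeft (QuotientGroup.lift (proPFrattini p ψ.ker) f (proPFrattini_le_ker hf))
  let F₁ : PFrattiniModule p ψ →ₗ[ZMod p] ZMod p := AddMonoidHom.toZModLinearMap p F₀
  have h : ∀ g v, F₁ (pFrattiniRep p ψ hψ g v) = σ g (F₁ v) := by
    intro g v
    obtain ⟨γ, rfl⟩ := hψ g
    rw [pFrattiniRep_apply]
    exact pFrattiniModule_ind p ψ
      (q := fun v => F₁ (pFrattiniConj p ψ γ v) = σ (ψ γ) (F₁ v)) (fun a => hσ γ a) v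
  exact ⟨Representation.IntertwiningMap.equivLinearMapAsModule _ σ
    (LinearMap.intertwiningMap_of_isIntertwiningMap (pFrattiniRep p ψ hψ) σ F₁ h), fun r => rfl⟩

theorem continuous_asAlgebraHom (a : MonoidAlgebra (ZMod p) G) :
    Continuous ((pFrattiniRep p ψ hψ).asAlgebraHom a : PFrattiniModule p ψ → PFrattiniModule p ψ) := by
  induction a using MonoidAlgebra.induction_linear with
  | zero => rw [map_zero]; exact continuous_const
  | add x y hx hy => rw [map_add]; exact hx.add hy
  | single g a =>
    obtain ⟨γ, rfl⟩ := hψ g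
    rw [Representation.asAlgebraHom_single, pFrattiniRep_apply]
    have hc : Continuous (pFrattiniConj p ψ γ) :=
      continuous_quot_lift _ (QuotientGroup.continuous_mk.comp (continuous_conjNormal ψ.ker γ))
    obtain ⟨n, rfl⟩ := ZMod.intCast_surjective a
    have : ⇑((n : ZMod p) • pFrattiniConj p ψ γ) = fun v => n • pFrattiniConj p ψ γ v := by
      ext1 v
      rw [LinearMap.smul_apply, Int.cast_smul_eq_zsmul]
    rw [this]
    exact hc.zsmul n

/-- The submodule `J M₀` is closed. -/
theorem isClosed_extensionKer_jacobson [Fact p.Prime] [CompactSpace Γ] [Finite G]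
    (hker : IsClosed (ψ.ker : Set Γ)) :
    IsClosed (extensionKer p ψ hψ (Ring.jacobson (MonoidAlgebra (ZMod p) G) • ⊤) : Set Γ) := by
  let J := Ring.jacobson (MonoidAlgebra (ZMod p) G)
  let ρ := pFrattiniRep p ψ hψ
  let : Fintype J := Fintype.ofFinite J
  have : CompactSpace ψ.ker := isCompact_iff_compactSpace.1 hker.isCompact
  have : IsClosed (proPFrattini p ψ.ker : Set ψ.ker) := Subgroup.isClosed_topologicalClosure _
  have : T2Space (PFrattiniModule p ψ) := inferInstanceAs (T2Space (ψ.ker ⧸ proPFrattini p ψ.ker))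
  -- The radical is finite, so `J M₀` is the image of the compact space `M₀^J` under one continuous
  -- map.
  let F : (J → PFrattiniModule p ψ) → PFrattiniModule p ψ :=
    fun f => ∑ j : J, ρ.asAlgebraHom (j : MonoidAlgebra (ZMod p) G) (f j)
  have hF : Continuous F := continuous_finsetSum _ fun j _ =>
    (continuous_asAlgebraHom hψ (j : MonoidAlgebra (ZMod p) G)).comp (continuous_apply j)
  have hrange : ∀ m : ρ.asModule, m ∈ (J • ⊤ : Submodule (MonoidAlgebra (ZMod p) G) ρ.asModule) ↔
      ρ.asModuleEquiv m ∈ Set.range F := by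
    intro m
    constructor
    · intro hm
      refine Submodule.smul_induction_on hm ?_ ?_
      · intro j hj m _
        classical
        refine ⟨Pi.single ⟨j, hj⟩ (ρ.asModuleEquiv m), ?_⟩
        rw [Representation.asModuleEquiv_map_smul]
        change ∑ i : J, _ = _
        rw [Finset.sum_eq_single (⟨j, hj⟩ : J)]
        · rw [Pi.single_eq_same]
        · intro i _ hi
          rw [Pi.single_eq_of_ne hi, map_zero]
        · simp
      · rintro x y ⟨f, hf⟩ ⟨g, hg⟩
        refine ⟨f + g, ?_⟩
        rw [map_add, ← hf, ← hg]
        change ∑ i : J, _ = ∑ i : J, _ + ∑ i : J, _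
        rw [← Finset.sum_add_distrib]
        exact Finset.sum_congr rfl fun i _ => map_add _ _ _
    · rintro ⟨f, hf⟩
      have : m = ∑ j : J, (j : MonoidAlgebra (ZMod p) G) • ρ.asModuleEquiv.symm (f j) := by
        apply ρ.asModuleEquiv.injective
        rw [← hf, map_sum]
        refine Finset.sum_congr rfl fun j _ => ?_
        rw [Representation.asModuleEquiv_map_smul, LinearEquiv.apply_symm_apply]
      rw [this]
      exact Submodule.sum_mem _ fun j _ => Submodule.smul_mem_smul j.2 trivial
  have hcl : IsClosed {r : ψ.ker | Additive.ofMul (QuotientGroup.mk r : ψ.ker ⧸ proPFrattini p ψ.ker)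
      ∈ Set.range F} :=
    (isCompact_range hF).isClosed.preimage (continuous_ofMul.comp QuotientGroup.continuous_mk)
  have himage : (extensionKer p ψ hψ (J • ⊤) : Set Γ) = Subtype.val '' {r : ψ.ker |
      Additive.ofMul (QuotientGroup.mk r : ψ.ker ⧸ proPFrattini p ψ.ker) ∈ Set.range F} := by
    ext γ
    constructor
    · rintro ⟨h, hW⟩
      exact ⟨⟨γ, h⟩, (hrange _).1 hW, rfl⟩
    · rintro ⟨⟨γ, h⟩, hW, rfl⟩
      exact ⟨h, (hrange _).2 hW⟩
  rw [himage]
  exact hker.isClosedEmbedding_subtypeVal.isClosedMap _ hcl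

end FrattiniModule

/-! ### The head of the `p`-Frattini module of `(ℤ/p)² ⋊ {±1}` -/

theorem SignSemidirect.conj_left_toAdd {A : Type*} [AddCommGroup A] (g : SignSemidirect A)
    {h : SignSemidirect A} (hh : h.right = 1) :
    (g * h * g⁻¹).left.toAdd = (g.right : ℤ) • h.left.toAdd := by
  have e : (g * h * g⁻¹ * g).left.toAdd = (g * h).left.toAdd := by rw [inv_mul_cancel_right]
  have hr : (g * h * g⁻¹).right = 1 := by
    rw [SemidirectProduct.mul_right, SemidirectProduct.mul_right, hh, mul_one,
      SemidirectProduct.inv_right, mul_inv_cancel]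
  rw [left_mul_of_right_eq_one hr, mul_left_toAdd, add_comm] at e
  exact add_left_cancel e

theorem HeisenbergSign.conj_eq_of_mem_ker_proj {R : Type*} [CommRing R] (g : HeisenbergSign R)
    {h : HeisenbergSign R} (hh : h ∈ (HeisenbergSign.proj R).ker) : g * h * g⁻¹ = h := by
  rw [mem_ker_proj_iff] at hh
  rw [mul_inv_eq_iff_eq_mul, hh]
  refine SemidirectProduct.ext ?_ ?_
  · rw [SemidirectProduct.mul_left, SemidirectProduct.mul_left, SemidirectProduct.left_inl,
      SemidirectProduct.right_inl, map_one]
    ext <;> simp [Heisenberg.signAut, add_comm]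
  · simp

section Padic

variable {p : ℕ} [Fact p.Prime]

theorem PadicInt.toZMod_eq_zero_iff {z : ℤ_[p]} : PadicInt.toZMod z = 0 ↔ ∃ w, z = p * w := by
  rw [← RingHom.mem_ker, PadicInt.ker_toZMod, PadicInt.maximalIdeal_eq_span_p,
    Ideal.mem_span_singleton]
  rfl

theorem PadicInt.toZModPow_two_eq_zero_iff {w : ℤ_[p]} :
    PadicInt.toZModPow 2 ((p : ℤ_[p]) * w) = 0 ↔ PadicInt.toZMod w = 0 := by
  have hp0 : (p : ℤ_[p]) ≠ 0 := by exact_mod_cast (Fact.out : p.Prime).ne_zero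
  rw [← RingHom.mem_ker, PadicInt.ker_toZModPow, Ideal.mem_span_singleton, pow_two,
    mul_dvd_mul_iff_left hp0, toZMod_eq_zero_iff]
  rfl

/-- Division by `p` followed by reduction, for a homomorphism with values in `pℤ_p`. -/
theorem exists_hom_div_p {K : Type*} [Group K] (τ : K →* Multiplicative ℤ_[p])
    (hτ : ∀ r, PadicInt.toZMod (τ r).toAdd = 0) :
    ∃ α : K →* Multiplicative (ZMod p),
      ∀ r w, (τ r).toAdd = p * w → (α r).toAdd = PadicInt.toZMod w := by
  have hp0 : (p : ℤ_[p]) ≠ 0 := by exact_mod_cast (Fact.out : p.Prime).ne_zero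
  choose w hw using fun r => PadicInt.toZMod_eq_zero_iff.1 (hτ r)
  have huniq : ∀ r v, (τ r).toAdd = p * v → w r = v := fun r v h =>
    mul_left_cancel₀ hp0 ((hw r).symm.trans h)
  refine ⟨MonoidHom.mk' (fun r => Multiplicative.ofAdd (PadicInt.toZMod (w r))) fun r s => ?_,
    fun r v h => congrArg PadicInt.toZMod (huniq r v h)⟩
  rw [huniq (r * s) (w r + w s) (by rw [map_mul, toAdd_mul, hw, hw, mul_add]), map_add, ofAdd_add]

end Padic

section Head

variable {p : ℕ} [Fact p.Prime] {Γ : Type*} [Group Γ] [TopologicalSpace Γ]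
  {ψ : Γ →* SignSemidirect (ZMod p × ZMod p)}

/-- The central coordinate in the Heisenberg extension. -/
theorem exists_heisenbergCoord {χ : Γ →* HeisenbergSign (ZMod p)} (hlc : IsLocallyConstant χ)
    (hχ : (HeisenbergSign.proj (ZMod p)).comp χ = ψ) :
    ∃ ζ : ψ.ker →* Multiplicative (ZMod p), IsClosed (ζ.ker : Set ψ.ker) ∧
      (∀ r : ψ.ker, χ r = SemidirectProduct.inl ⟨0, 0, (ζ r).toAdd⟩) ∧
      ∀ γ r, ζ (MulAut.conjNormal γ r) = ζ r := by
  have hker : ∀ r : ψ.ker, χ r ∈ (HeisenbergSign.proj (ZMod p)).ker := fun r =>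
    (DFunLike.congr_fun hχ (r : Γ)).trans r.2
  have hz : ∀ r : ψ.ker, χ r = SemidirectProduct.inl ⟨0, 0, (χ r).left.z⟩ := fun r =>
    HeisenbergSign.mem_ker_proj_iff.1 (hker r)
  refine ⟨MonoidHom.mk' (fun r => Multiplicative.ofAdd (χ r).left.z) fun r s => ?_, ?_, hz, ?_⟩
  · rw [Subgroup.coe_mul, map_mul, hz r, hz s, ← map_mul]
    simp [← ofAdd_add]
  · exact (hlc.comp_continuous continuous_subtype_val).isClosed_preimage
      {h | Multiplicative.ofAdd h.left.z = 1}
  · intro γ r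
    change Multiplicative.ofAdd (χ (γ * r * γ⁻¹)).left.z = Multiplicative.ofAdd (χ r).left.z
    rw [map_mul, map_mul, map_inv, HeisenbergSign.conj_eq_of_mem_ker_proj _ (hker r)]

variable [IsTopologicalGroup Γ]

theorem levelKer_one_le_ker {χ : Γ →* HeisenbergSign (ZMod p)} (hlc : IsLocallyConstant χ)
    (hχ : (HeisenbergSign.proj (ZMod p)).comp χ = ψ) : levelKer p ψ 1 ≤ χ.ker := by
  obtain ⟨ζ, hcl, hz, -⟩ := exists_heisenbergCoord hlc hχ
  rintro _ ⟨r, hr, rfl⟩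
  have : ζ r = 1 := proPFrattini_le_ker hcl hr
  refine (hz r).trans ?_
  rw [this]
  rfl

/-- A coordinate of `ker ψ → p(ℤ_p)²`, divided by `p`. -/
theorem exists_linearMap_signRep (hψ : Function.Surjective ψ)
    {e : Γ →* SignSemidirect (ℤ_[p] × ℤ_[p])} (he : Continuous e)
    (heψ : ∀ γ, SignSemidirect.map (padicSqToZMod p) (e γ) = ψ γ)
    (l : ℤ_[p] × ℤ_[p] →+ ℤ_[p]) (hl : Continuous l)
    (hl0 : ∀ r : ψ.ker, PadicInt.toZMod (l (e r).left.toAdd) = 0) :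
    ∃ F : (pFrattiniRep p ψ hψ).asModule →ₗ[MonoidAlgebra (ZMod p)
        (SignSemidirect (ZMod p × ZMod p))] (signRep (ZMod p) (ZMod p × ZMod p)).asModule,
      ∀ (r : ψ.ker) w, l (e r).left.toAdd = p * w → F (frattiniClass hψ r) =
        (signRep (ZMod p) (ZMod p × ZMod p)).asModuleEquiv.symm (PadicInt.toZMod w) := by
  have hr : ∀ r : ψ.ker, (e r).right = 1 := fun r => by
    rw [right_padic heψ, (r.2 : ψ r = 1)]; rfl
  obtain ⟨α, hα⟩ := exists_hom_div_p (MonoidHom.mk'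
    (fun r : ψ.ker => Multiplicative.ofAdd (l (e r).left.toAdd)) fun r s => by
      rw [Subgroup.coe_mul, map_mul, SignSemidirect.left_mul_of_right_eq_one (hr r), map_add,
        ofAdd_add]) hl0
  have hα' : ∀ (r : ψ.ker) w, l (e r).left.toAdd = p * w → (α r).toAdd = PadicInt.toZMod w := hα
  -- Division by `p` followed by reduction vanishes exactly when the original value is zero modulo
  -- `p²`, which is a locally constant condition.
  have hset : (α.ker : Set ψ.ker) =
      (fun r : ψ.ker => PadicInt.toZModPow 2 (l (e r).left.toAdd)) ⁻¹' {0} := by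
    ext r
    obtain ⟨w, hw⟩ := PadicInt.toZMod_eq_zero_iff.1 (hl0 r)
    change α r = 1 ↔ PadicInt.toZModPow 2 (l (e r).left.toAdd) = 0
    rw [hw, PadicInt.toZModPow_two_eq_zero_iff, ← hα' r w hw]
    rfl
  have hcl : IsClosed (α.ker : Set ψ.ker) := by
    rw [hset]
    exact ((isLocallyConstant_toZModPow p 2).comp_continuous (hl.comp (continuous_fst.comp
      (continuous_signSemidirect_coord.comp (he.comp continuous_subtype_val))))).isClosed_preimage _
  obtain ⟨F, hF⟩ := exists_linearMap_of_equivariant hψ (signRep (ZMod p) (ZMod p × ZMod p)) hcl (by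
    intro γ r
    obtain ⟨w, hw⟩ := PadicInt.toZMod_eq_zero_iff.1 (hl0 r)
    rw [hα' r w hw, hα' (MulAut.conjNormal γ r) (((ψ γ).right : ℤ) • w) (by
      rw [MulAut.conjNormal_apply, map_mul, map_mul, map_inv,
        SignSemidirect.conj_left_toAdd _ (hr r), map_zsmul, hw, right_padic heψ, mul_smul_comm])]
    change _ = (((ψ γ).right : ℤ) : ZMod p) • PadicInt.toZMod w
    rw [map_zsmul, Int.cast_smul_eq_zsmul])
  exact ⟨F, fun r w h => (hF r).trans (congrArg _ (hα' r w h))⟩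

/-- A closed normal subgroup that is large enough contains the kernel of the homomorphism to
`((ℤ/p²)² ⋊ {±1}) × (ℍ ⋊ {±1})`. -/
theorem InvolutionTriple.mem_of_padicRed_eq_one [CompactSpace Γ] [TotallyDisconnectedSpace Γ]
    {s₀ s₁ s₂ : Γ} (h : InvolutionTriple ψ s₀ s₁ s₂) (hψ : IsUniversalPFrattiniCover p ψ)
    {e : Γ →* SignSemidirect (ℤ_[p] × ℤ_[p])} (he : Continuous e)
    (heψ : ∀ γ, SignSemidirect.map (padicSqToZMod p) (e γ) = ψ γ)
    {χ : Γ →* HeisenbergSign (ZMod p)} (hlc : IsLocallyConstant χ)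
    (hχ : (HeisenbergSign.proj (ZMod p)).comp χ = ψ)
    {T : Subgroup Γ} [T.Normal] (hT : IsClosed (T : Set Γ))
    (hTe : ∀ t ∈ T, padicRed p 2 (e t) = 1) (hTχ : T ≤ χ.ker)
    (hTp : ∀ r ∈ ψ.ker, r ^ p ∈ T)
    (hTc : ∀ u r, (ψ u).right = 1 → r ∈ ψ.ker → u * r * u⁻¹ * r⁻¹ ∈ T)
    {r : Γ} (hre : padicRed p 2 (e r) = 1) (hrχ : χ r = 1) : r ∈ T := by
  let μ := (padicRed p 2).comp e
  have hμ : IsLocallyConstant μ := (isLocallyConstant_padicRed 2).comp_continuous he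
  have hμψ : (zmodRed (dvd_pow_self p (Nat.succ_ne_zero 1))).comp μ = ψ := by
    ext1 γ
    rw [← heψ]
    exact zmodRed_padicRed_eq_map 1 (e γ)
  have hxr := h.right_mul₀₁
  have hyr := h.right_mul₁₂
  have hdetμ := h.isUnit_det₂_of_lift hμψ
  have hdet := h.isUnit_det₂
  have hxp := pow_mem_ker_of_right_eq_one hxr
  have hyp := pow_mem_ker_of_right_eq_one hyr
  have hxχ : (χ (s₀ * s₁)).right = 1 := by rw [← hxr, ← hχ]; rfl
  have hyχ : (χ (s₁ * s₂)).right = 1 := by rw [← hyr, ← hχ]; rfl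
  have hxμ : (μ (s₀ * s₁)).right = 1 := (right_of_lift hμψ _).trans hxr
  have hyμ : (μ (s₁ * s₂)).right = 1 := (right_of_lift hμψ _).trans hyr
  obtain ⟨x, hx⟩ : ∃ x, x = s₀ * s₁ := ⟨_, rfl⟩
  obtain ⟨y, hy⟩ : ∃ y, y = s₁ * s₂ := ⟨_, rfl⟩
  obtain ⟨c, hc⟩ : ∃ c, c = x * y * x⁻¹ * y⁻¹ := ⟨_, rfl⟩
  rw [← hx] at hxr hxp hdet hdetμ hxχ hxμ
  rw [← hy] at hyr hyp hdet hdetμ hyχ hyμ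
  have hcψ : c ∈ ψ.ker := by
    rw [MonoidHom.mem_ker, hc]
    simp only [map_mul, map_inv]
    rw [SignSemidirect.mul_comm_of_right_eq_one hxr hyr]
    group
  have hcμ : μ c = 1 := by
    rw [hc]
    simp only [map_mul, map_inv]
    rw [SignSemidirect.mul_comm_of_right_eq_one hxμ hyμ]
    group
  have hcχ : χ c = SemidirectProduct.inl ⟨0, 0, det₂ (ψ x).left.toAdd (ψ y).left.toAdd⟩ := by
    rw [hc]
    simp only [map_mul, map_inv]
    rw [HeisenbergSign.commutator_eq hxχ hyχ, ← hχ]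
    rfl
  have hpow : ∀ g : Γ, g ^ p ∈ ψ.ker → ∀ a : ℤ, (a : ZMod (p ^ 2)) = 0 → g ^ a ∈ T := by
    intro g hg a ha
    rw [ZMod.intCast_zmod_eq_zero_iff_dvd] at ha
    obtain ⟨m, rfl⟩ := ha
    rw [zpow_mul, zpow_natCast, pow_two, pow_mul]
    exact T.zpow_mem (hTp _ hg) m
  refine mem_of_forall_openNormalSubgroup hT fun U => ?_
  obtain ⟨u, ⟨⟨huU, huμ⟩, huχ⟩, hru⟩ := exists_mul_mem_of_dense (h.topologicalClosure hψ) r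
    (U ⊓ openKer μ hμ ⊓ openKer χ hlc)
  replace huμ : μ u = 1 := huμ
  replace huχ : χ u = 1 := huχ
  have hruμ : μ (r * u) = 1 := by
    rw [map_mul, huμ, mul_one]; exact hre
  have hruχ : χ (r * u) = 1 := by rw [map_mul, huχ, mul_one, hrχ]
  refine ⟨u, huU, ?_⟩
  -- The commutator condition on `T` makes `c` central modulo `T`, as the normal form requires.
  obtain ⟨a, b, k, t, ht, hg | hg⟩ := involutions_normal_form_mod T h.sq₀ h.sq₁ h.sq₂ hx hy hc
    (hTc x c hxr hcψ) (hTc y c hyr hcψ) hru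
  · have htμ : μ t = 1 := hTe t ht
    have htχ : χ t = 1 := hTχ ht
    have h1 : μ x ^ a * μ y ^ b = 1 := by
      rw [hg] at hruμ
      simpa [htμ, hcμ] using hruμ
    have h2 := (SignSemidirect.left_zpow_mul_zpow hxμ hyμ a b).1
    rw [h1] at h2
    -- Triviality modulo `p²` forces `p²` to divide `a` and `b`, so `x^a` and `y^b` are powers of
    -- `p`-th powers of elements of `ker ψ`. What remains is `c^k`, and the Heisenberg coordinate
    -- then gives `p ∣ k`.
    obtain ⟨ha, hb⟩ := eq_zero_of_det₂_isUnit hdetμ h2.symm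
    have hxa := hpow x hxp a ha
    have hyb := hpow y hyp b hb
    have hck : c ^ k ∈ T := by
      have h3 : χ c ^ k = 1 := by
        rw [hg] at hruχ
        have e1 : χ (x ^ a) = 1 := hTχ hxa
        have e2 : χ (y ^ b) = 1 := hTχ hyb
        rw [map_mul, map_mul, map_mul, e1, e2, htχ, one_mul, one_mul, mul_one, map_zpow] at hruχ
        exact hruχ
      rw [← pow_natAbs_eq_one, hcχ, HeisenbergSign.central_pow,
        HeisenbergSign.inl_central_eq_one_iff, hdet.mul_left_eq_zero,
        ZMod.natCast_eq_zero_iff, ← Int.natCast_dvd] at h3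
      obtain ⟨m, rfl⟩ := h3
      rw [zpow_mul, zpow_natCast]
      exact T.zpow_mem (hTp c hcψ) m
    rw [hg]
    exact T.mul_mem (T.mul_mem (T.mul_mem hxa hyb) hck) ht
  · exfalso
    have htμ : μ t = 1 := hTe t ht
    have h1 : μ (x ^ a * y ^ b) * μ s₁ = 1 := by
      rw [hg] at hruμ
      simpa [htμ, hcμ] using hruμ
    have h2 := congrArg (fun g : SignSemidirect (ZMod (p ^ 2) × ZMod (p ^ 2)) => g.right) h1
    have h3 : (μ (x ^ a * y ^ b)).right = 1 := by
      rw [map_mul, map_zpow, map_zpow]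
      exact (SignSemidirect.left_zpow_mul_zpow hxμ hyμ a b).2
    have h4 : (μ s₁).right = -1 := (right_of_lift hμψ _).trans h.right₁
    simp only [SemidirectProduct.mul_right, h3, h4, SemidirectProduct.one_right] at h2
    exact absurd h2 (by decide)

end Head

section HeadIso

variable {p : ℕ} [Fact p.Prime] {Γ : Type*} [Group Γ] [TopologicalSpace Γ] [IsTopologicalGroup Γ]
  {ψ : Γ →* SignSemidirect (ZMod p × ZMod p)}

/-- The head of the `p`-Frattini module, with the projection to its trivial component. -/
theorem InvolutionTriple.exists_head [CompactSpace Γ] [TotallyDisconnectedSpace Γ]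
    {s₀ s₁ s₂ : Γ} (h : InvolutionTriple ψ s₀ s₁ s₂) (hψ : IsUniversalPFrattiniCover p ψ)
    {e : Γ →* SignSemidirect (ℤ_[p] × ℤ_[p])} (he : Continuous e)
    (heψ : ∀ γ, SignSemidirect.map (padicSqToZMod p) (e γ) = ψ γ)
    {χ : Γ →* HeisenbergSign (ZMod p)} (hlc : IsLocallyConstant χ)
    (hχ : (HeisenbergSign.proj (ZMod p)).comp χ = ψ) :
    ∃ (Z : (pFrattiniRep p ψ hψ.surjective).asModule →ₗ[MonoidAlgebra (ZMod p)
        (SignSemidirect (ZMod p × ZMod p))] (Representation.trivial (ZMod p)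
          (SignSemidirect (ZMod p × ZMod p)) (ZMod p)).asModule)
      (B : (pFrattiniRep p ψ hψ.surjective).asModule →ₗ[MonoidAlgebra (ZMod p)
        (SignSemidirect (ZMod p × ZMod p))] (signRep (ZMod p) (ZMod p × ZMod p)).asModule ×
          (signRep (ZMod p) (ZMod p × ZMod p)).asModule),
      Function.Surjective (Z.prod B) ∧
      LinearMap.ker (Z.prod B) =
        Ring.jacobson (MonoidAlgebra (ZMod p) (SignSemidirect (ZMod p × ZMod p))) • ⊤ ∧
      χ.ker = extensionKer p ψ hψ.surjective (LinearMap.ker Z) := by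
  let τ := Representation.trivial (ZMod p) (SignSemidirect (ZMod p × ZMod p)) (ZMod p)
  let σ := signRep (ZMod p) (ZMod p × ZMod p)
  let J := Ring.jacobson (MonoidAlgebra (ZMod p) (SignSemidirect (ZMod p × ZMod p)))
  obtain ⟨ζ, hζcl, hζ, hζconj⟩ := exists_heisenbergCoord hlc hχ
  obtain ⟨Z, hZ⟩ := exists_linearMap_of_equivariant hψ.surjective τ hζcl
    (fun γ r => congrArg Multiplicative.toAdd (hζconj γ r))
  have hleft : ∀ r : ψ.ker, padicSqToZMod p (e r).left.toAdd = 0 := fun r => by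
    rw [← SignSemidirect.map_left_toAdd, heψ, (r.2 : ψ r = 1)]; rfl
  have h0₁ : ∀ r : ψ.ker, PadicInt.toZMod (e r).left.toAdd.1 = 0 := fun r =>
    congrArg Prod.fst (hleft r)
  have h0₂ : ∀ r : ψ.ker, PadicInt.toZMod (e r).left.toAdd.2 = 0 := fun r =>
    congrArg Prod.snd (hleft r)
  obtain ⟨A₁, hA₁⟩ := exists_linearMap_signRep hψ.surjective he heψ (AddMonoidHom.fst _ _)
    continuous_fst h0₁
  obtain ⟨A₂, hA₂⟩ := exists_linearMap_signRep hψ.surjective he heψ (AddMonoidHom.snd _ _)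
    continuous_snd h0₂
  have hZ0 : ∀ r : ψ.ker, Z (frattiniClass hψ.surjective r) = 0 ↔ χ r = 1 := by
    intro r
    rw [hZ, hζ, HeisenbergSign.inl_central_eq_one_iff]
    exact LinearEquiv.map_eq_zero_iff _
  have hA0 : ∀ r : ψ.ker, (A₁.prod A₂) (frattiniClass hψ.surjective r) = 0 ↔
      padicRed p 2 (e r) = 1 := by
    intro r
    obtain ⟨w₁, hw₁⟩ := PadicInt.toZMod_eq_zero_iff.1 (h0₁ r)
    obtain ⟨w₂, hw₂⟩ := PadicInt.toZMod_eq_zero_iff.1 (h0₂ r)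
    have hr : (padicRed p 2 (e r)).right = 1 := by
      change (e r).right = 1
      rw [right_padic heψ, (r.2 : ψ r = 1)]; rfl
    change (A₁ _, A₂ _) = (0 : σ.asModule × σ.asModule) ↔ _
    rw [hA₁ r w₁ hw₁, hA₂ r w₂ hw₂, SignSemidirect.ext_iff',
      padicRed_left, hw₁, hw₂, Prod.mk_eq_zero, LinearEquiv.map_eq_zero_iff,
      LinearEquiv.map_eq_zero_iff, ← PadicInt.toZModPow_two_eq_zero_iff (w := w₁),
      ← PadicInt.toZModPow_two_eq_zero_iff (w := w₂), ← Prod.mk_eq_zero]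
    exact (and_iff_left hr).symm
  have := Representation.isSimpleModule_of_self τ
  have := Representation.isSimpleModule_of_self σ
  have hJ : J • ⊤ ≤ LinearMap.ker (Z.prod (A₁.prod A₂)) := by
    rw [LinearMap.ker_prod, LinearMap.ker_prod]
    exact le_inf (jacobson_smul_top_le_ker Z)
      (le_inf (jacobson_smul_top_le_ker A₁) (jacobson_smul_top_le_ker A₂))
  refine ⟨Z, A₁.prod A₂, ?_, le_antisymm ?_ hJ, ?_⟩
  · rintro ⟨t, a₁, a₂⟩
    -- The classes of `x^p` and `y^p` have as signed components the coordinates of `ψ x` and `ψ y`,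
    -- which span, so `i` and `j` hit `(a₁, a₂)`. The class of `c` has no signed component.
    obtain ⟨i, j, hij⟩ := exists_zsmul_of_det₂_isUnit h.isUnit_det₂
      (σ.asModuleEquiv a₁, σ.asModuleEquiv a₂)
    rw [zsmul_add_zsmul_eq, Prod.ext_iff] at hij
    let X : ψ.ker := ⟨_, pow_mem_ker_of_right_eq_one h.right_mul₀₁⟩
    let Y : ψ.ker := ⟨_, pow_mem_ker_of_right_eq_one h.right_mul₁₂⟩
    have hxχ : (χ (s₀ * s₁)).right = 1 := by rw [← h.right_mul₀₁, ← hχ]; rfl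
    have hyχ : (χ (s₁ * s₂)).right = 1 := by rw [← h.right_mul₁₂, ← hχ]; rfl
    let C : ψ.ker := ⟨s₀ * s₁ * (s₁ * s₂) * (s₀ * s₁)⁻¹ * (s₁ * s₂)⁻¹, by
      rw [MonoidHom.mem_ker, map_mul, map_inv, map_mul, map_inv, map_mul,
        SignSemidirect.mul_comm_of_right_eq_one h.right_mul₀₁ h.right_mul₁₂]
      group⟩
    have hpow : ∀ g : Γ, (ψ g).right = 1 → (e (g ^ p)).left.toAdd = (p : ℤ) • (e g).left.toAdd := by
      intro g hg
      rw [map_pow, ← zpow_natCast]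
      exact (SignSemidirect.left_zpow ((right_padic heψ g).trans hg) _).1
    have hred : ∀ g : Γ, PadicInt.toZMod (e g).left.toAdd.1 = (ψ g).left.toAdd.1 ∧
        PadicInt.toZMod (e g).left.toAdd.2 = (ψ g).left.toAdd.2 := fun g => by
      rw [← heψ]; exact ⟨rfl, rfl⟩
    have hA : ∀ (r : ψ.ker) (g : Γ), (ψ g).right = 1 → (r : Γ) = g ^ p →
        σ.asModuleEquiv (A₁ (frattiniClass hψ.surjective r)) = (ψ g).left.toAdd.1 ∧
          σ.asModuleEquiv (A₂ (frattiniClass hψ.surjective r)) = (ψ g).left.toAdd.2 := by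
      intro r g hg hr
      have hw := hpow g hg
      rw [← hr, ← Prod.eta (e g).left.toAdd, Prod.smul_mk, zsmul_eq_mul, zsmul_eq_mul,
        Int.cast_natCast] at hw
      rw [hA₁ r _ (congrArg Prod.fst hw), hA₂ r _ (congrArg Prod.snd hw),
        LinearEquiv.apply_symm_apply, LinearEquiv.apply_symm_apply]
      exact hred g
    obtain ⟨hX₁, hX₂⟩ := hA X _ h.right_mul₀₁ rfl
    obtain ⟨hY₁, hY₂⟩ := hA Y _ h.right_mul₁₂ rfl
    have hC : (A₁.prod A₂) (frattiniClass hψ.surjective C) = 0 := by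
      rw [hA0, ← map_one (padicRed p 2)]
      refine congrArg _ ?_
      change e (s₀ * s₁ * (s₁ * s₂) * (s₀ * s₁)⁻¹ * (s₁ * s₂)⁻¹) = 1
      rw [map_mul, map_inv, map_mul, map_inv, map_mul, SignSemidirect.mul_comm_of_right_eq_one
        ((right_padic heψ _).trans h.right_mul₀₁) ((right_padic heψ _).trans h.right_mul₁₂)]
      group
    have hCZ : τ.asModuleEquiv (Z (frattiniClass hψ.surjective C)) =
        det₂ (ψ (s₀ * s₁)).left.toAdd (ψ (s₁ * s₂)).left.toAdd := by
      have h1 := hζ C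
      have h2 := HeisenbergSign.commutator_eq hxχ hyχ
      rw [← map_inv, ← map_inv, ← map_mul, ← map_mul, ← map_mul, ← MonoidHom.comp_apply,
        ← MonoidHom.comp_apply, hχ] at h2
      rw [hZ, LinearEquiv.apply_symm_apply]
      exact congrArg Heisenberg.z (SemidirectProduct.inl_injective (h1.symm.trans h2))
    -- The coefficient of `c` corrects the trivial component left by `x^p` and `y^p`, on dividing by
    -- the nonzero determinant.
    obtain ⟨k, hk⟩ := ZMod.intCast_surjective ((τ.asModuleEquiv t -
      ((i : ZMod p) * τ.asModuleEquiv (Z (frattiniClass hψ.surjective X)) +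
        (j : ZMod p) * τ.asModuleEquiv (Z (frattiniClass hψ.surjective Y)))) /
      det₂ (ψ (s₀ * s₁)).left.toAdd (ψ (s₁ * s₂)).left.toAdd)
    refine ⟨i • frattiniClass hψ.surjective X + j • frattiniClass hψ.surjective Y +
      k • frattiniClass hψ.surjective C, Prod.ext ?_ (Prod.ext ?_ ?_)⟩
    · change Z _ = t
      apply τ.asModuleEquiv.injective
      simp only [map_add, map_zsmul, hCZ, zsmul_eq_mul]
      rw [hk, div_mul_cancel₀ _ h.isUnit_det₂.ne_zero, add_sub_cancel]
    · change A₁ _ = a₁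
      apply σ.asModuleEquiv.injective
      have hC₁ : A₁ (frattiniClass hψ.surjective C) = 0 := congrArg Prod.fst hC
      simp only [map_add, map_zsmul, hC₁, hX₁, hY₁, smul_zero, add_zero, zsmul_eq_mul]
      exact hij.1.symm
    · change A₂ _ = a₂
      apply σ.asModuleEquiv.injective
      have hC₂ : A₂ (frattiniClass hψ.surjective C) = 0 := congrArg Prod.snd hC
      simp only [map_add, map_zsmul, hC₂, hX₂, hY₂, smul_zero, add_zero, zsmul_eq_mul]
      exact hij.2.symm
  · intro m hm
    obtain ⟨r, rfl⟩ := frattiniClass_surjective hψ.surjective m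
    have hmem : ∀ r : ψ.ker, frattiniClass hψ.surjective r ∈ LinearMap.ker (Z.prod (A₁.prod A₂)) →
        χ r = 1 ∧ padicRed p 2 (e r) = 1 := by
      intro r hr
      rw [LinearMap.ker_prod] at hr
      exact ⟨(hZ0 r).1 hr.1, (hA0 r).1 hr.2⟩
    have := extensionKer_normal (p := p) hψ.surjective (J • ⊤)
    -- The translations form a normal `p`-subgroup, so they act trivially modulo `J`. This supplies
    -- the commutator condition.
    have hVp : IsPGroup p (SignSemidirect.sign (A := ZMod p × ZMod p)).ker := by
      rintro ⟨v, hv⟩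
      refine ⟨1, Subtype.ext ?_⟩
      change v ^ p ^ 1 = 1
      rw [pow_one]
      exact pow_mem_ker_of_right_eq_one (ψ := MonoidHom.id _) hv
    have hr : (r : Γ) ∈ extensionKer p ψ hψ.surjective (J • ⊤) :=
      h.mem_of_padicRed_eq_one hψ he heψ hlc hχ
        (isClosed_extensionKer_jacobson hψ.surjective
          ((IsLocallyConstant.of_isOpen_ker hψ.isOpen_ker).isClosed_preimage {1}))
        (fun t ⟨h1, h2⟩ => (hmem ⟨t, h1⟩ (hJ h2)).2)
        (fun t ⟨h1, h2⟩ => (hmem ⟨t, h1⟩ (hJ h2)).1)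
        (fun r hr => pow_mem_extensionKer hψ.surjective _ hr)
        (fun u r hu hr => commutator_mem_extensionKer_jacobson hψ.surjective hVp hu hr)
        (hmem r hm).2 (hmem r hm).1
    exact hr.elim fun _ h => h
  · ext γ
    rw [mem_extensionKer_iff]
    constructor
    · intro hγ
      have hγψ : γ ∈ ψ.ker := by
        rw [MonoidHom.mem_ker, ← hχ, MonoidHom.comp_apply, (hγ : χ γ = 1), map_one]
      exact ⟨hγψ, (hZ0 ⟨γ, hγψ⟩).2 hγ⟩
    · rintro ⟨hγψ, hγ⟩
      exact (hZ0 ⟨γ, hγψ⟩).1 hγ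

/-- The trivial module occurs once in the head. -/
theorem existsUnique_quotient_trivial (hp : Odd p) {G : Type*} [Group G] {M : Type*} [AddCommGroup M]
    [Module (MonoidAlgebra (ZMod p) G) M] {N : Type*} [AddCommGroup N]
    [Module (MonoidAlgebra (ZMod p) G) N]
    {Z : M →ₗ[MonoidAlgebra (ZMod p) G] (Representation.trivial (ZMod p) G (ZMod p)).asModule}
    {B : M →ₗ[MonoidAlgebra (ZMod p) G] N} (hs : Function.Surjective (Z.prod B))
    (hker : LinearMap.ker (Z.prod B) = Ring.jacobson (MonoidAlgebra (ZMod p) G) • ⊤)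
    {g : G} (hg : ∀ n : N, MonoidAlgebra.of (ZMod p) G g • n = -n)
    (W' : Submodule (MonoidAlgebra (ZMod p) G) M) :
    Nonempty ((M ⧸ W') ≃ₗ[MonoidAlgebra (ZMod p) G]
      (Representation.trivial (ZMod p) G (ZMod p)).asModule) ↔ W' = LinearMap.ker Z := by
  let τ := Representation.trivial (ZMod p) G (ZMod p)
  have hsimple := Representation.isSimpleModule_of_self τ
  have hZs : Function.Surjective Z := fun t => by
    obtain ⟨m, hm⟩ := hs (t, 0)
    exact ⟨m, congrArg Prod.fst hm⟩
  have hτ : ∀ t : τ.asModule, MonoidAlgebra.of (ZMod p) G g • t = t := fun t => by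
    apply τ.asModuleEquiv.injective
    rw [Representation.asModuleEquiv_map_smul, Representation.asAlgebraHom_of]
    rfl
  constructor
  · rintro ⟨f⟩
    have hf : ∀ m, f (W'.mkQ m) = 0 ↔ m ∈ W' := fun m => by
      rw [LinearEquiv.map_eq_zero_iff, Submodule.mkQ_apply, Submodule.Quotient.mk_eq_zero]
    have hle : LinearMap.ker Z ≤ W' := by
      intro m hm
      rw [LinearMap.mem_ker] at hm
      -- On `ker Z` the element `g` acts as `-1` modulo `J M`, while it fixes the trivial quotient
      -- `M / W'`. Hence twice the image of `m` vanishes there, and `2` is invertible.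
      have h1 : MonoidAlgebra.of (ZMod p) G g • m + m ∈ LinearMap.ker (Z.prod B) := by
        rw [LinearMap.ker_prod]
        constructor
        · rw [SetLike.mem_coe, LinearMap.mem_ker, map_add, map_smul, hm, smul_zero, add_zero]
        · rw [SetLike.mem_coe, LinearMap.mem_ker, map_add, map_smul, hg, neg_add_cancel]
      have h2 := jacobson_smul_top_le_ker (f.toLinearMap.comp W'.mkQ) (hker ▸ h1)
      rw [LinearMap.mem_ker, map_add, map_smul, hτ] at h2
      rw [← hf]
      apply τ.asModuleEquiv.injective
      have h3 : τ.asModuleEquiv (f (W'.mkQ m)) + τ.asModuleEquiv (f (W'.mkQ m)) = 0 := by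
        rw [← map_add]
        exact congrArg _ h2
      rw [← two_mul] at h3
      exact (mul_eq_zero.1 h3).resolve_left (ZMod.two_ne_zero_of_odd hp)
    have hcoatom : IsCoatom (LinearMap.ker Z) := by
      rw [← isSimpleModule_iff_isCoatom]
      exact IsSimpleModule.congr (Z.quotKerEquivOfSurjective hZs)
    refine (hcoatom.le_iff_eq ?_).1 hle
    rintro rfl
    have := hsimple.nontrivial
    obtain ⟨t, ht⟩ := exists_ne (0 : τ.asModule)
    obtain ⟨m, rfl⟩ := f.surjective t
    obtain ⟨m, rfl⟩ := Submodule.mkQ_surjective _ m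
    exact ht ((hf m).2 trivial)
  · rintro rfl
    exact ⟨Z.quotKerEquivOfSurjective hZs⟩

end HeadIso

/-- `-1` acts on `𝟏⁻ ⊕ 𝟏⁻` as multiplication by `-1`. -/
theorem of_negOne_smul_signRep_prod {k A : Type*} [CommRing k] [AddCommGroup A]
    (n : (signRep k A).asModule × (signRep k A).asModule) :
    MonoidAlgebra.of k _ (SignSemidirect.negOne A) • n = -n := by
  have key : ∀ a : (signRep k A).asModule,
      MonoidAlgebra.of k _ (SignSemidirect.negOne A) • a = -a := fun a => by
    apply (signRep k A).asModuleEquiv.injective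
    rw [Representation.asModuleEquiv_map_smul, Representation.asAlgebraHom_of, map_neg]
    simp [signRep, SignSemidirect.negOne]
  exact Prod.ext (key n.1) (key n.2)

/-! ### The main theorem -/

theorem mainTheorem12 (p : ℕ) [Fact p.Prime] :
    IsFrattiniCover (Heisenberg.proj (ZMod p)) ∧
    (p ≠ 2 →
      (∃ (Γ : ProfiniteGrp.{0}) (ψ : Γ →* SignSemidirect (ZMod p × ZMod p)),
        IsUniversalPFrattiniCover p ψ) ∧
      ∀ (Γ : ProfiniteGrp.{u}) (ψ : Γ →* SignSemidirect (ZMod p × ZMod p))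
        (hψ : IsUniversalPFrattiniCover p ψ),
        -- the head of the `p`-Frattini module
        Nonempty (ModuleHead (MonoidAlgebra (ZMod p) (SignSemidirect (ZMod p × ZMod p)))
            (pFrattiniRep p ψ hψ.surjective).asModule
          ≃ₗ[MonoidAlgebra (ZMod p) (SignSemidirect (ZMod p × ZMod p))]
            (Representation.trivial (ZMod p) (SignSemidirect (ZMod p × ZMod p))
                (ZMod p)).asModule ×
              (signRep (ZMod p) (ZMod p × ZMod p)).asModule ×
                (signRep (ZMod p) (ZMod p × ZMod p)).asModule) ∧
        -- the extension defined by the trivial summand is the Heisenberg extension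
        (∃ W : Submodule (MonoidAlgebra (ZMod p) (SignSemidirect (ZMod p × ZMod p)))
            (pFrattiniRep p ψ hψ.surjective).asModule,
          (∀ W' : Submodule (MonoidAlgebra (ZMod p) (SignSemidirect (ZMod p × ZMod p)))
              (pFrattiniRep p ψ hψ.surjective).asModule,
            Nonempty (((pFrattiniRep p ψ hψ.surjective).asModule ⧸ W')
              ≃ₗ[MonoidAlgebra (ZMod p) (SignSemidirect (ZMod p × ZMod p))]
                (Representation.trivial (ZMod p) (SignSemidirect (ZMod p × ZMod p))
                  (ZMod p)).asModule) ↔ W' = W) ∧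
          ∃ χ : Γ →* HeisenbergSign (ZMod p), Function.Surjective χ ∧
            χ.ker = extensionKer p ψ hψ.surjective W ∧
            (HeisenbergSign.proj (ZMod p)).comp χ = ψ) ∧
        -- it obstructs every element of the (nonempty) Nielsen class at level 0
        (NielsenClass p (MonoidHom.id (SignSemidirect (ZMod p × ZMod p)))
          (classes24 (ZMod p × ZMod p))).Nonempty ∧
        (∀ g ∈ NielsenClass p (MonoidHom.id (SignSemidirect (ZMod p × ZMod p)))
            (classes24 (ZMod p × ZMod p)),
          (∃! h, IsPrimeLift p (HeisenbergSign.proj (ZMod p)) g h) ∧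
          ∀ h, IsPrimeLift p (HeisenbergSign.proj (ZMod p)) g h → (List.ofFn h).prod ≠ 1) ∧
        NielsenClass p (levelMap p ψ 1) (classes24 (ZMod p × ZMod p)) = ∅ ∧
        -- limit groups
        (∃ P : NielsenPath p ψ (classes24 (ZMod p × ZMod p)), P.IsMaximal) ∧
        ∀ P : NielsenPath p ψ (classes24 (ZMod p × ZMod p)), P.IsMaximal →
          (∀ k, P.ThroughLevel k ↔ k = 0) ∧
          Infinite P.limitGroup ∧
          ∃ e : P.limitGroup ≃ₜ* SignSemidirect (ℤ_[p] × ℤ_[p]),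
            ∀ γ : Γ, SignSemidirect.map (padicSqToZMod p) (e (QuotientGroup.mk γ)) = ψ γ) := by

  refine ⟨isFrattiniCover_heisenberg_proj p, fun hp2 => ?_⟩
  have hp : Odd p := (Fact.out : p.Prime).odd_of_ne_two hp2
  refine ⟨exists_isUniversalPFrattiniCover p _, fun Γ ψ hψ => ?_⟩
  obtain ⟨s₀, s₁, s₂, h⟩ := exists_involutionTriple hp hψ
  obtain ⟨e, he, hes, heψ⟩ := h.exists_hom_padic hψ
  obtain ⟨χ, hlc, hχs, hχ⟩ := exists_hom_heisenberg hψ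
  have hχ1 : levelKer p ψ 1 ≤ χ.ker := levelKer_one_le_ker hlc hχ
  obtain ⟨Z, B, hs, hker, hW⟩ := h.exists_head hψ he heψ hlc hχ
  refine ⟨⟨(Submodule.quotEquivOfEq _ _ hker.symm).trans
      ((Z.prod B).quotKerEquivOfSurjective hs)⟩,
    ⟨LinearMap.ker Z, existsUnique_quotient_trivial hp hs hker of_negOne_smul_signRep_prod,
      χ, hχs, hW, hχ⟩,
    nielsenClass_nonempty hp,
    fun g hg => ⟨existsUnique_isPrimeLift_heisenberg hp
      fun i => (((mem_nielsenClass_iff hp).1 hg).1 i).2,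
      fun k hk => isPrimeLift_heisenberg_prod_ne_one hp hg hk⟩,
    nielsenClass_eq_empty hp hχ hψ.surjective (levelKer_le_ker p ψ 1) hχ1,
    ⟨_, h.path_isMaximal he heψ hp hψ⟩, fun P hP => ?_⟩
  obtain ⟨f, hf⟩ := hP.exists_continuousMulEquiv he heψ hp hψ hes
  refine ⟨P.throughLevel_iff hp hψ hχ hχ1 he heψ hP, ?_, f, hf⟩
  -- The translations by `(n, 0)` for natural `n` are distinct because `ℤ_p` has characteristic
  -- zero.
  have : Function.Injective fun n : ℕ => f.symm (SemidirectProduct.inl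
      (Multiplicative.ofAdd ((n : ℤ_[p]), (0 : ℤ_[p])))) := fun m n hmn =>
    Nat.cast_injective (R := ℤ_[p]) (congrArg Prod.fst
      (Multiplicative.ofAdd.injective (SemidirectProduct.inl_injective (f.symm.injective hmn))))
  exact Infinite.of_injective _ this
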